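/- **Theorem (Boundedness).** Let $\Omega\subset\mathbb R^n$ be open, $T>0$, $\Omega_T=\Omega\times(0,T)$. Let $\Phi:\mathbb R^N\to\mathbb R$ be strictly convex and twice continuously differentiable, with $$\lambda|\xi|^2\le \Phi_{z_iz_j}(z)\,\xi^i\xi^j\le\Lambda|\xi|^2\qquad(z,\xi\in\mathbb R^N)$$ for some constants $\lambda>0$ and $\Lambda$, and suppose that $\Phi$ depends only on the norm: $\Phi(z)=\phi(|z|)$. Let $V(\Omega_T;\mathbb R^N)$ be the closure of the $C^1(\Omega_T;\mathbb R^N)$ functions under the norm $$\|v\|_{V}^2=\sup_{0<t<T}\int_\Omega|v(x,t)|^2\,dx+\iint_{\Omega_T}|\nabla v|^2\,dx\,dt ,$$ and let $\mathbf u\in V(\Omega_T;\mathbb R^N)$ be a weak solution of $\mathbf u_t-\Delta[\nabla\Phi(\mathbf u)]=0$, that is, $$\iint_{\Omega_T}-u^iw^i_t+(\Phi_{z_i}(\mathbf u))_{x_\alpha}w^i_{x_\alpha}\,dx\,dt=0\qquad\text{for all }\mathbf w\in H^1_0(\Omega_T;\mathbb R^N),$$ the derivatives $(\Phi_{z_i}(\mathbf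 u))_{x_\alpha}\in L^2(\Omega_T)$ being weak derivatives. The values $\mathbf u(\cdot,0)$ and $\mathbf u(\cdot,T)$ are the weak $L^2(\Omega)$ limits of $\mathbf u(\cdot,t)$ as $t\to0^+$ and $t\to T^-$. For a function $f$ on $\Omega$, let $\|f\|_{L^\infty(\partial\Omega)}\in[0,\infty]$ be the infimum of all $k\in[0,\infty)$ such that $|f|\le k$ on $\partial\Omega$ in the sense that $(|f|-k)^+\in H^1_0(\Omega)$ (and $\infty$ if there is no such $k$); here $H^1_0(\Omega)$ is the $H^1$-closure of $C_c^\infty(\Omega)$. Then for every $t\in[0,T]$, as an inequality in $[0,\infty]$, $$\|\mathbf u(\cdot,t)\|_{L^\infty(\Omega)}\le\max\Big\{\|\mathbf u(\cdot,0)\|_{L^\infty(\Omega)},\ \operatorname*{ess\,sup}_{0<s<t}\|\mathbf u(\cdot,s)\|_{L^\infty(\partial\Omega)}\Big\}$$ (the essential supremum being $0$ for $t=0$). In particular, if $\|\mathbf u(\cdot,0)\|_{L^\infty(\Omega)}<\infty$ and $\operatorname{ess\,sup}_{0<s<T}\|\mathbf u(\cdot,s)\|_{L^\infty(\partial\Omega)}<\infty$,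 then $\|\mathbf u\|_{L^\infty(\Omega_T)}<\infty$. -/

import Mathlib

open MeasureTheory Filter Topology Set
open scoped ENNReal NNReal ContDiff

noncomputable section

/-- `w ∈ H¹₀(U; F)` with weak derivative `Dw`: the pair `(w, Dw)` is the limit in `L²(U)` of
`(φ k, Dφ k)` for some sequence of smooth functions `φ k` compactly supported in `U`. -/
structure IsH10With {E F : Type*} [NormedAddCommGroup E] [NormedSpace ℝ E] [MeasureSpace E]
    [NormedAddCommGroup F] [NormedSpace ℝ F]
    (U : Set E) (w : E → F) (Dw : E → E →L[ℝ] F) : Prop where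
  memLp : MemLp w 2 (volume.restrict U)
  memLp_deriv : MemLp Dw 2 (volume.restrict U)
  approx : ∃ φ : ℕ → E → F,
    (∀ k, ContDiff ℝ ∞ (φ k) ∧ HasCompactSupport (φ k) ∧ tsupport (φ k) ⊆ U) ∧
    Tendsto (fun k => eLpNorm (fun x => φ k x - w x) 2 (volume.restrict U)) atTop (𝓝 0) ∧
    Tendsto (fun k => eLpNorm (fun x => fderiv ℝ (φ k) x - Dw x) 2 (volume.restrict U))
      atTop (𝓝 0)

/-- `w ∈ H¹₀(U; F)`. -/
def MemH10 {E F : Type*} [NormedAddCommGroup E] [NormedSpace ℝ E] [MeasureSpace E]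
    [NormedAddCommGroup F] [NormedSpace ℝ F] (U : Set E) (w : E → F) : Prop :=
  ∃ Dw : E → E →L[ℝ] F, IsH10With U w Dw

/-- The norm `‖f‖_{L^∞(∂Ω)} ∈ [0, ∞]` of the boundary values of a Sobolev function `f` on an
arbitrary open set `Ω`: the infimum of all `k ≥ 0` such that `|f| ≤ k` on `∂Ω` in the sense of
`H¹`, that is, `(|f| - k)⁺ ∈ H¹₀(Ω)`. -/
def boundaryNorm {E F : Type*} [NormedAddCommGroup E] [NormedSpace ℝ E] [MeasureSpace E]
    [NormedAddCommGroup F] (Ω : Set E) (f : E → F) : ℝ≥0∞ :=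
  ⨅ (k : ℝ≥0) (_ : MemH10 Ω (fun x => max (‖f x‖ - (k : ℝ)) 0)), (k : ℝ≥0∞)

/-- The cylinder `Ω × (0, T)` in `ℝⁿ × ℝ`. -/
def parabolicCylinder {n : ℕ} (Ω : Set (EuclideanSpace ℝ (Fin n))) (T : ℝ) :
    Set (EuclideanSpace ℝ (Fin n) × ℝ) :=
  Ω ×ˢ Ioo 0 T

/-- The spatial derivative at `p = (x, t)` of a function on `ℝⁿ × ℝ`. -/
def spatialDeriv {n N : ℕ} (v : EuclideanSpace ℝ (Fin n) × ℝ → EuclideanSpace ℝ (Fin N))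
    (p : EuclideanSpace ℝ (Fin n) × ℝ) :
    EuclideanSpace ℝ (Fin n) →L[ℝ] EuclideanSpace ℝ (Fin N) :=
  fderiv ℝ (fun x => v (x, p.2)) p.1

/-- `u ∈ V(Ω_T; ℝᴺ)`: `u(t, x)` is the limit of a sequence of functions `v k ∈ C¹(Ω_T; ℝᴺ)` of
finite `V`-norm, `‖v‖² = sup_{0<t<T} ∫_Ω |v(x,t)|² dx + ∬_{Ω_T} |∇v|² dx dt`, in that norm. The
`L²`-limit `Du` of the spatial gradients is the weak spatial gradient of `u`. -/
structure MemV {n N : ℕ} (Ω : Set (EuclideanSpace ℝ (Fin n))) (T : ℝ)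
    (u : ℝ → EuclideanSpace ℝ (Fin n) → EuclideanSpace ℝ (Fin N)) : Prop where
  aestronglyMeasurable :
    AEStronglyMeasurable (fun p : EuclideanSpace ℝ (Fin n) × ℝ => u p.2 p.1)
      (volume.restrict (parabolicCylinder Ω T))
  memLp_slice : ∀ t ∈ Ioo 0 T, MemLp (u t) 2 (volume.restrict Ω)
  approx : ∃ (v : ℕ → EuclideanSpace ℝ (Fin n) × ℝ → EuclideanSpace ℝ (Fin N))
    (Du : EuclideanSpace ℝ (Fin n) × ℝ →
      EuclideanSpace ℝ (Fin n) →L[ℝ] EuclideanSpace ℝ (Fin N)),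
    (∀ k, ContDiffOn ℝ 1 (v k) (parabolicCylinder Ω T)) ∧
    (∀ k, (⨆ t ∈ Ioo 0 T, eLpNorm (fun x => v k (x, t)) 2 (volume.restrict Ω)) < ⊤) ∧
    (∀ k, MemLp (spatialDeriv (v k)) 2 (volume.restrict (parabolicCylinder Ω T))) ∧
    MemLp Du 2 (volume.restrict (parabolicCylinder Ω T)) ∧
    Tendsto (fun k => ⨆ t ∈ Ioo 0 T,
      eLpNorm (fun x => v k (x, t) - u t x) 2 (volume.restrict Ω)) atTop (𝓝 0) ∧
    Tendsto (fun k => eLpNorm (fun p => spatialDeriv (v k) p - Du p) 2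
      (volume.restrict (parabolicCylinder Ω T))) atTop (𝓝 0)

/-- `H` is the weak spatial derivative on `Ω_T` of `f`. -/
structure IsWeakSpatialDeriv {n N : ℕ} (Ω : Set (EuclideanSpace ℝ (Fin n))) (T : ℝ)
    (f : EuclideanSpace ℝ (Fin n) × ℝ → EuclideanSpace ℝ (Fin N))
    (H : EuclideanSpace ℝ (Fin n) × ℝ →
      EuclideanSpace ℝ (Fin n) →L[ℝ] EuclideanSpace ℝ (Fin N)) : Prop where
  locallyIntegrableOn : LocallyIntegrableOn f (parabolicCylinder Ω T)
  locallyIntegrableOn_deriv : LocallyIntegrableOn H (parabolicCylinder Ω T)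
  integral_eq : ∀ ψ : EuclideanSpace ℝ (Fin n) × ℝ → ℝ,
    ContDiff ℝ ∞ ψ → HasCompactSupport ψ → tsupport ψ ⊆ parabolicCylinder Ω T →
    ∀ e : EuclideanSpace ℝ (Fin n),
      ∫ p in parabolicCylinder Ω T, (fderiv ℝ ψ p (e, 0)) • f p =
        - ∫ p in parabolicCylinder Ω T, ψ p • H p e

/-- The structural assumptions on `Φ`: it is strictly convex, of class `C²`, and
`lam |ξ|² ≤ Φ_{z_i z_j} ξ^i ξ^j ≤ Lam |ξ|²` with `lam > 0`. -/
structure IsDiffusionPotential {N : ℕ} (Φ : EuclideanSpace ℝ (Fin N) → ℝ) (lam Lam : ℝ) :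
    Prop where
  lam_pos : 0 < lam
  contDiff : ContDiff ℝ 2 Φ
  strictConvexOn : StrictConvexOn ℝ univ Φ
  lower : ∀ z ξ : EuclideanSpace ℝ (Fin N), lam * ‖ξ‖ ^ 2 ≤ fderiv ℝ (fderiv ℝ Φ) z ξ ξ
  upper : ∀ z ξ : EuclideanSpace ℝ (Fin N), fderiv ℝ (fderiv ℝ Φ) z ξ ξ ≤ Lam * ‖ξ‖ ^ 2

/-- `u` is a weak solution of `u_t - Δ[∇Φ(u)] = 0` in `Ω_T`: `u ∈ V(Ω_T; ℝᴺ)` and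
`∬_{Ω_T} -u^i w^i_t + (Φ_{z_i}(u))_{x_α} w^i_{x_α} dx dt = 0` for all `w ∈ H¹₀(Ω_T; ℝᴺ)`,
where the weak derivative `H` of `∇Φ(u)` is square integrable. -/
structure IsWeakSolution {n N : ℕ} (Ω : Set (EuclideanSpace ℝ (Fin n))) (T : ℝ)
    (Φ : EuclideanSpace ℝ (Fin N) → ℝ)
    (u : ℝ → EuclideanSpace ℝ (Fin n) → EuclideanSpace ℝ (Fin N)) : Prop where
  memV : MemV Ω T u
  weak_eq : ∃ H : EuclideanSpace ℝ (Fin n) × ℝ →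
      EuclideanSpace ℝ (Fin n) →L[ℝ] EuclideanSpace ℝ (Fin N),
    IsWeakSpatialDeriv Ω T (fun p => gradient Φ (u p.2 p.1)) H ∧
    MemLp H 2 (volume.restrict (parabolicCylinder Ω T)) ∧
    ∀ (w : EuclideanSpace ℝ (Fin n) × ℝ → EuclideanSpace ℝ (Fin N))
      (Dw : EuclideanSpace ℝ (Fin n) × ℝ →
        EuclideanSpace ℝ (Fin n) × ℝ →L[ℝ] EuclideanSpace ℝ (Fin N)),
      IsH10With (parabolicCylinder Ω T) w Dw →
      ∫ p in parabolicCylinder Ω T,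
        (- inner ℝ (u p.2 p.1) (Dw p (0, 1)) +
          ∑ α : Fin n, inner ℝ (H p (EuclideanSpace.single α 1))
            (Dw p (EuclideanSpace.single α 1, 0))) = 0

/-- `u(t, ·)` converges to `f` weakly in `L²(Ω)` along the filter `l` of times. Along
`t → 0⁺` and `t → T⁻` this determines the values `u(0, ·)` and `u(T, ·)`. -/
structure TendstoWeakL2 {n N : ℕ} (Ω : Set (EuclideanSpace ℝ (Fin n)))
    (u : ℝ → EuclideanSpace ℝ (Fin n) → EuclideanSpace ℝ (Fin N)) (l : Filter ℝ)
    (f : EuclideanSpace ℝ (Fin n) → EuclideanSpace ℝ (Fin N)) : Prop where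
  memLp : MemLp f 2 (volume.restrict Ω)
  tendsto : ∀ φ : EuclideanSpace ℝ (Fin n) → EuclideanSpace ℝ (Fin N),
    MemLp φ 2 (volume.restrict Ω) →
    Tendsto (fun t => ∫ x in Ω, inner ℝ (φ x) (u t x)) l (𝓝 (∫ x in Ω, inner ℝ (φ x) (f x)))

end

/-! Fix a level `k` above the initial bound and above the boundary bound, and take the convex radial
potential `truncPotential k` =: Ψ, which vanishes exactly where |z| ≤ k. Testing formally with w =
∇Ψ(u) = `truncField k u` gives d/dt ∫ Ψ(u) = -∬ ∇[∇Φ(u)] : ∇[∇Ψ(u)]. The integrand is the sum over α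
of ⟨D²Φ(u) u_α, D²Ψ(u) u_α⟩. Both potentials are radial, so both Hessians preserve the line through
z and its orthogonal complement, and D²Ψ acts as a nonnegative scalar on each of them. Hence the
integrand is nonnegative (`IsDiffusionPotential.inner_fderiv_truncField_nonneg`), the energy ∫ Ψ(u)
cannot grow, and it starts at zero.

Two points need care. First, w must vanish on the lateral boundary. If (|u| - k')⁺ lies in H¹₀ for
some k' < k, its test-function approximations supply cutoffs that equal 1 in the limit where |u| >
k, so w is in H¹₀ at almost every time (`isH10With_truncField`). Giving Ψ linear growth, with ∇Ψ and
D²Ψ bounded, keeps every product in L².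

Second, u has no time derivative. The equation is integrated in time against a fixed spatial test
function (`weak_eq_integrated`), and convexity of Ψ bounds a backward difference of the energy by a
pairing of the flux at time t - r with ∇w at time t (`truncEnergy_step`). Integration over t leaves
an average of the energy on (b - h, b), bounded by minus the integral over 0 < r < h of the
dissipation J(r) with time shift r (`integral_energy_le`). Translations are continuous in L², so J
is continuous at 0, where it is nonnegative. Dividing by h and letting h → 0, with weak lower
semicontinuity of the energy from the left (`eventually_truncEnergy_ge`), gives zero energy at time
b on every compact subset of Ω; this is `IsWeakSolution.ae_norm_le`. -/

section L2

/-! ### Limits of bilinear expressions in L² -/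

variable {α G₁ G₂ G₃ : Type*} [MeasurableSpace α] {μ : Measure α}
  [NormedAddCommGroup G₁] [NormedSpace ℝ G₁] [NormedAddCommGroup G₂] [NormedSpace ℝ G₂]
  [NormedAddCommGroup G₃] [NormedSpace ℝ G₃]

theorem tendsto_eLpNorm_two_of_dominated {G : Type*} [NormedAddCommGroup G] {f : ℕ → α → G} {g : α → ℝ}
    (hf : ∀ k, AEStronglyMeasurable (f k) μ) (hg : MemLp g 2 μ)
    (hle : ∀ k, ∀ᵐ x ∂μ, ‖f k x‖ ≤ g x)
    (hlim : ∀ᵐ x ∂μ, Tendsto (fun k => f k x) atTop (𝓝 0)) :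
    Tendsto (fun k => eLpNorm (f k) 2 μ) atTop (𝓝 0) := by
  have h2 : Tendsto (fun k => ∫⁻ x, ‖f k x‖ₑ ^ (2 : ℝ) ∂μ) atTop (𝓝 0) := by
    have := tendsto_lintegral_of_dominated_convergence' (μ := μ)
      (F := fun k x => ‖f k x‖ₑ ^ (2 : ℝ)) (f := fun _ => 0) (fun x => ‖g x‖ₑ ^ (2 : ℝ))
      (fun k => (hf k).enorm.pow_const _) (fun k => ?_) ?_ ?_
    · simpa using this
    · filter_upwards [hle k] with x hx
      gcongr
      rw [← ofReal_norm, ← ofReal_norm]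
      exact ENNReal.ofReal_le_ofReal (hx.trans (le_abs_self _))
    · have := hg.2
      rw [eLpNorm_lt_top_iff_lintegral_rpow_enorm_lt_top (by norm_num) (by norm_num)] at this
      simpa using this.ne
    · filter_upwards [hlim] with x hx
      have h1 : Tendsto (fun k => ‖f k x‖ₑ) atTop (𝓝 0) := by
        simpa using hx.enorm
      have := (ENNReal.continuous_rpow_const (y := 2)).tendsto 0 |>.comp h1
      simpa [Function.comp_def] using this
  have h3 := (ENNReal.continuous_rpow_const (y := 1 / 2)).tendsto 0 |>.comp h2
  simp only [Function.comp_def] at h3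
  rw [ENNReal.zero_rpow_of_pos (by norm_num)] at h3
  refine h3.congr fun k => ?_
  rw [eLpNorm_eq_lintegral_rpow_enorm_toReal (by norm_num) (by norm_num)]
  simp

theorem eLpNorm_bilin_le (L : G₁ →L[ℝ] G₂ →L[ℝ] G₃) {c : α → G₁} {g : α → G₂} {C : ℝ}
    (hc : ∀ᵐ x ∂μ, ‖c x‖ ≤ C) :
    eLpNorm (fun x => L (c x) (g x)) 2 μ ≤ ENNReal.ofReal (‖L‖ * C) * eLpNorm g 2 μ := by
  refine eLpNorm_le_mul_eLpNorm_of_ae_le_mul ?_ 2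
  filter_upwards [hc] with x hx
  refine (L.le_opNorm₂ _ _).trans ?_
  gcongr

theorem memLp_bilin_of_bound (L : G₁ →L[ℝ] G₂ →L[ℝ] G₃) {c : α → G₁} {g : α → G₂} {C : ℝ}
    (hcm : AEStronglyMeasurable c μ) (hc : ∀ᵐ x ∂μ, ‖c x‖ ≤ C) (hg : MemLp g 2 μ) :
    MemLp (fun x => L (c x) (g x)) 2 μ :=
  ⟨L.aestronglyMeasurable_comp₂ hcm hg.1, (eLpNorm_bilin_le L hc).trans_lt
    (ENNReal.mul_lt_top ENNReal.ofReal_lt_top hg.2)⟩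

/-- Write the difference as c_k (g_k - g') + (c_k - c') g'. The uniform bound on c_k handles the
first term and dominated convergence the second. This is the tool for chain and product rules, where
the coefficients are bounded nonlinear functions of approximants and converge only almost
everywhere. -/
theorem tendsto_eLpNorm_bilin (L : G₁ →L[ℝ] G₂ →L[ℝ] G₃) {c : ℕ → α → G₁} {c' : α → G₁}
    {g : ℕ → α → G₂} {g' : α → G₂} {C : ℝ} (hcm : ∀ k, AEStronglyMeasurable (c k) μ)
    (hc : ∀ k, ∀ᵐ x ∂μ, ‖c k x‖ ≤ C)
    (hlim : ∀ᵐ x ∂μ, Tendsto (fun k => c k x) atTop (𝓝 (c' x)))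
    (hg : ∀ k, AEStronglyMeasurable (g k) μ) (hg' : MemLp g' 2 μ)
    (hgl : Tendsto (fun k => eLpNorm (fun x => g k x - g' x) 2 μ) atTop (𝓝 0)) :
    Tendsto (fun k => eLpNorm (fun x => L (c k x) (g k x) - L (c' x) (g' x)) 2 μ)
      atTop (𝓝 0) := by
  have hc'm : AEStronglyMeasurable c' μ := aestronglyMeasurable_of_tendsto_ae atTop hcm hlim
  have hc' : ∀ᵐ x ∂μ, ‖c' x‖ ≤ C := by
    filter_upwards [hlim, ae_all_iff.2 hc] with x h1 h2
    exact le_of_tendsto h1.norm (Eventually.of_forall h2)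
  have hA : Tendsto (fun k => eLpNorm (fun x => L (c k x) (g k x - g' x)) 2 μ) atTop (𝓝 0) := by
    refine tendsto_of_tendsto_of_tendsto_of_le_of_le tendsto_const_nhds ?_
      (fun _ => zero_le) (fun k => eLpNorm_bilin_le L (hc k))
    simpa using ENNReal.Tendsto.const_mul hgl (Or.inr ENNReal.ofReal_ne_top)
  have hB : Tendsto (fun k => eLpNorm (fun x => L (c k x - c' x) (g' x)) 2 μ) atTop (𝓝 0) := by
    refine tendsto_eLpNorm_two_of_dominated (g := fun x => (‖L‖ * (C + C)) * ‖g' x‖)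
      (fun k => ?_) (hg'.norm.const_mul _) (fun k => ?_) ?_
    · exact L.aestronglyMeasurable_comp₂ ((hcm k).sub hc'm) hg'.1
    · filter_upwards [hc k, hc'] with x h1 h2
      refine (L.le_opNorm₂ _ _).trans ?_
      gcongr
      exact (norm_sub_le _ _).trans (add_le_add h1 h2)
    · filter_upwards [hlim] with x hx
      have h0 : Tendsto (fun k => c k x - c' x) atTop (𝓝 0) := by
        simpa using hx.sub_const (c' x)
      have := ((L.flip (g' x)).continuous.tendsto 0).comp h0
      simpa [Function.comp_def] using this
  refine tendsto_of_tendsto_of_tendsto_of_le_of_le tendsto_const_nhds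
    (by simpa only [add_zero] using hA.add hB) (fun _ => zero_le) (fun k => ?_)
  have h1 : AEStronglyMeasurable (fun x => L (c k x) (g k x - g' x)) μ :=
    L.aestronglyMeasurable_comp₂ (hcm k) ((hg k).sub hg'.1)
  have h2 : AEStronglyMeasurable (fun x => L (c k x - c' x) (g' x)) μ :=
    L.aestronglyMeasurable_comp₂ ((hcm k).sub hc'm) hg'.1
  have h3 : (fun x => L (c k x) (g k x) - L (c' x) (g' x)) =
      (fun x => L (c k x) (g k x - g' x)) + fun x => L (c k x - c' x) (g' x) := by
    ext x
    simp
  rw [h3]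
  exact eLpNorm_add_le h1 h2 one_le_two

theorem integrable_bilin (L : G₁ →L[ℝ] G₂ →L[ℝ] G₃) {f : α → G₁} {g : α → G₂}
    (hf : MemLp f 2 μ) (hg : MemLp g 2 μ) : Integrable (fun x => L (f x) (g x)) μ := by
  have h : Integrable (fun x => ‖f x‖ * ‖g x‖) μ := hf.norm.integrable_mul hg.norm
  refine (h.const_mul ‖L‖).mono' (L.aestronglyMeasurable_comp₂ hf.1 hg.1)
    (Eventually.of_forall fun x => ?_)
  rw [← mul_assoc]
  exact L.le_opNorm₂ _ _

theorem enorm_integral_bilin_le (L : G₁ →L[ℝ] G₂ →L[ℝ] G₃) {f : α → G₁} {g : α → G₂}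
    (hf : AEStronglyMeasurable f μ) (hg : AEStronglyMeasurable g μ) :
    ‖∫ x, L (f x) (g x) ∂μ‖ₑ ≤ ‖L‖ₑ * eLpNorm f 2 μ * eLpNorm g 2 μ := by
  refine (enorm_integral_le_lintegral_enorm _).trans ?_
  rw [← eLpNorm_one_eq_lintegral_enorm]
  refine eLpNorm_le_eLpNorm_mul_eLpNorm_of_nnnorm (p := 2) (q := 2) hf hg (fun a b => L a b)
    ‖L‖₊ (Eventually.of_forall fun x => ?_)
  exact L.le_opNorm₂ _ _

theorem tendsto_integral_bilin (L : G₁ →L[ℝ] G₂ →L[ℝ] G₃) {ι : Type*} {l : Filter ι}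
    {f : α → G₁} {g : ι → α → G₂}
    {g' : α → G₂} (hf : MemLp f 2 μ) (hg : ∀ k, MemLp (g k) 2 μ) (hg' : MemLp g' 2 μ)
    (hgl : Tendsto (fun k => eLpNorm (fun x => g k x - g' x) 2 μ) l (𝓝 0)) :
    Tendsto (fun k => ∫ x, L (f x) (g k x) ∂μ) l (𝓝 (∫ x, L (f x) (g' x) ∂μ)) := by
  rw [tendsto_iff_edist_tendsto_0]
  refine tendsto_of_tendsto_of_tendsto_of_le_of_le
    (h := fun k => ‖L‖ₑ * eLpNorm f 2 μ * eLpNorm (fun x => g k x - g' x) 2 μ)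
    tendsto_const_nhds ?_ (fun _ => zero_le) (fun k => ?_)
  · simpa using ENNReal.Tendsto.const_mul hgl
      (Or.inr (ENNReal.mul_ne_top enorm_ne_top hf.2.ne))
  · simp only
    rw [edist_eq_enorm_sub, ← integral_sub (integrable_bilin L hf (hg k)) (integrable_bilin L hf hg')]
    simp only [← map_sub]
    exact enorm_integral_bilin_le L hf.1 ((hg k).1.sub hg'.1)

theorem exists_subseq_tendsto_ae {G : Type*} [NormedAddCommGroup G] {f : ℕ → α → G} {g : α → G}
    (hf : ∀ k, AEStronglyMeasurable (f k) μ) (hg : AEStronglyMeasurable g μ)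
    (h : Tendsto (fun k => eLpNorm (fun x => f k x - g x) 2 μ) atTop (𝓝 0)) :
    ∃ ns : ℕ → ℕ, StrictMono ns ∧
      ∀ᵐ x ∂μ, Tendsto (fun k => f (ns k) x) atTop (𝓝 (g x)) :=
  (tendstoInMeasure_of_tendsto_eLpNorm (p := 2) (by norm_num) hf hg h).exists_seq_tendsto_ae

theorem LipschitzWith.tendsto_eLpNorm_comp {G G' : Type*} [NormedAddCommGroup G]
    [NormedAddCommGroup G'] {A : G → G'} {C : ℝ≥0} (hA : LipschitzWith C A)
    {ι : Type*} {l : Filter ι} {f : ι → α → G} {g : α → G}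
    (h : Tendsto (fun k => eLpNorm (fun x => f k x - g x) 2 μ) l (𝓝 0)) :
    Tendsto (fun k => eLpNorm (fun x => A (f k x) - A (g x)) 2 μ) l (𝓝 0) := by
  refine tendsto_of_tendsto_of_tendsto_of_le_of_le
    (h := fun k => ENNReal.ofReal C * eLpNorm (fun x => f k x - g x) 2 μ)
    tendsto_const_nhds ?_ (fun _ => zero_le) (fun k => ?_)
  · have := ENNReal.Tendsto.const_mul (a := ENNReal.ofReal C) h (Or.inr ENNReal.ofReal_ne_top)
    rwa [mul_zero] at this
  · exact eLpNorm_le_mul_eLpNorm_of_ae_le_mul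
      (Eventually.of_forall fun x => hA.norm_sub_le _ _) 2

end L2

/-! ### The squared positive part -/

theorem hasDerivAt_sq_posPart (r : ℝ) :
    HasDerivAt (fun x : ℝ => max x 0 ^ 2) (2 * max r 0) r := by
  rcases lt_trichotomy r 0 with h | h | h
  · rw [max_eq_right h.le, mul_zero]
    refine (hasDerivAt_const r (0 : ℝ)).congr_of_eventuallyEq ?_
    filter_upwards [Iio_mem_nhds h] with x hx
    simp [max_eq_right (mem_Iio.1 hx).le]
  · subst h
    rw [max_self, mul_zero, hasDerivAt_iff_isLittleO_nhds_zero]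
    have h1 : (fun h : ℝ => max (0 + h) 0 ^ 2 - max (0 : ℝ) 0 ^ 2 - h • (0 : ℝ))
        =O[𝓝 0] fun h : ℝ => h ^ 2 := by
      refine Asymptotics.IsBigO.of_bound 1 (Eventually.of_forall fun x => ?_)
      rcases le_total x 0 with hx | hx <;> simp [hx]; positivity
    exact h1.trans_isLittleO (by simpa using Asymptotics.isLittleO_pow_pow (𝕜 := ℝ) one_lt_two)
  · rw [max_eq_left h.le]
    have := (hasDerivAt_pow 2 r)
    refine HasDerivAt.congr_of_eventuallyEq (by simpa using this) ?_
    filter_upwards [Ioi_mem_nhds h] with x hx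
    simp [max_eq_left (mem_Ioi.1 hx).le]

theorem contDiff_sq_posPart : ContDiff ℝ 1 (fun x : ℝ => max x 0 ^ 2) := by
  rw [contDiff_one_iff_deriv]
  refine ⟨fun r => (hasDerivAt_sq_posPart r).differentiableAt, ?_⟩
  have : deriv (fun x : ℝ => max x 0 ^ 2) = fun r => 2 * max r 0 :=
    funext fun r => (hasDerivAt_sq_posPart r).deriv
  rw [this]
  fun_prop

/-! ### A cutoff function of class `C¹` -/

/-- A `C¹` function vanishing at `0` and equal to `1` on `[δ, ∞)`. -/
noncomputable def cutoff (δ r : ℝ) : ℝ := 1 - max (1 - (r / δ) ^ 2) 0 ^ 2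

theorem cutoff_zero (δ : ℝ) : cutoff δ 0 = 0 := by simp [cutoff]

theorem cutoff_of_le {δ r : ℝ} (hδ : 0 < δ) (h : δ ≤ r) : cutoff δ r = 1 := by
  have : 1 ≤ r / δ := (one_le_div hδ).2 h
  have h2 : 1 - (r / δ) ^ 2 ≤ 0 := by nlinarith
  simp [cutoff, max_eq_right h2]

theorem contDiff_cutoff (δ : ℝ) : ContDiff ℝ 1 (cutoff δ) :=
  contDiff_const.sub (contDiff_sq_posPart.comp (f := fun r : ℝ => 1 - (r / δ) ^ 2) (by fun_prop))

theorem abs_cutoff_le (δ r : ℝ) : |cutoff δ r| ≤ 1 := by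
  have h1 : 0 ≤ max (1 - (r / δ) ^ 2) 0 := le_max_right _ _
  have h2 : max (1 - (r / δ) ^ 2) 0 ≤ 1 := max_le (by nlinarith [sq_nonneg (r / δ)]) zero_le_one
  rw [cutoff, abs_le]
  constructor <;> nlinarith

theorem hasDerivAt_cutoff (δ r : ℝ) :
    HasDerivAt (cutoff δ) (2 * max (1 - (r / δ) ^ 2) 0 * (2 * (r / δ) * (1 / δ))) r := by
  have h1 : HasDerivAt (fun r : ℝ => 1 - (r / δ) ^ 2) (-(2 * (r / δ) * (1 / δ))) r := by
    have := (((hasDerivAt_id r).div_const δ).pow 2).const_sub 1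
    simpa using this
  have := ((hasDerivAt_sq_posPart _).comp r h1).const_sub 1
  exact this.congr_deriv (by ring)

theorem abs_deriv_cutoff_le {δ : ℝ} (hδ : 0 < δ) (r : ℝ) : |deriv (cutoff δ) r| ≤ 4 / δ := by
  rw [(hasDerivAt_cutoff δ r).deriv]
  have h1 : |max (1 - (r / δ) ^ 2) 0 * (r / δ)| ≤ 1 := by
    rcases le_total (1 - (r / δ) ^ 2) 0 with h | h
    · simp [max_eq_right h]
    · rw [max_eq_left h, abs_mul]
      have h2 : |r / δ| ≤ 1 := by rw [← sq_le_one_iff_abs_le_one]; linarith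
      have h3 : |1 - (r / δ) ^ 2| ≤ 1 := by
        rw [abs_of_nonneg h]; nlinarith [sq_nonneg (r / δ)]
      exact mul_le_one₀ h3 (abs_nonneg _) h2
  have h4 : 2 * max (1 - (r / δ) ^ 2) 0 * (2 * (r / δ) * (1 / δ))
      = (4 / δ) * (max (1 - (r / δ) ^ 2) 0 * (r / δ)) := by ring
  rw [h4, abs_mul, abs_of_pos (by positivity : 0 < 4 / δ)]
  exact mul_le_of_le_one_right (by positivity) h1

theorem deriv_cutoff_of_le {δ r : ℝ} (hδ : 0 < δ) (h : δ ≤ r) : deriv (cutoff δ) r = 0 := by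
  have : 1 ≤ r / δ := (one_le_div hδ).2 h
  have h2 : 1 - (r / δ) ^ 2 ≤ 0 := by nlinarith
  rw [(hasDerivAt_cutoff δ r).deriv, max_eq_right h2]
  ring

/-! ### The profile of the truncation potential -/

/-- A bounded nondecreasing `C¹` function, positive exactly on `(0, ∞)`. -/
noncomputable def profile (r : ℝ) : ℝ := max r 0 ^ 2 / (1 + r ^ 2)

theorem contDiff_profile : ContDiff ℝ 1 profile :=
  contDiff_sq_posPart.div (by fun_prop) (fun x => by positivity)

theorem continuous_profile : Continuous profile := contDiff_profile.continuous

theorem profile_of_nonpos {r : ℝ} (h : r ≤ 0) : profile r = 0 := by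
  simp [profile, max_eq_right h]

theorem profile_nonneg (r : ℝ) : 0 ≤ profile r := by unfold profile; positivity

theorem profile_pos {r : ℝ} (h : 0 < r) : 0 < profile r := by
  rw [profile, max_eq_left h.le]; positivity

theorem profile_le_one (r : ℝ) : profile r ≤ 1 := by
  rw [profile, div_le_one (by positivity)]
  rcases le_total r 0 with h | h
  · rw [max_eq_right h]; nlinarith
  · rw [max_eq_left h]; linarith

theorem hasDerivAt_profile (r : ℝ) :
    HasDerivAt profile (2 * max r 0 / (1 + r ^ 2) ^ 2) r := by
  have h1 : HasDerivAt (fun r : ℝ => 1 + r ^ 2) (2 * r) r := by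
    simpa using (hasDerivAt_pow 2 r).const_add 1
  have h2 := (hasDerivAt_sq_posPart r).div h1 (by positivity)
  refine HasDerivAt.congr_deriv (f := profile) h2 ?_
  congr 1
  rcases le_total r 0 with h | h
  · simp [max_eq_right h]
  · rw [max_eq_left h]; ring

theorem deriv_profile_nonneg (r : ℝ) : 0 ≤ deriv profile r := by
  rw [(hasDerivAt_profile r).deriv]; positivity

theorem deriv_profile_le (r : ℝ) : deriv profile r ≤ 1 := by
  rw [(hasDerivAt_profile r).deriv, div_le_one (by positivity)]
  rcases le_total r 0 with h | h
  · rw [max_eq_right h]; nlinarith [sq_nonneg (1 + r ^ 2)]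
  · rw [max_eq_left h]; nlinarith [sq_nonneg (r - 1), sq_nonneg (r ^ 2)]

theorem deriv_profile_of_nonpos {r : ℝ} (h : r ≤ 0) : deriv profile r = 0 := by
  rw [(hasDerivAt_profile r).deriv, max_eq_right h]; simp

theorem monotone_profile : Monotone profile :=
  monotone_of_deriv_nonneg (fun r => (hasDerivAt_profile r).differentiableAt) deriv_profile_nonneg

/-- The primitive of `profile`. -/
noncomputable def profilePrim (r : ℝ) : ℝ := ∫ s in (0 : ℝ)..r, profile s

/-- Convexity of the primitive in subgradient form: `profile` is monotone, so its integral between b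
and a is compared with its value at b. -/
theorem profilePrim_sub_ge (a b : ℝ) :
    profile b * (a - b) ≤ profilePrim a - profilePrim b := by
  have hint : ∀ x y, IntervalIntegrable profile volume x y :=
    fun x y => continuous_profile.intervalIntegrable x y
  have h0 : profilePrim a - profilePrim b = ∫ s in b..a, profile s := by
    rw [profilePrim, profilePrim, intervalIntegral.integral_interval_sub_left (hint _ _) (hint _ _)]
  rw [h0]
  rcases le_total b a with h | h
  · have := intervalIntegral.integral_mono_on h (intervalIntegrable_const (c := profile b))
      (hint b a) (fun x hx => monotone_profile hx.1)
    rw [intervalIntegral.integral_const, smul_eq_mul] at this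
    linarith
  · rw [intervalIntegral.integral_symm]
    have := intervalIntegral.integral_mono_on h (hint a b)
      (intervalIntegrable_const (c := profile b)) (fun x hx => monotone_profile hx.2)
    rw [intervalIntegral.integral_const, smul_eq_mul] at this
    linarith

theorem continuous_profilePrim : Continuous profilePrim :=
  intervalIntegral.continuous_primitive (fun a b => continuous_profile.intervalIntegrable a b) 0

theorem profilePrim_zero : profilePrim 0 = 0 := by simp [profilePrim]

theorem profilePrim_nonneg (r : ℝ) : 0 ≤ profilePrim r := by
  have := profilePrim_sub_ge r 0
  rw [profile_of_nonpos le_rfl, profilePrim_zero] at this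
  linarith

theorem profilePrim_of_nonpos {r : ℝ} (h : r ≤ 0) : profilePrim r = 0 := by
  have := profilePrim_sub_ge 0 r
  rw [profile_of_nonpos h, profilePrim_zero] at this
  linarith [profilePrim_nonneg r]

theorem profilePrim_pos {r : ℝ} (h : 0 < r) : 0 < profilePrim r := by
  have h1 := profilePrim_sub_ge r (r / 2)
  have h2 := mul_pos (profile_pos (half_pos h)) (by linarith : 0 < r - r / 2)
  linarith [profilePrim_nonneg (r / 2)]

theorem profilePrim_le (r : ℝ) : profilePrim r ≤ |r| := by
  rcases le_total r 0 with h | h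
  · rw [profilePrim_of_nonpos h]; positivity
  · have h1 := profilePrim_sub_ge 0 r
    have h2 := profile_le_one r
    rw [profilePrim_zero] at h1
    rw [abs_of_nonneg h]
    nlinarith

/-! ### The truncation potential -/

section Truncation

variable {F : Type*} [NormedAddCommGroup F]

/-- The regularized norm `(1 + |z|²)^(1/2)`. -/
noncomputable def bracket (z : F) : ℝ := √(1 + ‖z‖ ^ 2)

theorem bracket_sq (z : F) : bracket z ^ 2 = 1 + ‖z‖ ^ 2 := Real.sq_sqrt (by positivity)

theorem bracket_pos (z : F) : 0 < bracket z := Real.sqrt_pos.2 (by positivity)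

theorem one_le_bracket (z : F) : 1 ≤ bracket z := by
  have h1 := bracket_sq z
  nlinarith [bracket_pos z, sq_nonneg ‖z‖]

theorem norm_le_bracket (z : F) : ‖z‖ ≤ bracket z := by
  have h1 := bracket_sq z
  nlinarith [bracket_pos z, norm_nonneg z]

/-- A convex potential of linear growth, positive exactly on `{|z| > k}`. -/
noncomputable def truncPotential (k : ℝ) (z : F) : ℝ :=
  profilePrim (bracket z - √(1 + k ^ 2))

theorem bracket_le_of_norm_le {k : ℝ} {z : F} (h : ‖z‖ ≤ k) :
    bracket z - √(1 + k ^ 2) ≤ 0 := by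
  rw [sub_nonpos]
  exact Real.sqrt_le_sqrt (by gcongr)

theorem lt_bracket_of_lt_norm {k : ℝ} (hk : 0 ≤ k) {z : F} (h : k < ‖z‖) :
    0 < bracket z - √(1 + k ^ 2) := by
  rw [sub_pos]
  exact Real.sqrt_lt_sqrt (by positivity) (by gcongr)

theorem truncPotential_nonneg (k : ℝ) (z : F) : 0 ≤ truncPotential k z := profilePrim_nonneg _

theorem truncPotential_of_le {k : ℝ} {z : F} (h : ‖z‖ ≤ k) : truncPotential k z = 0 :=
  profilePrim_of_nonpos (bracket_le_of_norm_le h)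

theorem truncPotential_pos {k : ℝ} (hk : 0 ≤ k) {z : F} (h : k < ‖z‖) :
    0 < truncPotential k z :=
  profilePrim_pos (lt_bracket_of_lt_norm hk h)

/-- Since √(1 + k²) ≥ 1, the argument is at most `bracket z - 1`, hence at most `bracket z ^ 2 - 1`.
A bound by |z|², without a constant term, makes the energy finite for L² functions even when Ω has
infinite measure. -/
theorem truncPotential_le (k : ℝ) (z : F) : truncPotential k z ≤ ‖z‖ ^ 2 := by
  rcases le_total (bracket z - √(1 + k ^ 2)) 0 with h | h
  · rw [truncPotential, profilePrim_of_nonpos h]; positivity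
  · refine (profilePrim_le _).trans ?_
    rw [abs_of_nonneg h]
    have h1 : 1 ≤ √(1 + k ^ 2) := Real.one_le_sqrt.2 (by nlinarith [sq_nonneg k])
    nlinarith [bracket_sq z, one_le_bracket z]

variable [InnerProductSpace ℝ F]

/-- Convexity of `bracket`, multiplied through by `bracket z`. It is the Cauchy–Schwarz inequality
for the vectors (1, z) and (1, y), whose norms are the brackets. -/
theorem inner_le_bracket_mul_sub (y z : F) :
    inner ℝ z (y - z) ≤ bracket z * (bracket y - bracket z) := by
  have h1 := bracket_sq z
  have h2 := bracket_sq y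
  have h3 := real_inner_le_norm z y
  have h4 : 1 + ‖z‖ * ‖y‖ ≤ bracket z * bracket y := by
    refine le_of_sq_le_sq ?_ (by positivity [bracket_pos z, bracket_pos y])
    rw [mul_pow, h1, h2]
    nlinarith [sq_nonneg (‖z‖ - ‖y‖)]
  rw [inner_sub_right, real_inner_self_eq_norm_sq]
  nlinarith

theorem contDiff_bracket : ContDiff ℝ ∞ (bracket : F → ℝ) :=
  (contDiff_const.add (contDiff_norm_sq ℝ)).sqrt (fun z => by positivity)

theorem hasFDerivAt_bracket (z : F) :
    HasFDerivAt (bracket : F → ℝ) ((bracket z)⁻¹ • innerSL ℝ z) z := by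
  have h1 : HasFDerivAt (fun z : F => 1 + ‖z‖ ^ 2) (2 • innerSL ℝ z) z :=
    ((hasStrictFDerivAt_norm_sq z).hasFDerivAt).const_add 1
  refine HasFDerivAt.congr_fderiv (h1.sqrt (by positivity)) ?_
  ext ξ
  have : √(1 + ‖z‖ ^ 2) = bracket z := rfl
  rw [this]
  simp
  ring

/-- The gradient of `truncPotential k`. -/
noncomputable def truncField (k : ℝ) (z : F) : F :=
  (profile (bracket z - √(1 + k ^ 2)) / bracket z) • z

theorem continuous_truncPotential (k : ℝ) : Continuous (truncPotential k : F → ℝ) :=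
  continuous_profilePrim.comp (contDiff_bracket.continuous.sub continuous_const)

/-- A nondecreasing convex function of a convex function is convex: the two subgradient inequalities
compose because `profile` is nonnegative. -/
theorem inner_truncField_le (k : ℝ) (y z : F) :
    inner ℝ (truncField k z) (y - z) ≤ truncPotential k y - truncPotential k z := by
  refine le_trans ?_ (profilePrim_sub_ge _ _)
  rw [truncField, real_inner_smul_left, div_mul_eq_mul_div, div_le_iff₀ (bracket_pos z)]
  have := mul_le_mul_of_nonneg_left (inner_le_bracket_mul_sub y z)
    (profile_nonneg (bracket z - √(1 + k ^ 2)))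
  linarith

theorem truncField_of_le {k : ℝ} {z : F} (h : ‖z‖ ≤ k) : truncField k z = 0 := by
  rw [truncField, profile_of_nonpos (bracket_le_of_norm_le h)]
  simp

theorem norm_truncField_le (k : ℝ) (z : F) : ‖truncField k z‖ ≤ 1 := by
  rw [truncField, norm_smul, Real.norm_of_nonneg
    (div_nonneg (profile_nonneg _) (bracket_pos z).le), div_mul_eq_mul_div,
    div_le_one (bracket_pos z)]
  nlinarith [profile_le_one (bracket z - √(1 + k ^ 2)), norm_le_bracket z, norm_nonneg z]

theorem contDiff_truncField (k : ℝ) : ContDiff ℝ 1 (truncField k : F → F) := by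
  have hb : ContDiff ℝ 1 (bracket : F → ℝ) := contDiff_bracket.of_le (by norm_cast)
  exact ((contDiff_profile.comp (hb.sub contDiff_const)).div hb
    (fun z => (bracket_pos z).ne')).smul contDiff_id

/-- A multiple of the identity plus a rank-one map along z. This form exhibits the eigenspaces, the
line through z and its orthogonal complement, on which the sign of the dissipation depends. -/
theorem fderiv_truncField_apply (k : ℝ) (z ξ : F) :
    fderiv ℝ (truncField k) z ξ =
      (profile (bracket z - √(1 + k ^ 2)) / bracket z) • ξ +
      ((deriv profile (bracket z - √(1 + k ^ 2)) / bracket z ^ 2 -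
        profile (bracket z - √(1 + k ^ 2)) / bracket z ^ 3) * inner ℝ z ξ) • z := by
  have hb := hasFDerivAt_bracket z
  have hp := bracket_pos z
  have h1 : HasDerivAt (fun r => profile (r - √(1 + k ^ 2)) / r)
      ((deriv profile (bracket z - √(1 + k ^ 2)) * bracket z -
        profile (bracket z - √(1 + k ^ 2)) * 1) / bracket z ^ 2) (bracket z) := by
    refine HasDerivAt.div ?_ (hasDerivAt_id _) hp.ne'
    have := (hasDerivAt_profile (bracket z - √(1 + k ^ 2))).differentiableAt.hasDerivAt
    exact HasDerivAt.comp_sub_const (bracket z) _ this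
  have h2 := (h1.comp_hasFDerivAt z hb).smul (hasFDerivAt_id z)
  have h3 : HasFDerivAt (truncField k : F → F) _ z := h2
  rw [h3.fderiv]
  simp [smul_smul]
  congr 1
  field_simp

theorem norm_fderiv_truncField_le (k : ℝ) (z : F) : ‖fderiv ℝ (truncField k) z‖ ≤ 3 := by
  refine ContinuousLinearMap.opNorm_le_bound _ (by norm_num) fun ξ => ?_
  rw [fderiv_truncField_apply]
  set p := profile (bracket z - √(1 + k ^ 2)) with hp
  set q := deriv profile (bracket z - √(1 + k ^ 2)) with hq
  have hp0 : 0 ≤ p := profile_nonneg _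
  have hp1 : p ≤ 1 := profile_le_one _
  have hq0 : 0 ≤ q := deriv_profile_nonneg _
  have hq1 : q ≤ 1 := deriv_profile_le _
  have hb := one_le_bracket z
  have hz := norm_le_bracket z
  have hb0 := bracket_pos z
  have h1 : ‖(p / bracket z) • ξ‖ ≤ ‖ξ‖ := by
    rw [norm_smul, Real.norm_of_nonneg (by positivity)]
    exact mul_le_of_le_one_left (norm_nonneg _) ((div_le_one hb0).2 (hp1.trans hb))
  -- The rank-one term carries two factors of z, absorbed by `bracket z ^ 2`. It contributes at most
  -- 2, and the isotropic term at most 1.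
  have h2 : |q / bracket z ^ 2 - p / bracket z ^ 3| * bracket z ^ 2 ≤ 2 := by
    rw [← abs_of_pos (by positivity : 0 < bracket z ^ 2), ← abs_mul,
      abs_of_pos (by positivity : 0 < bracket z ^ 2)]
    have : (q / bracket z ^ 2 - p / bracket z ^ 3) * bracket z ^ 2 = q - p / bracket z := by
      field_simp
    rw [this]
    have h3 : 0 ≤ p / bracket z := by positivity
    have h4 : p / bracket z ≤ 1 := (div_le_one hb0).2 (hp1.trans hb)
    rw [abs_le]
    constructor <;> linarith
  have h5 : ‖((q / bracket z ^ 2 - p / bracket z ^ 3) * inner ℝ z ξ) • z‖ ≤ 2 * ‖ξ‖ := by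
    rw [norm_smul, norm_mul, Real.norm_eq_abs]
    calc |q / bracket z ^ 2 - p / bracket z ^ 3| * ‖(inner ℝ z ξ : ℝ)‖ * ‖z‖
        ≤ |q / bracket z ^ 2 - p / bracket z ^ 3| * (‖z‖ * ‖ξ‖) * ‖z‖ := by
          gcongr; exact norm_inner_le_norm z ξ
      _ = |q / bracket z ^ 2 - p / bracket z ^ 3| * ‖z‖ ^ 2 * ‖ξ‖ := by ring
      _ ≤ |q / bracket z ^ 2 - p / bracket z ^ 3| * bracket z ^ 2 * ‖ξ‖ := by gcongr
      _ ≤ 2 * ‖ξ‖ := by gcongr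
  linarith [norm_add_le ((p / bracket z) • ξ)
    (((q / bracket z ^ 2 - p / bracket z ^ 3) * inner ℝ z ξ) • z)]

theorem fderiv_truncField_of_le {k : ℝ} {z : F} (h : ‖z‖ ≤ k) :
    fderiv ℝ (truncField k) z = 0 := by
  ext ξ
  rw [fderiv_truncField_apply, profile_of_nonpos (bracket_le_of_norm_le h),
    deriv_profile_of_nonpos (bracket_le_of_norm_le h)]
  simp

theorem lipschitzWith_truncField (k : ℝ) : LipschitzWith 3 (truncField k : F → F) :=
  lipschitzWith_of_nnnorm_fderiv_le ((contDiff_truncField k).differentiable one_ne_zero)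
    (fun z => norm_fderiv_truncField_le k z)

theorem continuous_fderiv_truncField (k : ℝ) :
    Continuous (fderiv ℝ (truncField k : F → F)) :=
  (contDiff_truncField k).continuous_fderiv one_ne_zero

end Truncation

/-! ### Radial diffusion potentials -/

section Potential

variable {N : ℕ} {Φ : EuclideanSpace ℝ (Fin N) → ℝ} {lam Lam : ℝ}

theorem IsDiffusionPotential.hessian_symm (hΦ : IsDiffusionPotential Φ lam Lam)
    (z ξ η : EuclideanSpace ℝ (Fin N)) :
    fderiv ℝ (fderiv ℝ Φ) z ξ η = fderiv ℝ (fderiv ℝ Φ) z η ξ :=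
  (hΦ.contDiff.contDiffAt.isSymmSndFDerivAt (by simp)).eq ξ η

/-- Polarization: 4 B(ξ, η) = B(ξ + η, ξ + η) - B(ξ - η, ξ - η), and for unit vectors both terms lie
in [0, 4|Lam|]. The absolute value covers N = 0, where `Lam` may be negative. -/
theorem IsDiffusionPotential.hessian_norm_le (hΦ : IsDiffusionPotential Φ lam Lam)
    (z : EuclideanSpace ℝ (Fin N)) : ‖fderiv ℝ (fderiv ℝ Φ) z‖ ≤ |Lam| := by
  have hlow : ∀ ξ, 0 ≤ fderiv ℝ (fderiv ℝ Φ) z ξ ξ := fun ξ =>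
    le_trans (mul_nonneg hΦ.lam_pos.le (by positivity)) (hΦ.lower z ξ)
  have hup : ∀ ξ, fderiv ℝ (fderiv ℝ Φ) z ξ ξ ≤ |Lam| * ‖ξ‖ ^ 2 := fun ξ =>
    (hΦ.upper z ξ).trans (by gcongr; exact le_abs_self _)
  have hunit : ∀ ξ η : EuclideanSpace ℝ (Fin N), ‖ξ‖ = 1 → ‖η‖ = 1 →
      |fderiv ℝ (fderiv ℝ Φ) z ξ η| ≤ |Lam| := by
    intro ξ η hξ hη
    have h1 := hup (ξ + η)
    have h2 := hup (ξ - η)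
    have h3 := hlow (ξ + η)
    have h4 := hlow (ξ - η)
    have h5 := hΦ.hessian_symm z ξ η
    have h6 : ‖ξ + η‖ ^ 2 ≤ 4 := by
      have := norm_add_le ξ η
      rw [hξ, hη] at this
      nlinarith [norm_nonneg (ξ + η)]
    have h7 : ‖ξ - η‖ ^ 2 ≤ 4 := by
      have := norm_sub_le ξ η
      rw [hξ, hη] at this
      nlinarith [norm_nonneg (ξ - η)]
    simp only [map_add, map_sub, add_apply,
      sub_apply] at h1 h2 h3 h4
    have h8 := mul_le_mul_of_nonneg_left h6 (abs_nonneg Lam)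
    have h9 := mul_le_mul_of_nonneg_left h7 (abs_nonneg Lam)
    rw [abs_le]
    constructor <;> linarith
  refine ContinuousLinearMap.opNorm_le_bound₂ _ (abs_nonneg _) fun ξ η => ?_
  rcases eq_or_ne ξ 0 with rfl | hξ
  · simp
  rcases eq_or_ne η 0 with rfl | hη
  · simp
  have hξ' := norm_pos_iff.2 hξ
  have hη' := norm_pos_iff.2 hη
  have := hunit (‖ξ‖⁻¹ • ξ) (‖η‖⁻¹ • η) (by rw [norm_smul, norm_inv, norm_norm, inv_mul_cancel₀ hξ'.ne'])
    (by rw [norm_smul, norm_inv, norm_norm, inv_mul_cancel₀ hη'.ne'])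
  simp only [map_smul, smul_apply, smul_eq_mul, abs_mul, abs_inv,
    abs_norm] at this
  rw [Real.norm_eq_abs]
  have h10 : |fderiv ℝ (fderiv ℝ Φ) z ξ η| =
      (‖η‖⁻¹ * (‖ξ‖⁻¹ * |fderiv ℝ (fderiv ℝ Φ) z ξ η|)) * (‖ξ‖ * ‖η‖) := by
    field_simp
  rw [h10, mul_assoc |Lam|]
  gcongr

theorem IsDiffusionPotential.contDiff_gradient (hΦ : IsDiffusionPotential Φ lam Lam) :
    ContDiff ℝ 1 (gradient Φ) :=
  (InnerProductSpace.toDual ℝ (EuclideanSpace ℝ (Fin N))).symm.contDiff.comp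
    (hΦ.contDiff.fderiv_right (m := 1) (by norm_num))

theorem IsDiffusionPotential.inner_fderiv_gradient (hΦ : IsDiffusionPotential Φ lam Lam)
    (z ξ η : EuclideanSpace ℝ (Fin N)) :
    inner ℝ (fderiv ℝ (gradient Φ) z ξ) η = fderiv ℝ (fderiv ℝ Φ) z ξ η := by
  have h1 : HasFDerivAt (fderiv ℝ Φ) (fderiv ℝ (fderiv ℝ Φ) z) z :=
    ((hΦ.contDiff.fderiv_right (m := 1) (by norm_num)).differentiable one_ne_zero z).hasFDerivAt
  have h2 := ((hΦ.contDiff_gradient.differentiable one_ne_zero z).hasFDerivAt)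
  have h3 : HasFDerivAt (fun y => inner ℝ (gradient Φ y) η)
      ((innerSL ℝ η).comp (fderiv ℝ (gradient Φ) z)) z := by
    have := (innerSL ℝ η).hasFDerivAt.comp z h2
    refine this.congr_of_eventuallyEq (Eventually.of_forall fun y => ?_)
    simp
  have h4 : HasFDerivAt (fun y => fderiv ℝ Φ y η) ((fderiv ℝ (fderiv ℝ Φ) z).flip η) z :=
    (ContinuousLinearMap.apply ℝ ℝ η).hasFDerivAt.comp z h1
  have h5 : (fun y => inner ℝ (gradient Φ y) η) = fun y => fderiv ℝ Φ y η := by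
    ext y
    simp [gradient]
  rw [h5] at h3
  have := congrArg (fun A => A ξ) (h3.unique h4)
  simpa [real_inner_comm] using this

theorem IsDiffusionPotential.norm_fderiv_gradient_le (hΦ : IsDiffusionPotential Φ lam Lam)
    (z : EuclideanSpace ℝ (Fin N)) : ‖fderiv ℝ (gradient Φ) z‖ ≤ |Lam| := by
  refine ContinuousLinearMap.opNorm_le_bound _ (abs_nonneg _) fun ξ => ?_
  have h1 := hΦ.inner_fderiv_gradient z ξ (fderiv ℝ (gradient Φ) z ξ)
  rw [real_inner_self_eq_norm_sq] at h1
  have h2 := (fderiv ℝ (fderiv ℝ Φ) z).le_opNorm₂ ξ (fderiv ℝ (gradient Φ) z ξ)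
  rw [← h1, Real.norm_of_nonneg (by positivity)] at h2
  have h3 := hΦ.hessian_norm_le z
  rcases (norm_nonneg (fderiv ℝ (gradient Φ) z ξ)).eq_or_lt with h | h
  · rw [← h]; positivity
  · have h4 : ‖fderiv ℝ (gradient Φ) z ξ‖ ≤ ‖fderiv ℝ (fderiv ℝ Φ) z‖ * ‖ξ‖ := by nlinarith
    exact h4.trans (by gcongr)

/-- For η orthogonal to z, the vectors z + sη and z - sη have the same norm, so Φ is even in s along
this line and its derivative at s = 0 vanishes. No regularity of the profile φ is needed. -/
theorem fderiv_radial_apply_eq_zero (hd : Differentiable ℝ Φ) {φ : ℝ → ℝ}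
    (hφ : ∀ z, Φ z = φ ‖z‖) {z η : EuclideanSpace ℝ (Fin N)} (h : inner ℝ z η = 0) :
    fderiv ℝ Φ z η = 0 := by
  have hline : ∀ v : EuclideanSpace ℝ (Fin N),
      HasDerivAt (fun s : ℝ => Φ (z + s • v)) (fderiv ℝ Φ z v) 0 :=
    fun v => (hd z).hasFDerivAt.hasLineDerivAt v
  have h1 := hline η
  have h2 := hline (-η)
  have h3 : (fun s : ℝ => Φ (z + s • η)) = fun s : ℝ => Φ (z + s • (-η)) := by
    ext s
    rw [hφ, hφ]
    congr 1
    rw [smul_neg, ← sub_eq_add_neg]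
    refine (sq_eq_sq₀ (norm_nonneg _) (norm_nonneg _)).1 ?_
    rw [norm_add_sq_real, norm_sub_sq_real, real_inner_smul_right, h]
    ring
  rw [← h3] at h2
  have h4 := h1.unique h2
  rw [map_neg] at h4
  linarith

/-- Along the ray z + sz every point is orthogonal to η, so the derivative of Φ in direction η is
identically zero there; differentiating in s gives the claim. With symmetry, the Hessian does not
mix radial and tangential directions. -/
theorem IsDiffusionPotential.hessian_radial (hΦ : IsDiffusionPotential Φ lam Lam)
    {φ : ℝ → ℝ} (hφ : ∀ z, Φ z = φ ‖z‖) {z η : EuclideanSpace ℝ (Fin N)}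
    (h : inner ℝ z η = 0) : fderiv ℝ (fderiv ℝ Φ) z z η = 0 := by
  have hd : Differentiable ℝ Φ := hΦ.contDiff.differentiable two_ne_zero
  have h1 : HasFDerivAt (fderiv ℝ Φ) (fderiv ℝ (fderiv ℝ Φ) z) z :=
    ((hΦ.contDiff.fderiv_right (m := 1) (by norm_num)).differentiable one_ne_zero z).hasFDerivAt
  have h4 : HasFDerivAt (fun y => fderiv ℝ Φ y η) ((fderiv ℝ (fderiv ℝ Φ) z).flip η) z :=
    (ContinuousLinearMap.apply ℝ ℝ η).hasFDerivAt.comp z h1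
  have h5 := h4.hasLineDerivAt z
  have h6 : (fun s : ℝ => fderiv ℝ Φ (z + s • z) η) = fun _ => 0 := by
    ext s
    refine fderiv_radial_apply_eq_zero hd hφ ?_
    rw [inner_add_left, real_inner_smul_left, h]
    simp
  unfold HasLineDerivAt at h5
  rw [h6] at h5
  simpa using h5.unique (hasDerivAt_const _ _)

/-- The algebraic heart, and the place where radiality of Φ is indispensable: a product of two
positive symmetric maps has no sign in general, but here the maps share the splitting into radial
and tangential directions. -/
theorem IsDiffusionPotential.inner_fderiv_truncField_nonneg (hΦ : IsDiffusionPotential Φ lam Lam)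
    {φ : ℝ → ℝ} (hφ : ∀ z, Φ z = φ ‖z‖) (k : ℝ) (z ξ : EuclideanSpace ℝ (Fin N)) :
    0 ≤ inner ℝ (fderiv ℝ (gradient Φ) z ξ) (fderiv ℝ (truncField k) z ξ) := by
  rw [fderiv_truncField_apply, inner_add_right, real_inner_smul_right, real_inner_smul_right,
    hΦ.inner_fderiv_gradient, hΦ.inner_fderiv_gradient]
  set p := profile (bracket z - √(1 + k ^ 2)) with hp
  set q := deriv profile (bracket z - √(1 + k ^ 2)) with hq
  have hp0 : 0 ≤ p := profile_nonneg _
  have hq0 : 0 ≤ q := deriv_profile_nonneg _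
  have hb0 := bracket_pos z
  have hlow : ∀ ξ, 0 ≤ fderiv ℝ (fderiv ℝ Φ) z ξ ξ := fun ξ =>
    le_trans (mul_nonneg hΦ.lam_pos.le (by positivity)) (hΦ.lower z ξ)
  rcases eq_or_ne z 0 with rfl | hz
  · simp only [inner_zero_left, mul_zero, zero_mul, add_zero]
    exact mul_nonneg (by positivity) (hlow ξ)
  have hz' : 0 < ‖z‖ := norm_pos_iff.2 hz
  -- Split ξ into its projection onto z and a tangential remainder; the mixed Hessian terms then
  -- vanish.
  obtain ⟨c, η, hη, rfl⟩ : ∃ (c : ℝ) (η : EuclideanSpace ℝ (Fin N)),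
      inner ℝ z η = 0 ∧ ξ = c • z + η := by
    refine ⟨inner ℝ z ξ / ‖z‖ ^ 2, ξ - (inner ℝ z ξ / ‖z‖ ^ 2) • z, ?_, by simp⟩
    rw [inner_sub_right, real_inner_smul_right, real_inner_self_eq_norm_sq]
    field_simp
    simp
  have h1 := hΦ.hessian_radial hφ hη
  have h2 := hΦ.hessian_symm z η z
  rw [h1] at h2
  simp only [map_add, map_smul, add_apply, smul_apply,
    h1, h2, inner_add_right, real_inner_smul_right, hη, real_inner_self_eq_norm_sq, smul_eq_mul]
  have h3 := hlow z
  have h4 := hlow η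
  set Q := fderiv ℝ (fderiv ℝ Φ) z z z
  set R := fderiv ℝ (fderiv ℝ Φ) z η η
  have h5 : ‖z‖ ^ 2 = bracket z ^ 2 - 1 := by rw [bracket_sq]; ring
  have h6 : 0 ≤ q * ‖z‖ ^ 2 / bracket z ^ 2 + p / bracket z ^ 3 := by positivity
  -- The rank-one coefficient may be negative, but on the radial direction it combines with the
  -- isotropic part: by |z|² = `bracket z ^ 2 - 1`, the radial eigenvalue is q|z|²/b² + p/b³ ≥ 0,
  -- with b = `bracket z`.
  have h7 : p / bracket z * (c * (c * Q) + R) +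
      (q / bracket z ^ 2 - p / bracket z ^ 3) * (c * ‖z‖ ^ 2) * (c * Q)
      = c ^ 2 * Q * (q * ‖z‖ ^ 2 / bracket z ^ 2 + p / bracket z ^ 3) + p / bracket z * R := by
    rw [h5]
    field_simp
    ring
  refine le_of_le_of_eq (b := c ^ 2 * Q * (q * ‖z‖ ^ 2 / bracket z ^ 2 + p / bracket z ^ 3) +
    p / bracket z * R) (by positivity) ?_
  rw [← h7]
  ring

end Potential

/-! ### Combining L² limits -/

theorem tendsto_eLpNorm_sub_self {α G : Type*} [MeasurableSpace α] {μ : Measure α}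
    [NormedAddCommGroup G] (g : α → G) :
    Tendsto (fun _ : ℕ => eLpNorm (fun x => g x - g x) 2 μ) atTop (𝓝 0) := by
  simp

theorem tendsto_eLpNorm_sub_add {α G : Type*} [MeasurableSpace α] {μ : Measure α}
    [NormedAddCommGroup G] {f g : ℕ → α → G} {f' g' : α → G}
    (hf : ∀ j, AEStronglyMeasurable (f j) μ) (hf' : AEStronglyMeasurable f' μ)
    (hg : ∀ j, AEStronglyMeasurable (g j) μ) (hg' : AEStronglyMeasurable g' μ)
    (h1 : Tendsto (fun j => eLpNorm (fun x => f j x - f' x) 2 μ) atTop (𝓝 0))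
    (h2 : Tendsto (fun j => eLpNorm (fun x => g j x - g' x) 2 μ) atTop (𝓝 0)) :
    Tendsto (fun j => eLpNorm (fun x => f j x + g j x - (f' x + g' x)) 2 μ) atTop (𝓝 0) := by
  refine tendsto_of_tendsto_of_tendsto_of_le_of_le tendsto_const_nhds
    (by simpa only [add_zero] using h1.add h2) (fun _ => zero_le) (fun j => ?_)
  have h5 : (fun x => f j x + g j x - (f' x + g' x)) =
      (fun x => f j x - f' x) + fun x => g j x - g' x := by
    ext x
    simp only [Pi.add_apply]
    abel
  rw [h5]
  exact eLpNorm_add_le ((hf j).sub hf') ((hg j).sub hg') one_le_two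

theorem tendsto_eLpNorm_sub_trans {α G : Type*} [MeasurableSpace α] {μ : Measure α}
    [NormedAddCommGroup G] {f g : ℕ → α → G} {g' : α → G} {ε : ℕ → ℝ≥0∞}
    (hf : ∀ j, AEStronglyMeasurable (f j) μ) (hg : ∀ j, AEStronglyMeasurable (g j) μ)
    (hg' : AEStronglyMeasurable g' μ) (h1 : ∀ j, eLpNorm (fun x => f j x - g j x) 2 μ ≤ ε j)
    (hε : Tendsto ε atTop (𝓝 0))
    (h2 : Tendsto (fun j => eLpNorm (fun x => g j x - g' x) 2 μ) atTop (𝓝 0)) :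
    Tendsto (fun j => eLpNorm (fun x => f j x - g' x) 2 μ) atTop (𝓝 0) := by
  refine tendsto_of_tendsto_of_tendsto_of_le_of_le tendsto_const_nhds
    (by simpa only [add_zero] using hε.add h2) (fun _ => zero_le) (fun j => ?_)
  have h5 : (fun x => f j x - g' x) = (fun x => f j x - g j x) + fun x => g j x - g' x := by
    ext x
    simp
  rw [h5]
  exact (eLpNorm_add_le ((hf j).sub (hg j)) ((hg j).sub hg') one_le_two).trans
    (add_le_add (h1 j) le_rfl)

theorem tendsto_eLpNorm_of_uniform {E G : Type*} [TopologicalSpace E] [T2Space E]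
    [MeasurableSpace E] [OpensMeasurableSpace E] [NormedAddCommGroup G] {K : Set E}
    (hK : IsCompact K) {f : ℕ → E → G} {g : E → G}
    (hsupp : ∀ j, ∀ x ∉ K, f j x = g x)
    (h : TendstoUniformly f g atTop) (μ : Measure E) [IsFiniteMeasureOnCompacts μ] :
    Tendsto (fun j => eLpNorm (fun x => f j x - g x) 2 μ) atTop (𝓝 0) := by
  rw [ENNReal.tendsto_nhds_zero]
  intro ε hε
  have hKm : μ K ^ (1 / (2 : ℝ≥0∞).toReal) ≠ ⊤ :=
    (ENNReal.rpow_lt_top_of_nonneg (by simp) hK.measure_lt_top.ne).ne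
  obtain ⟨d, hd, hdε⟩ : ∃ d : ℝ, 0 < d ∧
      ENNReal.ofReal d * μ K ^ (1 / (2 : ℝ≥0∞).toReal) ≤ ε := by
    have h1 : Tendsto (fun d : ℝ => ENNReal.ofReal d * μ K ^ (1 / (2 : ℝ≥0∞).toReal))
        (𝓝[>] 0) (𝓝 0) := by
      have : Tendsto (fun d : ℝ => ENNReal.ofReal d) (𝓝[>] 0) (𝓝 0) := by
        have := (ENNReal.continuous_ofReal.tendsto 0).mono_left (nhdsWithin_le_nhds (s := Ioi 0))
        simpa using this
      simpa using ENNReal.Tendsto.mul_const this (Or.inr hKm)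
    obtain ⟨d, h2, h3⟩ := ((h1.eventually_le_const hε).and self_mem_nhdsWithin).exists
    exact ⟨d, h3, h2⟩
  filter_upwards [Metric.tendstoUniformly_iff.1 h d hd] with j hj
  refine le_trans ?_ hdε
  have h2 : eLpNorm (fun x => f j x - g x) 2 μ ≤
      eLpNorm (K.indicator fun _ => d) 2 μ := by
    refine eLpNorm_mono_real fun x => ?_
    by_cases hx : x ∈ K
    · rw [indicator_of_mem hx, ← dist_eq_norm, dist_comm]
      exact (hj x).le
    · rw [hsupp j x hx, indicator_of_notMem hx]
      simp
  refine h2.trans ((eLpNorm_indicator_const_le d 2).trans ?_)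
  rw [← ofReal_norm, Real.norm_of_nonneg hd.le]

/-! ### The space `H¹₀` -/

section H10

variable {E F : Type*} [NormedAddCommGroup E] [NormedSpace ℝ E] [MeasureSpace E]
  [NormedAddCommGroup F] [NormedSpace ℝ F] {U : Set E}

theorem IsH10With.of_contDiff [BorelSpace E] [FiniteDimensional ℝ E]
    [IsFiniteMeasureOnCompacts (volume : Measure E)]
    {φ : E → F} (h : ContDiff ℝ ∞ φ) (hc : HasCompactSupport φ) (hs : tsupport φ ⊆ U) :
    IsH10With U φ (fderiv ℝ φ) where
  memLp := (h.continuous.memLp_of_hasCompactSupport hc).restrict U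
  memLp_deriv := ((h.continuous_fderiv (by simp)).memLp_of_hasCompactSupport
    (hc.fderiv ℝ)).restrict U
  approx := ⟨fun _ => φ, fun _ => ⟨h, hc, hs⟩, tendsto_eLpNorm_sub_self _, tendsto_eLpNorm_sub_self _⟩

end H10

/-! ### Closedness of H¹₀ and mollification -/

section FiniteDim

variable {E F : Type*} [NormedAddCommGroup E] [NormedSpace ℝ E] [FiniteDimensional ℝ E]
  [MeasureSpace E] [BorelSpace E] [NormedAddCommGroup F] [NormedSpace ℝ F] {U : Set E}

/-- Diagonal argument: for each j a test function within 1/(j + 1) of the j-th pair, in both norms.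
-/
theorem IsH10With.of_tendsto {w : ℕ → E → F} {Dw : ℕ → E → E →L[ℝ] F} {w' : E → F}
    {Dw' : E → E →L[ℝ] F} (h : ∀ j, IsH10With U (w j) (Dw j))
    (hw : MemLp w' 2 (volume.restrict U)) (hDw : MemLp Dw' 2 (volume.restrict U))
    (h1 : Tendsto (fun j => eLpNorm (fun x => w j x - w' x) 2 (volume.restrict U)) atTop (𝓝 0))
    (h2 : Tendsto (fun j => eLpNorm (fun x => Dw j x - Dw' x) 2 (volume.restrict U))
      atTop (𝓝 0)) :
    IsH10With U w' Dw' := by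
  refine ⟨hw, hDw, ?_⟩
  have key : ∀ j : ℕ, ∃ φ : E → F,
      (ContDiff ℝ ∞ φ ∧ HasCompactSupport φ ∧ tsupport φ ⊆ U) ∧
      eLpNorm (fun x => φ x - w j x) 2 (volume.restrict U) < ((j : ℝ≥0∞) + 1)⁻¹ ∧
      eLpNorm (fun x => fderiv ℝ φ x - Dw j x) 2 (volume.restrict U) < ((j : ℝ≥0∞) + 1)⁻¹ := by
    intro j
    obtain ⟨φ, hφ, ha, hb⟩ := (h j).approx
    have hpos : 0 < ((j : ℝ≥0∞) + 1)⁻¹ := ENNReal.inv_pos.2 (by finiteness)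
    obtain ⟨i, hi1, hi2⟩ := ((ha.eventually_lt_const hpos).and
      (hb.eventually_lt_const hpos)).exists
    exact ⟨φ i, hφ i, hi1, hi2⟩
  choose φ hφ ha hb using key
  have hlim : Tendsto (fun j : ℕ => ((j : ℝ≥0∞) + 1)⁻¹) atTop (𝓝 0) := by
    have := ENNReal.tendsto_inv_nat_nhds_zero.comp (tendsto_add_atTop_nat 1)
    simpa [Function.comp_def] using this
  exact ⟨φ, hφ,
    tendsto_eLpNorm_sub_trans (fun j => (hφ j).1.continuous.aestronglyMeasurable)
      (fun j => (h j).memLp.1) hw.1 (fun j => (ha j).le) hlim h1,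
    tendsto_eLpNorm_sub_trans
      (fun j => ((hφ j).1.continuous_fderiv (by simp)).aestronglyMeasurable)
      (fun j => (h j).memLp_deriv.1) hDw.1 (fun j => (hb j).le) hlim h2⟩

variable [(volume : Measure E).IsAddHaarMeasure] [CompleteSpace F]

theorem tendstoUniformly_convolution_bump {G : Type*} [NormedAddCommGroup G] [NormedSpace ℝ G]
    [CompleteSpace G] {g : E → G} (hg : Continuous g) (hgc : HasCompactSupport g)
    {ρ : ℕ → ContDiffBump (0 : E)} (hρ : Tendsto (fun j => (ρ j).rOut) atTop (𝓝 0)) :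
    TendstoUniformly (fun j => convolution ((ρ j).normed volume) g
      (ContinuousLinearMap.lsmul ℝ ℝ) volume) g atTop := by
  rw [Metric.tendstoUniformly_iff]
  intro ε hε
  obtain ⟨d, hd, hdg⟩ := Metric.uniformContinuous_iff.1
    (hgc.uniformContinuous_of_continuous hg) (ε / 2) (half_pos hε)
  filter_upwards [hρ.eventually_lt_const hd] with j hj x
  rw [dist_comm]
  refine lt_of_le_of_lt ((ρ j).dist_normed_convolution_le hg.aestronglyMeasurable
    (ε := ε / 2) fun y hy => (hdg ?_).le) (half_lt_self hε)
  exact (Metric.mem_ball.1 hy).trans hj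

/-- Mollification. The definition of H¹₀ asks for smooth approximants, whereas truncations and
cutoffs are only C¹. -/
theorem IsH10With.of_contDiff_one {f : E → F} (hf : ContDiff ℝ 1 f) (hc : HasCompactSupport f)
    (hU : IsOpen U) (hs : tsupport f ⊆ U) : IsH10With U f (fderiv ℝ f) := by
  -- All mollification radii stay at most δ, so every mollified function is supported in one compact
  -- K inside U, and uniform convergence upgrades to L² convergence.
  obtain ⟨δ, hδ, hδU⟩ := hc.isCompact.exists_cthickening_subset_open hU hs
  set K := Metric.cthickening δ (tsupport f) with hK
  have hKc : IsCompact K := hc.isCompact.cthickening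
  let ρ : ℕ → ContDiffBump (0 : E) := fun j =>
    ⟨δ / (j + 1) / 2, δ / (j + 1), by positivity, half_lt_self (by positivity)⟩
  have hρ : Tendsto (fun j => (ρ j).rOut) atTop (𝓝 0) := by
    have := (tendsto_one_div_add_atTop_nhds_zero_nat (𝕜 := ℝ)).const_mul δ
    simpa [ρ, div_eq_mul_inv] using this
  let φ : ℕ → E → F := fun j => convolution ((ρ j).normed volume) f
    (ContinuousLinearMap.lsmul ℝ ℝ) volume
  have hcf' : HasCompactSupport (fderiv ℝ f) := hc.fderiv ℝ
  have hf'c : Continuous (fderiv ℝ f) := hf.continuous_fderiv one_ne_zero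
  have hli : LocallyIntegrable f (volume : Measure E) := hf.continuous.locallyIntegrable
  have hrle : ∀ j : ℕ, δ / (j + 1 : ℝ) ≤ δ := fun j =>
    div_le_self hδ.le (by linarith [(Nat.cast_nonneg j : (0 : ℝ) ≤ j)])
  have hsub : ∀ j, Function.support (φ j) ⊆ K := by
    intro j
    refine (support_convolution_subset _).trans ?_
    rw [(ρ j).support_normed_eq]
    rintro _ ⟨a, ha, b, hb, rfl⟩
    refine Metric.mem_cthickening_of_dist_le _ b _ _ (subset_tsupport f hb) ?_
    simp only [mem_ball_zero_iff] at ha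
    rw [dist_eq_norm, add_sub_cancel_right]
    exact ha.le.trans (hrle j)
  have htsub : ∀ j, tsupport (φ j) ⊆ K := fun j =>
    closure_minimal (hsub j) Metric.isClosed_cthickening
  have hsm : ∀ j, ContDiff ℝ ∞ (φ j) := fun j =>
    (ρ j).hasCompactSupport_normed.contDiff_convolution_left _ (ρ j).contDiff_normed hli
  have hder : ∀ j x, fderiv ℝ (φ j) x = convolution ((ρ j).normed volume) (fderiv ℝ f)
      (ContinuousLinearMap.lsmul ℝ ℝ) volume x := by
    intro j x
    have h1 := (hc.hasFDerivAt_convolution_right (ContinuousLinearMap.lsmul ℝ ℝ)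
      (((ρ j).continuous_normed (μ := volume)).locallyIntegrable (μ := volume)) hf x)
    rw [h1.fderiv, convolution_def, convolution_def]
    refine integral_congr_ae (Eventually.of_forall fun t => ?_)
    ext e
    simp [ContinuousLinearMap.precompR]
  refine ⟨(hf.continuous.memLp_of_hasCompactSupport hc).restrict U,
    (hf'c.memLp_of_hasCompactSupport hcf').restrict U, φ, fun j =>
      ⟨hsm j, HasCompactSupport.of_support_subset_isCompact hKc (hsub j), (htsub j).trans hδU⟩,
      ?_, ?_⟩
  · refine tendsto_eLpNorm_of_uniform (f := φ) hKc (fun j x hx => ?_) (tendstoUniformly_convolution_bump hf.continuous hc hρ) _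
    rw [image_eq_zero_of_notMem_tsupport (f := φ j) (fun h => hx (htsub j h)),
      image_eq_zero_of_notMem_tsupport (fun h => hx (Metric.self_subset_cthickening _ h))]
  · refine tendsto_eLpNorm_of_uniform hKc (fun j x hx => ?_) ?_ _
    · rw [image_eq_zero_of_notMem_tsupport (f := fderiv ℝ (φ j))
        (fun h => hx (htsub j (tsupport_fderiv_subset ℝ h))),
        image_eq_zero_of_notMem_tsupport (f := fderiv ℝ f) (fun h =>
          hx (Metric.self_subset_cthickening _ (tsupport_fderiv_subset ℝ h)))]
    · have : (fun j => fderiv ℝ (φ j)) = fun j => convolution ((ρ j).normed volume) (fderiv ℝ f)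
        (ContinuousLinearMap.lsmul ℝ ℝ) volume := by
        ext1 j
        ext1 x
        exact hder j x
      rw [this]
      exact tendstoUniformly_convolution_bump hf'c hcf' hρ

end FiniteDim

/-! ### Boundary values of truncations -/

section TruncH10

variable {E F : Type*} [NormedAddCommGroup E] [NormedSpace ℝ E] [FiniteDimensional ℝ E]
  [MeasureSpace E] [BorelSpace E] [(volume : Measure E).IsAddHaarMeasure]
  [NormedAddCommGroup F] [InnerProductSpace ℝ F] [FiniteDimensional ℝ F] {U : Set E}

/-- A truncation of a Sobolev function bounded by `k'` on the boundary, at a level above `k'`,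
vanishes on the boundary. -/
theorem isH10With_truncField (hU : IsOpen U) {u : E → F} {Du : E → E →L[ℝ] F} {v : ℕ → E → F}
    (hu : MemLp u 2 (volume.restrict U)) (hDu : MemLp Du 2 (volume.restrict U))
    (hv : ∀ j, ContDiffOn ℝ 1 (v j) U)
    (h1 : Tendsto (fun j => eLpNorm (fun x => v j x - u x) 2 (volume.restrict U)) atTop (𝓝 0))
    (h2 : Tendsto (fun j => eLpNorm (fun x => fderiv ℝ (v j) x - Du x) 2 (volume.restrict U))
      atTop (𝓝 0))
    {k k' : ℝ} (hk : k' < k) (h : MemH10 U (fun x => max (‖u x‖ - k') 0)) :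
    IsH10With U (fun x => truncField k (u x))
      (fun x => (fderiv ℝ (truncField k) (u x)).comp (Du x)) := by
  obtain ⟨Df, hf, hDf, φ', hφ', ha', hb'⟩ := h
  set f : E → ℝ := fun x => max (‖u x‖ - k') 0 with hfdef
  set δ := k - k' with hδdef
  have hδ : 0 < δ := sub_pos.2 hk
  have hvm : ∀ j, AEStronglyMeasurable (v j) (volume.restrict U) := fun j =>
    (hv j).continuousOn.aestronglyMeasurable hU.measurableSet
  have hDvm : ∀ j, AEStronglyMeasurable (fderiv ℝ (v j)) (volume.restrict U) := fun j =>
    ((hv j).continuousOn_fderiv_of_isOpen hU le_rfl).aestronglyMeasurable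
      hU.measurableSet
  obtain ⟨ns, hns, hφlim'⟩ := exists_subseq_tendsto_ae
    (fun j => (hφ' j).1.continuous.aestronglyMeasurable) hf.1 ha'
  have h1' := h1.comp hns.tendsto_atTop
  obtain ⟨ms, hms, hvlim⟩ := exists_subseq_tendsto_ae (fun j => hvm (ns j)) hu.1 h1'
  have hφlim : ∀ᵐ x ∂(volume.restrict U),
      Tendsto (fun j => φ' (ns (ms j)) x) atTop (𝓝 (f x)) := by
    filter_upwards [hφlim'] with x hx
    exact hx.comp hms.tendsto_atTop
  have hss : Tendsto (fun j => ns (ms j)) atTop atTop :=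
    hns.tendsto_atTop.comp hms.tendsto_atTop
  set φ : ℕ → E → ℝ := fun j => φ' (ns (ms j)) with hφdef
  set y : ℕ → E → F := fun j => v (ns (ms j)) with hydef
  have hφ := fun j => hφ' (ns (ms j))
  have hy := fun j => hv (ns (ms j))
  have hym := fun j => hvm (ns (ms j))
  have hDym := fun j => hDvm (ns (ms j))
  have hb := hb'.comp hss
  have h1y := h1.comp hss
  have h2y := h2.comp hss
  have hφm : ∀ j, AEStronglyMeasurable (φ j) (volume.restrict U) := fun j =>
    (hφ j).1.continuous.aestronglyMeasurable
  have hB := contDiff_truncField (F := F) k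
  have hDB := continuous_fderiv_truncField (F := F) k
  have hη := contDiff_cutoff δ
  have hη' : Continuous (deriv (cutoff δ)) := hη.continuous_deriv le_rfl
  -- `truncField k (y j)` need not have compact support. The factor `cutoff δ (φ j)` vanishes
  -- wherever the test function `φ j` does, which makes the product C¹ with compact support in U.
  set w : ℕ → E → F := fun j x => cutoff δ (φ j x) • truncField k (y j x) with hwdef
  have hwd : ∀ j, ∀ x ∈ U, HasFDerivAt (w j)
      ((cutoff δ (φ j x) • fderiv ℝ (truncField k) (y j x)).comp (fderiv ℝ (y j) x) +
        (fderiv ℝ (φ j) x).smulRight (deriv (cutoff δ) (φ j x) • truncField k (y j x))) x := by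
    intro j x hx
    have hd1 : HasFDerivAt (φ j) (fderiv ℝ (φ j) x) x :=
      ((hφ j).1.differentiable (by simp) x).hasFDerivAt
    have hd2 : HasFDerivAt (y j) (fderiv ℝ (y j) x) x :=
      (((hy j).contDiffAt (hU.mem_nhds hx)).differentiableAt one_ne_zero).hasFDerivAt
    have hd3 := ((hB.differentiable one_ne_zero (y j x)).hasFDerivAt).comp x hd2
    have hd4 := ((hη.differentiable one_ne_zero (φ j x)).hasDerivAt).comp_hasFDerivAt x hd1
    refine (hd4.smul hd3).congr_fderiv ?_
    ext e
    simp [smul_smul, mul_comm]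
  have hwsupp : ∀ j, tsupport (w j) ⊆ tsupport (φ j) := by
    intro j
    refine closure_mono fun x hx => ?_
    contrapose! hx
    rw [Function.notMem_support] at hx ⊢
    simp [hwdef, hx, cutoff_zero]
  have hwC : ∀ j, ContDiff ℝ 1 (w j) := by
    intro j
    rw [contDiff_iff_contDiffAt]
    intro x
    by_cases hx : x ∈ U
    · exact (hη.contDiffAt.comp x ((hφ j).1.contDiffAt.of_le (by norm_cast))).smul
        (hB.contDiffAt.comp x ((hy j).contDiffAt (hU.mem_nhds hx)))
    · have h0 : w j =ᶠ[𝓝 x] fun _ => 0 :=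
        notMem_tsupport_iff_eventuallyEq.1 fun hx' => hx ((hφ j).2.2 (hwsupp j hx'))
      exact contDiffAt_const.congr_of_eventuallyEq h0
  have hwH : ∀ j, IsH10With U (w j) (fderiv ℝ (w j)) := fun j =>
    IsH10With.of_contDiff_one (hwC j)
      (HasCompactSupport.of_support_subset_isCompact (hφ j).2.1
        ((subset_tsupport _).trans (hwsupp j))) hU ((hwsupp j).trans (hφ j).2.2)
  -- In the limit the cutoff is invisible. Where |u| ≤ k the truncation and its derivative vanish;
  -- where |u| > k the function f is at least δ = k - k', so the cutoff is 1 with zero derivative.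
  -- The gap k' < k is used here.
  have hcut : ∀ x, cutoff δ (f x) • truncField k (u x) = truncField k (u x) ∧
      cutoff δ (f x) • fderiv ℝ (truncField k) (u x) = fderiv ℝ (truncField k) (u x) ∧
      deriv (cutoff δ) (f x) • truncField k (u x) = 0 := by
    intro x
    rcases le_or_gt ‖u x‖ k with hx | hx
    · rw [truncField_of_le hx, fderiv_truncField_of_le hx]
      simp
    · have h3 : δ ≤ f x := le_max_of_le_left (by rw [hδdef]; linarith)
      rw [cutoff_of_le hδ h3, deriv_cutoff_of_le hδ h3]
      simp
  have hwB : MemLp (fun x => truncField k (u x)) 2 (volume.restrict U) :=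
    (lipschitzWith_truncField k).comp_memLp (by simp [truncField]) hu
  have hDwB : MemLp (fun x => (fderiv ℝ (truncField k) (u x)).comp (Du x)) 2
      (volume.restrict U) := by
    refine hDu.of_le_mul (c := 3) ?_ (Eventually.of_forall fun x => ?_)
    · exact (ContinuousLinearMap.compL ℝ E F F).aestronglyMeasurable_comp₂
        (hDB.comp_aestronglyMeasurable hu.1) hDu.1
    · exact (ContinuousLinearMap.opNorm_comp_le _ _).trans
        (by gcongr; exact norm_fderiv_truncField_le k _)
  refine IsH10With.of_tendsto hwH hwB hDwB ?_ ?_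
  · have := tendsto_eLpNorm_bilin (μ := volume.restrict U) (ContinuousLinearMap.lsmul ℝ ℝ)
      (c := fun j x => cutoff δ (φ j x)) (c' := fun x => cutoff δ (f x))
      (g := fun j x => truncField k (y j x)) (g' := fun x => truncField k (u x)) (C := 1)
      (fun j => hη.continuous.comp_aestronglyMeasurable (hφm j))
      (fun j => Eventually.of_forall fun x => abs_cutoff_le _ _)
      (by filter_upwards [hφlim] with x hx using (hη.continuous.tendsto _).comp hx)
      (fun j => hB.continuous.comp_aestronglyMeasurable (hym j)) hwB
      ((lipschitzWith_truncField k).tendsto_eLpNorm_comp h1y)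
    simpa only [ContinuousLinearMap.lsmul_apply, (hcut _).1] using this
  -- The product rule gives one term with `fderiv (y j)`, coefficient bounded by 3, and one with
  -- `fderiv (φ j)`, coefficient bounded by 4/δ because the truncation field has norm at most 1. The
  -- second tends to zero.
  · have t1 := tendsto_eLpNorm_bilin (μ := volume.restrict U)
      (ContinuousLinearMap.compL ℝ E F F)
      (c := fun j x => cutoff δ (φ j x) • fderiv ℝ (truncField k) (y j x))
      (c' := fun x => cutoff δ (f x) • fderiv ℝ (truncField k) (u x))
      (g := fun j => fderiv ℝ (y j)) (g' := Du) (C := 3)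
      (fun j => (hη.continuous.comp_aestronglyMeasurable (hφm j)).smul
        (hDB.comp_aestronglyMeasurable (hym j)))
      (fun j => Eventually.of_forall fun x => by
        rw [norm_smul]
        calc ‖cutoff δ (φ j x)‖ * ‖fderiv ℝ (truncField k) (y j x)‖ ≤ 1 * 3 := by
              gcongr
              · exact abs_cutoff_le _ _
              · exact norm_fderiv_truncField_le _ _
          _ = 3 := one_mul 3)
      (by filter_upwards [hφlim, hvlim] with x hx hx' using
            ((hη.continuous.tendsto _).comp hx).smul ((hDB.tendsto _).comp hx'))
      hDym hDu h2y
    have t2 := tendsto_eLpNorm_bilin (μ := volume.restrict U)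
      (ContinuousLinearMap.smulRightL ℝ E F).flip
      (c := fun j x => deriv (cutoff δ) (φ j x) • truncField k (y j x))
      (c' := fun x => deriv (cutoff δ) (f x) • truncField k (u x))
      (g := fun j => fderiv ℝ (φ j)) (g' := Df) (C := 4 / δ)
      (fun j => (hη'.comp_aestronglyMeasurable (hφm j)).smul
        (hB.continuous.comp_aestronglyMeasurable (hym j)))
      (fun j => Eventually.of_forall fun x => by
        rw [norm_smul]
        calc ‖deriv (cutoff δ) (φ j x)‖ * ‖truncField k (y j x)‖ ≤ 4 / δ * 1 := by
              gcongr
              · exact abs_deriv_cutoff_le hδ _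
              · exact norm_truncField_le _ _
          _ = 4 / δ := mul_one _)
      (by filter_upwards [hφlim, hvlim] with x hx hx' using
            ((hη'.tendsto _).comp hx).smul ((hB.continuous.tendsto _).comp hx'))
      (fun j => ((hφ j).1.continuous_fderiv (by simp)).aestronglyMeasurable) hDf hb
    have e1 : ∀ j, AEStronglyMeasurable (fun x => ContinuousLinearMap.compL ℝ E F F
        (cutoff δ (φ j x) • fderiv ℝ (truncField k) (y j x)) (fderiv ℝ (y j) x))
        (volume.restrict U) := fun j =>
      (ContinuousLinearMap.compL ℝ E F F).aestronglyMeasurable_comp₂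
        ((hη.continuous.comp_aestronglyMeasurable (hφm j)).smul
          (hDB.comp_aestronglyMeasurable (hym j))) (hDym j)
    have e2 : ∀ j, AEStronglyMeasurable (fun x =>
        (ContinuousLinearMap.smulRightL ℝ E F).flip
          (deriv (cutoff δ) (φ j x) • truncField k (y j x)) (fderiv ℝ (φ j) x))
        (volume.restrict U) := fun j =>
      (ContinuousLinearMap.smulRightL ℝ E F).flip.aestronglyMeasurable_comp₂
        ((hη'.comp_aestronglyMeasurable (hφm j)).smul
          (hB.continuous.comp_aestronglyMeasurable (hym j)))
        ((hφ j).1.continuous_fderiv (by simp)).aestronglyMeasurable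
    have e1' : (fun x => ContinuousLinearMap.compL ℝ E F F
        (cutoff δ (f x) • fderiv ℝ (truncField k) (u x)) (Du x)) =
        fun x => (fderiv ℝ (truncField k) (u x)).comp (Du x) := by
      ext1 x
      rw [(hcut x).2.1]
      rfl
    have e2' : (fun x => (ContinuousLinearMap.smulRightL ℝ E F).flip
        (deriv (cutoff δ) (f x) • truncField k (u x)) (Df x)) = fun _ => 0 := by
      ext1 x
      rw [(hcut x).2.2, map_zero]
      rfl
    have t3 := tendsto_eLpNorm_sub_add e1 (e1' ▸ hDwB.1) e2
      (e2' ▸ aestronglyMeasurable_const) t1 t2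
    refine t3.congr fun j => eLpNorm_congr_ae ?_
    filter_upwards [ae_restrict_mem hU.measurableSet] with x hx
    rw [(hwd j x hx).fderiv, congrFun e1' x, congrFun e2' x, add_zero]
    rfl

end TruncH10

/-! ### Functions of space and time -/

section Product

variable {α β : Type*} [MeasurableSpace α] [MeasurableSpace β] {μ : Measure α} {ν : Measure β}
  [SFinite μ] [SFinite ν] {G : Type*} [NormedAddCommGroup G]

theorem eLpNorm_two_eq {α : Type*} [MeasurableSpace α] {μ : Measure α} (f : α → G) :
    eLpNorm f 2 μ = (∫⁻ x, ‖f x‖ₑ ^ (2 : ℝ) ∂μ) ^ (1 / (2 : ℝ)) := by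
  rw [eLpNorm_eq_lintegral_rpow_enorm_toReal (by norm_num) (by norm_num)]
  simp

theorem eLpNorm_two_rpow {α : Type*} [MeasurableSpace α] {μ : Measure α} (f : α → G) :
    eLpNorm f 2 μ ^ (2 : ℝ) = ∫⁻ x, ‖f x‖ₑ ^ (2 : ℝ) ∂μ := by
  rw [eLpNorm_two_eq, ← ENNReal.rpow_mul]
  norm_num

theorem eLpNorm_prod_le {f : α × β → G} (hf : AEStronglyMeasurable f (μ.prod ν)) {C : ℝ≥0∞}
    (h : ∀ᵐ t ∂ν, eLpNorm (fun x => f (x, t)) 2 μ ≤ C) :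
    eLpNorm f 2 (μ.prod ν) ≤ C * ν univ ^ (1 / (2 : ℝ)) := by
  rw [eLpNorm_two_eq, lintegral_prod_symm _ (hf.enorm.pow_const _)]
  have h1 : ∫⁻ t, ∫⁻ x, ‖f (x, t)‖ₑ ^ (2 : ℝ) ∂μ ∂ν ≤ C ^ (2 : ℝ) * ν univ := by
    rw [← lintegral_const]
    refine lintegral_mono_ae ?_
    filter_upwards [h] with t ht
    rw [← eLpNorm_two_rpow (fun x => f (x, t))]
    gcongr
  refine (ENNReal.rpow_le_rpow h1 (by norm_num)).trans (le_of_eq ?_)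
  rw [ENNReal.mul_rpow_of_nonneg _ _ (by norm_num), ← ENNReal.rpow_mul]
  norm_num

/-- Choose indices along which the integrals are summable. The sum of the functions is then
integrable, hence finite almost everywhere, so its terms tend to zero. -/
theorem exists_subseq_tendsto_of_lintegral {α : Type*} [MeasurableSpace α] {μ : Measure α}
    {f : ℕ → α → ℝ≥0∞} (hf : ∀ k, AEMeasurable (f k) μ)
    (h : Tendsto (fun k => ∫⁻ x, f k x ∂μ) atTop (𝓝 0)) :
    ∃ ns : ℕ → ℕ, StrictMono ns ∧ ∀ᵐ x ∂μ, Tendsto (fun k => f (ns k) x) atTop (𝓝 0) := by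
  obtain ⟨ε, hε, hsum⟩ := ENNReal.exists_pos_sum_of_countable' one_ne_zero ℕ
  obtain ⟨ns, hns, hle⟩ := extraction_forall_of_eventually fun n =>
    h.eventually_le_const (hε n)
  refine ⟨ns, hns, ?_⟩
  have h1 : ∫⁻ x, ∑' k, f (ns k) x ∂μ ≠ ⊤ := by
    rw [lintegral_tsum fun k => hf (ns k)]
    exact ((ENNReal.tsum_le_tsum hle).trans_lt (hsum.trans ENNReal.one_lt_top)).ne
  filter_upwards [ae_lt_top' (AEMeasurable.tsum fun k => hf (ns k)) h1] with x hx
  exact ENNReal.tendsto_atTop_zero_of_tsum_ne_top hx.ne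

theorem exists_subseq_slice_tendsto {f : ℕ → α × β → G} {g : α × β → G}
    (hf : ∀ k, AEStronglyMeasurable (f k) (μ.prod ν)) (hg : AEStronglyMeasurable g (μ.prod ν))
    (h : Tendsto (fun k => eLpNorm (fun p => f k p - g p) 2 (μ.prod ν)) atTop (𝓝 0)) :
    ∃ ns : ℕ → ℕ, StrictMono ns ∧ ∀ᵐ t ∂ν,
      Tendsto (fun k => eLpNorm (fun x => f (ns k) (x, t) - g (x, t)) 2 μ) atTop (𝓝 0) := by
  have hm : ∀ k, AEMeasurable (fun p => ‖f k p - g p‖ₑ ^ (2 : ℝ)) (μ.prod ν) := fun k =>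
    ((hf k).sub hg).enorm.pow_const _
  have h1 : Tendsto (fun k => ∫⁻ t, ∫⁻ x, ‖f k (x, t) - g (x, t)‖ₑ ^ (2 : ℝ) ∂μ ∂ν)
      atTop (𝓝 0) := by
    have := ((ENNReal.continuous_rpow_const (y := 2)).tendsto 0).comp h
    simp only [Function.comp_def] at this
    rw [ENNReal.zero_rpow_of_pos (by norm_num)] at this
    refine this.congr fun k => ?_
    rw [eLpNorm_two_rpow, lintegral_prod_symm _ (hm k)]
  obtain ⟨ns, hns, hlim⟩ := exists_subseq_tendsto_of_lintegral
    (fun k => (hm k).lintegral_prod_left') h1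
  refine ⟨ns, hns, ?_⟩
  filter_upwards [hlim] with t ht
  have := ((ENNReal.continuous_rpow_const (y := 1 / 2)).tendsto 0).comp ht
  simp only [Function.comp_def] at this
  rw [ENNReal.zero_rpow_of_pos (by norm_num)] at this
  exact this.congr fun k => (eLpNorm_two_eq _).symm

end Product

/-! ### The space V: integrability and weak continuity in time -/

section V

variable {n N : ℕ} {Ω : Set (EuclideanSpace ℝ (Fin n))} {T : ℝ}
  {u : ℝ → EuclideanSpace ℝ (Fin n) → EuclideanSpace ℝ (Fin N)}

theorem restrict_parabolicCylinder (Ω : Set (EuclideanSpace ℝ (Fin n))) (T : ℝ) :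
    (volume.restrict (parabolicCylinder Ω T)) =
      (volume.restrict Ω).prod (volume.restrict (Ioo 0 T)) := by
  rw [Measure.prod_restrict, parabolicCylinder, Measure.volume_eq_prod]

theorem isOpen_parabolicCylinder (hΩ : IsOpen Ω) (T : ℝ) : IsOpen (parabolicCylinder Ω T) :=
  hΩ.prod isOpen_Ioo

theorem continuousOn_slice {G : Type*} [TopologicalSpace G] {v : EuclideanSpace ℝ (Fin n) × ℝ → G}
    (hv : ContinuousOn v (parabolicCylinder Ω T)) {t : ℝ} (ht : t ∈ Ioo 0 T) :
    ContinuousOn (fun x => v (x, t)) Ω :=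
  hv.comp (by fun_prop) fun _ hx => ⟨hx, ht⟩

theorem contDiffOn_slice {v : EuclideanSpace ℝ (Fin n) × ℝ → EuclideanSpace ℝ (Fin N)}
    (hv : ContDiffOn ℝ 1 v (parabolicCylinder Ω T)) {t : ℝ} (ht : t ∈ Ioo 0 T) :
    ContDiffOn ℝ 1 (fun x => v (x, t)) Ω :=
  hv.comp (by fun_prop) fun _ hx => ⟨hx, ht⟩

theorem le_iSup_slice {f : ℝ → ℝ≥0∞} {t : ℝ} (ht : t ∈ Ioo 0 T) :
    f t ≤ ⨆ t ∈ Ioo 0 T, f t := le_iSup₂ (f := fun t (_ : t ∈ Ioo 0 T) => f t) t ht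

theorem MemV.exists_bound (hΩ : IsOpen Ω) (hu : MemV Ω T u) :
    ∃ C : ℝ≥0∞, C ≠ ⊤ ∧ ∀ t ∈ Ioo 0 T, eLpNorm (u t) 2 (volume.restrict Ω) ≤ C := by
  obtain ⟨v, Du, hv, hvb, -, -, h1, -⟩ := hu.approx
  obtain ⟨k, hk⟩ := (h1.eventually_lt_const one_pos).exists
  refine ⟨(⨆ t ∈ Ioo 0 T, eLpNorm (fun x => v k (x, t)) 2 (volume.restrict Ω)) + 1,
    ENNReal.add_ne_top.2 ⟨(hvb k).ne, ENNReal.one_ne_top⟩, fun t ht => ?_⟩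
  have hvm : AEStronglyMeasurable (fun x => v k (x, t)) (volume.restrict Ω) :=
    (continuousOn_slice (hv k).continuousOn ht).aestronglyMeasurable hΩ.measurableSet
  have h2 : u t = (fun x => v k (x, t)) - fun x => v k (x, t) - u t x := by
    ext x
    simp
  rw [h2]
  refine (eLpNorm_sub_le hvm (hvm.sub (hu.memLp_slice t ht).1) one_le_two).trans ?_
  exact add_le_add (le_iSup_slice ht)
    ((le_iSup_slice (f := fun t => eLpNorm (fun x => v k (x, t) - u t x) 2 (volume.restrict Ω))
      ht).trans hk.le)

theorem MemV.memLp (hΩ : IsOpen Ω) (hu : MemV Ω T u) :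
    MemLp (fun p : EuclideanSpace ℝ (Fin n) × ℝ => u p.2 p.1) 2
      (volume.restrict (parabolicCylinder Ω T)) := by
  obtain ⟨C, hC, h⟩ := hu.exists_bound hΩ
  refine ⟨hu.aestronglyMeasurable, ?_⟩
  have hm := hu.aestronglyMeasurable
  rw [restrict_parabolicCylinder] at hm ⊢
  refine (eLpNorm_prod_le (C := C) hm ?_).trans_lt ?_
  · filter_upwards [ae_restrict_mem measurableSet_Ioo] with t ht
    exact h t ht
  · simp only [Measure.restrict_apply_univ, Real.volume_Ioo]
    finiteness

theorem tendsto_eLpNorm_parabolicCylinder (hΩ : IsOpen Ω) (hu : MemV Ω T u)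
    {v : ℕ → EuclideanSpace ℝ (Fin n) × ℝ → EuclideanSpace ℝ (Fin N)}
    (hv : ∀ k, ContDiffOn ℝ 1 (v k) (parabolicCylinder Ω T))
    (h : Tendsto (fun k => ⨆ t ∈ Ioo 0 T,
      eLpNorm (fun x => v k (x, t) - u t x) 2 (volume.restrict Ω)) atTop (𝓝 0)) :
    Tendsto (fun k => eLpNorm (fun p => v k p - u p.2 p.1) 2
      (volume.restrict (parabolicCylinder Ω T))) atTop (𝓝 0) := by
  have hm : ∀ k, AEStronglyMeasurable (fun p => v k p - u p.2 p.1)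
      (volume.restrict (parabolicCylinder Ω T)) := fun k =>
    ((hv k).continuousOn.aestronglyMeasurable
      (isOpen_parabolicCylinder hΩ T).measurableSet).sub hu.aestronglyMeasurable
  rw [restrict_parabolicCylinder] at hm ⊢
  refine tendsto_of_tendsto_of_tendsto_of_le_of_le tendsto_const_nhds
    (h := fun k => (⨆ t ∈ Ioo 0 T, eLpNorm (fun x => v k (x, t) - u t x) 2 (volume.restrict Ω)) *
      (volume.restrict (Ioo 0 T)) univ ^ (1 / (2 : ℝ)))
    ?_ (fun _ => zero_le) (fun k => eLpNorm_prod_le (hm k) ?_)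
  · have hfin : (volume.restrict (Ioo 0 T)) univ ^ (1 / (2 : ℝ)) ≠ ⊤ := by
      simp only [Measure.restrict_apply_univ, Real.volume_Ioo]
      finiteness
    simpa only [zero_mul] using ENNReal.Tendsto.mul_const h (Or.inr hfin)
  · filter_upwards [ae_restrict_mem measurableSet_Ioo] with t ht
    exact le_iSup_slice (f := fun t => eLpNorm (fun x => v k (x, t) - u t x) 2
      (volume.restrict Ω)) ht

theorem memLp_parabolicCylinder (hΩ : IsOpen Ω)
    {v : EuclideanSpace ℝ (Fin n) × ℝ → EuclideanSpace ℝ (Fin N)}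
    (hv : ContDiffOn ℝ 1 v (parabolicCylinder Ω T))
    (h : (⨆ t ∈ Ioo 0 T, eLpNorm (fun x => v (x, t)) 2 (volume.restrict Ω)) < ⊤) :
    MemLp v 2 (volume.restrict (parabolicCylinder Ω T)) := by
  have hm := hv.continuousOn.aestronglyMeasurable (μ := volume)
    (isOpen_parabolicCylinder hΩ T).measurableSet
  refine ⟨hm, ?_⟩
  rw [restrict_parabolicCylinder] at hm ⊢
  refine (eLpNorm_prod_le (C := ⨆ t ∈ Ioo 0 T, eLpNorm (fun x => v (x, t)) 2
    (volume.restrict Ω)) hm ?_).trans_lt ?_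
  · filter_upwards [ae_restrict_mem measurableSet_Ioo] with t ht
    exact le_iSup_slice (f := fun t => eLpNorm (fun x => v (x, t)) 2 (volume.restrict Ω)) ht
  · simp only [Measure.restrict_apply_univ, Real.volume_Ioo]
    have := h.ne
    finiteness

/-- The inner product of a real inner product space as a continuous bilinear map. -/
noncomputable def innerBilin (F : Type*) [NormedAddCommGroup F] [InnerProductSpace ℝ F] :
    F →L[ℝ] F →L[ℝ] ℝ :=
  (isBoundedBilinearMap_inner (𝕜 := ℝ) (E := F)).toContinuousLinearMap

theorem innerBilin_apply {F : Type*} [NormedAddCommGroup F] [InnerProductSpace ℝ F] (a b : F) :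
    innerBilin F a b = inner ℝ a b := rfl

/-- Elements of `V` are weakly continuous in time, locally in space. -/
theorem MemV.continuousOn_setIntegral_inner (hΩ : IsOpen Ω) (hu : MemV Ω T u)
    {K : Set (EuclideanSpace ℝ (Fin n))} (hK : IsCompact K) (hKΩ : K ⊆ Ω)
    {g : EuclideanSpace ℝ (Fin n) → EuclideanSpace ℝ (Fin N)}
    (hg : MemLp g 2 (volume.restrict K)) :
    ContinuousOn (fun t => ∫ x in K, inner ℝ (g x) (u t x)) (Ioo 0 T) := by
  obtain ⟨v, Du, hv, hvb, -, -, h1, -⟩ := hu.approx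
  have hle : (volume : Measure (EuclideanSpace ℝ (Fin n))).restrict K ≤ volume.restrict Ω :=
    Measure.restrict_mono hKΩ le_rfl
  have : IsFiniteMeasure ((volume : Measure (EuclideanSpace ℝ (Fin n))).restrict K) :=
    ⟨by rw [Measure.restrict_apply_univ]; exact hK.measure_lt_top⟩
  have hvs : ∀ k, ∀ t ∈ Ioo 0 T, MemLp (fun x => v k (x, t)) 2 (volume.restrict Ω) :=
    fun k t ht => ⟨(continuousOn_slice (hv k).continuousOn ht).aestronglyMeasurable
      hΩ.measurableSet, (le_iSup_slice (f := fun t => eLpNorm (fun x => v k (x, t)) 2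
        (volume.restrict Ω)) ht).trans_lt (hvb k)⟩
  -- Convergence in V is uniform in time, so by Cauchy–Schwarz the pairings of the approximants
  -- converge uniformly and continuity passes to the limit.
  have hunif : TendstoUniformlyOn (fun k t => ∫ x in K, inner ℝ (g x) (v k (x, t)))
      (fun t => ∫ x in K, inner ℝ (g x) (u t x)) atTop (Ioo 0 T) := by
    rw [EMetric.tendstoUniformlyOn_iff]
    intro ε hε
    have h2 : Tendsto (fun k => ‖innerBilin (EuclideanSpace ℝ (Fin N))‖ₑ *
        eLpNorm g 2 (volume.restrict K) * ⨆ t ∈ Ioo 0 T,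
          eLpNorm (fun x => v k (x, t) - u t x) 2 (volume.restrict Ω)) atTop (𝓝 0) := by
      have := ENNReal.Tendsto.const_mul (a := ‖innerBilin (EuclideanSpace ℝ (Fin N))‖ₑ *
        eLpNorm g 2 (volume.restrict K)) h1 (Or.inr (ENNReal.mul_ne_top enorm_ne_top hg.2.ne))
      simpa only [mul_zero] using this
    filter_upwards [h2.eventually_lt_const hε] with k hk t ht
    rw [edist_comm, edist_eq_enorm_sub]
    have hi1 := integrable_bilin (innerBilin _) hg ((hvs k t ht).mono_measure hle)
    have hi2 := integrable_bilin (innerBilin _) hg ((hu.memLp_slice t ht).mono_measure hle)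
    simp only [innerBilin_apply] at hi1 hi2
    rw [← integral_sub hi1 hi2]
    simp only [← inner_sub_right]
    refine (enorm_integral_bilin_le (innerBilin _) hg.1
      (((hvs k t ht).sub (hu.memLp_slice t ht)).mono_measure hle).1).trans_lt
        (lt_of_le_of_lt ?_ hk)
    gcongr
    refine (eLpNorm_mono_measure _ hle).trans ?_
    exact (le_iSup_slice (f := fun t => eLpNorm (fun x => v k (x, t) - u t x) 2
      (volume.restrict Ω)) ht)
  refine hunif.continuousOn (Eventually.of_forall fun k => ?_).frequently
  intro t₀ ht₀
  refine ContinuousAt.continuousWithinAt ?_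
  -- The approximants are controlled only inside the open cylinder; on K × [a, b] they are bounded,
  -- which gives a dominating function. This is why K is compact.
  obtain ⟨a, b, hab, hsub, hnhds⟩ : ∃ a b, a ≤ b ∧ Icc a b ⊆ Ioo 0 T ∧ Icc a b ∈ 𝓝 t₀ := by
    refine ⟨t₀ / 2, (t₀ + T) / 2, by linarith [ht₀.1, ht₀.2], fun t ht => ?_, Icc_mem_nhds ?_ ?_⟩
    · exact ⟨by linarith [ht.1, ht₀.1], by linarith [ht.2, ht₀.2]⟩
    · linarith [ht₀.1]
    · linarith [ht₀.2]
  have hKc : ContinuousOn (v k) (K ×ˢ Icc a b) :=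
    (hv k).continuousOn.mono (prod_mono hKΩ hsub)
  obtain ⟨M, hM⟩ := (hK.prod isCompact_Icc).exists_bound_of_continuousOn hKc
  refine continuousAt_of_dominated (bound := fun x => ‖g x‖ * M) ?_ ?_
    ((hg.integrable one_le_two).norm.mul_const M) ?_
  · filter_upwards [hnhds] with t ht
    exact hg.1.inner ((hvs k t (hsub ht)).mono_measure hle).1
  · filter_upwards [hnhds] with t ht
    filter_upwards [ae_restrict_mem hK.measurableSet] with x hx
    refine (norm_inner_le_norm _ _).trans ?_
    gcongr
    exact hM (x, t) ⟨hx, ht⟩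
  · filter_upwards [ae_restrict_mem hK.measurableSet] with x hx
    have h3 : ContinuousAt (v k) (x, t₀) :=
      (hv k).continuousOn.continuousAt
        ((isOpen_parabolicCylinder hΩ T).mem_nhds ⟨hKΩ hx, ht₀⟩)
    have h4 : ContinuousAt (fun t => v k (x, t)) t₀ := h3.comp (f := fun t : ℝ => (x, t)) (by fun_prop)
    exact continuousAt_const.inner h4

end V

/-! ### Weak spatial derivatives and the chain rule -/

section ChainRule

variable {n N : ℕ} {Ω : Set (EuclideanSpace ℝ (Fin n))} {T : ℝ}

theorem spatialDeriv_eq {v : EuclideanSpace ℝ (Fin n) × ℝ → EuclideanSpace ℝ (Fin N)}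
    {p : EuclideanSpace ℝ (Fin n) × ℝ} (hv : DifferentiableAt ℝ v p)
    (e : EuclideanSpace ℝ (Fin n)) : spatialDeriv v p e = fderiv ℝ v p (e, 0) := by
  have h1 : HasFDerivAt (fun x => (x, p.2))
      (ContinuousLinearMap.inl ℝ (EuclideanSpace ℝ (Fin n)) ℝ) p.1 := hasFDerivAt_prodMk_left _ _
  have h2 : HasFDerivAt (fun x => v (x, p.2)) _ p.1 := hv.hasFDerivAt.comp p.1 h1
  rw [spatialDeriv, h2.fderiv]
  rfl

/-- Integration by parts against a test function, for a function that is `C¹` on an open set. -/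
theorem setIntegral_fderiv_smul_eq_neg {X F : Type*} [NormedAddCommGroup X] [NormedSpace ℝ X]
    [FiniteDimensional ℝ X] [MeasureSpace X] [BorelSpace X]
    [(volume : Measure X).IsAddHaarMeasure] [NormedAddCommGroup F] [NormedSpace ℝ F]
    {U : Set X} (hU : IsOpen U) {g : X → F} (hg : ContDiffOn ℝ 1 g U) {ψ : X → ℝ}
    (hψ : ContDiff ℝ ∞ ψ) (hc : HasCompactSupport ψ) (hs : tsupport ψ ⊆ U) (e : X) :
    ∫ p in U, fderiv ℝ ψ p e • g p = -∫ p in U, ψ p • fderiv ℝ g p e := by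
  have hgc := hg.continuousOn
  have hg'c : ContinuousOn (fun p => fderiv ℝ g p e) U :=
    (hg.continuousOn_fderiv_of_isOpen hU le_rfl).clm_apply continuousOn_const
  have hψ'c : Continuous fun p => fderiv ℝ ψ p e :=
    (hψ.continuous_fderiv (by simp)).clm_apply continuous_const
  have z1 : ∀ p, p ∉ tsupport ψ → ψ p = 0 := fun p hp => image_eq_zero_of_notMem_tsupport hp
  have z2 : ∀ p, p ∉ tsupport ψ → fderiv ℝ ψ p e = 0 := fun p hp => by
    rw [image_eq_zero_of_notMem_tsupport (f := fderiv ℝ ψ)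
      (fun h => hp (tsupport_fderiv_subset ℝ h))]
    rfl
  have hint : ∀ {a : X → ℝ} {b : X → F}, Continuous a → (∀ p, p ∉ tsupport ψ → a p = 0) →
      ContinuousOn b U → Integrable (fun p => ContinuousLinearMap.lsmul ℝ ℝ (a p) (b p)) := by
    intro a b ha hz hb
    rw [← integrableOn_iff_integrable_of_support_subset (s := tsupport ψ)]
    · exact (ha.continuousOn.smul (hb.mono hs)).integrableOn_compact hc
    · intro p hp
      by_contra h
      exact hp (by simp [hz p h])
  have hparts := integral_bilinear_hasLineDerivAt_right_eq_neg_left_of_integrable (μ := volume)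
    (B := ContinuousLinearMap.lsmul ℝ ℝ) (f := ψ) (f' := fun p => fderiv ℝ ψ p e) (g := g)
    (g' := fun p => fderiv ℝ g p e) (v := e) (hint hψ'c z2 hgc) (hint hψ.continuous z1 hg'c)
    (hint hψ.continuous z1 hgc)
    (fun p _ => ((hψ.differentiable (by simp) p).hasFDerivAt).hasLineDerivAt e)
    (fun p hp => (((hg.contDiffAt (hU.mem_nhds (hs hp))).differentiableAt
      one_ne_zero).hasFDerivAt).hasLineDerivAt e)
  simp only [ContinuousLinearMap.lsmul_apply] at hparts
  rw [setIntegral_eq_integral_of_forall_compl_eq_zero,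
    setIntegral_eq_integral_of_forall_compl_eq_zero, hparts, neg_neg]
  · intro p hp
    rw [z1 p fun h => hp (hs h), zero_smul]
  · intro p hp
    rw [z2 p fun h => hp (hs h), zero_smul]

/-- The chain rule for the weak spatial derivative of `A(u)`. -/
theorem IsWeakSpatialDeriv.ae_eq_of_tendsto (hΩ : IsOpen Ω)
    {A : EuclideanSpace ℝ (Fin N) → EuclideanSpace ℝ (Fin N)} (hA : ContDiff ℝ 1 A)
    (hA0 : A 0 = 0) {C : ℝ≥0} (hC : ∀ z, ‖fderiv ℝ A z‖ ≤ C)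
    {v : ℕ → EuclideanSpace ℝ (Fin n) × ℝ → EuclideanSpace ℝ (Fin N)}
    {u : EuclideanSpace ℝ (Fin n) × ℝ → EuclideanSpace ℝ (Fin N)}
    {Du H : EuclideanSpace ℝ (Fin n) × ℝ →
      EuclideanSpace ℝ (Fin n) →L[ℝ] EuclideanSpace ℝ (Fin N)}
    (hv : ∀ k, ContDiffOn ℝ 1 (v k) (parabolicCylinder Ω T))
    (hvL : ∀ k, MemLp (v k) 2 (volume.restrict (parabolicCylinder Ω T)))
    (hDv : ∀ k, MemLp (spatialDeriv (v k)) 2 (volume.restrict (parabolicCylinder Ω T)))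
    (hu : MemLp u 2 (volume.restrict (parabolicCylinder Ω T)))
    (hDu : MemLp Du 2 (volume.restrict (parabolicCylinder Ω T)))
    (h1 : Tendsto (fun k => eLpNorm (fun p => v k p - u p) 2
      (volume.restrict (parabolicCylinder Ω T))) atTop (𝓝 0))
    (h2 : Tendsto (fun k => eLpNorm (fun p => spatialDeriv (v k) p - Du p) 2
      (volume.restrict (parabolicCylinder Ω T))) atTop (𝓝 0))
    (hH : IsWeakSpatialDeriv Ω T (fun p => A (u p)) H)
    (hH2 : MemLp H 2 (volume.restrict (parabolicCylinder Ω T))) :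
    ∀ᵐ p ∂volume.restrict (parabolicCylinder Ω T),
      H p = (fderiv ℝ A (u p)).comp (Du p) := by
  have : (volume : Measure (EuclideanSpace ℝ (Fin n) × ℝ)).IsAddHaarMeasure :=
    inferInstanceAs ((volume : Measure (EuclideanSpace ℝ (Fin n))).prod
      (volume : Measure ℝ)).IsAddHaarMeasure
  set U := parabolicCylinder Ω T with hUdef
  have hU : IsOpen U := isOpen_parabolicCylinder hΩ T
  have hAlip : LipschitzWith C A :=
    lipschitzWith_of_nnnorm_fderiv_le (hA.differentiable one_ne_zero) hC
  have hDA : Continuous (fderiv ℝ A) := hA.continuous_fderiv one_ne_zero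
  obtain ⟨ns, hns, hlim⟩ := exists_subseq_tendsto_ae (fun k => (hvL k).1) hu.1 h1
  have hcomp : ∀ {y : EuclideanSpace ℝ (Fin n) × ℝ → EuclideanSpace ℝ (Fin N)}
      {Dy : EuclideanSpace ℝ (Fin n) × ℝ →
        EuclideanSpace ℝ (Fin n) →L[ℝ] EuclideanSpace ℝ (Fin N)},
      AEStronglyMeasurable y (volume.restrict U) → MemLp Dy 2 (volume.restrict U) →
      MemLp (fun p => ContinuousLinearMap.compL ℝ (EuclideanSpace ℝ (Fin n)) _ _
        (fderiv ℝ A (y p)) (Dy p)) 2 (volume.restrict U) := fun hy hDy =>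
    memLp_bilin_of_bound _ (hDA.comp_aestronglyMeasurable hy)
      (Eventually.of_forall fun _ => hC _) hDy
  have hlimD := tendsto_eLpNorm_bilin (μ := volume.restrict U)
    (ContinuousLinearMap.compL ℝ (EuclideanSpace ℝ (Fin n)) _ _)
    (c := fun k p => fderiv ℝ A (v (ns k) p)) (c' := fun p => fderiv ℝ A (u p))
    (g := fun k => spatialDeriv (v (ns k))) (g' := Du) (C := C)
    (fun k => hDA.comp_aestronglyMeasurable (hvL _).1)
    (fun k => Eventually.of_forall fun p => hC _)
    (by filter_upwards [hlim] with p hp using (hDA.tendsto _).comp hp)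
    (fun k => (hDv _).1) hDu (h2.comp hns.tendsto_atTop)
  have hlimA : Tendsto (fun k => eLpNorm (fun p => A (v (ns k) p) - A (u p)) 2
      (volume.restrict U)) atTop (𝓝 0) :=
    hAlip.tendsto_eLpNorm_comp (h1.comp hns.tendsto_atTop)
  -- For one direction at a time, the fundamental lemma of the calculus of variations: the classical
  -- chain rule holds for the C¹ approximants, and both sides of the integration by parts pass to
  -- the limit.
  have key : ∀ e : EuclideanSpace ℝ (Fin n), ∀ᵐ p ∂(volume : Measure (_ × ℝ)), p ∈ U →
      H p e - (fderiv ℝ A (u p)).comp (Du p) e = 0 := by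
    intro e
    have hHe : MemLp (fun p => H p e) 2 (volume.restrict U) := hH2.continuousLinearMap_comp (ContinuousLinearMap.apply ℝ (EuclideanSpace ℝ (Fin N)) e)
    have hGe : MemLp (fun p => (fderiv ℝ A (u p)).comp (Du p) e) 2 (volume.restrict U) :=
      (hcomp hu.1 hDu).continuousLinearMap_comp (ContinuousLinearMap.apply ℝ (EuclideanSpace ℝ (Fin N)) e)
    refine hU.ae_eq_zero_of_integral_contDiff_smul_eq_zero ?_ ?_
    · exact locallyIntegrableOn_of_locallyIntegrable_restrict
        ((hHe.sub hGe).locallyIntegrable one_le_two)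
    · intro ψ hψ hc hs
      have hψL : MemLp ψ 2 (volume.restrict U) :=
        (hψ.continuous.memLp_of_hasCompactSupport hc).restrict U
      have hψ'L : MemLp (fun p => fderiv ℝ ψ p (e, 0)) 2 (volume.restrict U) := by
        refine (Continuous.memLp_of_hasCompactSupport
          ((hψ.continuous_fderiv (by simp)).clm_apply continuous_const) ?_).restrict U
        exact (hc.fderiv ℝ).comp_left (g := fun L : (EuclideanSpace ℝ (Fin n) × ℝ) →L[ℝ] ℝ => L (e, 0)) rfl
      have hwk := hH.integral_eq ψ hψ hc hs e
      have hk : ∀ k, ∫ p in U, fderiv ℝ ψ p (e, 0) • A (v k p) =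
          -∫ p in U, ψ p • (fderiv ℝ A (v k p)).comp (spatialDeriv (v k) p) e := by
        intro k
        have h3 : ContDiffOn ℝ 1 (fun p => A (v k p)) U := hA.comp_contDiffOn (hv k)
        rw [setIntegral_fderiv_smul_eq_neg hU h3 hψ hc hs]
        congr 1
        refine setIntegral_congr_fun hU.measurableSet fun p hp => ?_
        have hd : DifferentiableAt ℝ (v k) p :=
          ((hv k).contDiffAt (hU.mem_nhds hp)).differentiableAt one_ne_zero
        have := ((hA.differentiable one_ne_zero (v k p)).hasFDerivAt).comp p hd.hasFDerivAt
        simp only [Function.comp_def] at this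
        simp only [this.fderiv, ContinuousLinearMap.comp_apply, spatialDeriv_eq hd]
      have t1 := tendsto_integral_bilin (ContinuousLinearMap.lsmul ℝ ℝ) hψ'L
        (fun k => hAlip.comp_memLp hA0 (hvL (ns k))) (hAlip.comp_memLp hA0 hu) hlimA
      have t2 := tendsto_integral_bilin ((ContinuousLinearMap.lsmul ℝ ℝ :
          ℝ →L[ℝ] EuclideanSpace ℝ (Fin N) →L[ℝ] EuclideanSpace ℝ (Fin N)).bilinearComp
          (ContinuousLinearMap.id ℝ ℝ)
          (ContinuousLinearMap.apply ℝ (EuclideanSpace ℝ (Fin N)) e)) hψL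
        (fun k => hcomp (hvL (ns k)).1 (hDv (ns k))) (hcomp hu.1 hDu) hlimD
      have heq : ∫ p in U, fderiv ℝ ψ p (e, 0) • A (u p) =
          -∫ p in U, ψ p • (fderiv ℝ A (u p)).comp (Du p) e :=
        tendsto_nhds_unique t1 (t2.neg.congr fun k => (hk (ns k)).symm)
      rw [← setIntegral_eq_integral_of_forall_compl_eq_zero (s := U)]
      · simp only [smul_sub]
        have i1 : Integrable (fun p => ψ p • H p e) (volume.restrict U) :=
          integrable_bilin (ContinuousLinearMap.lsmul ℝ ℝ) hψL hHe
        have i2 : Integrable (fun p => ψ p • (fderiv ℝ A (u p)).comp (Du p) e)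
            (volume.restrict U) := integrable_bilin (ContinuousLinearMap.lsmul ℝ ℝ) hψL hGe
        rw [integral_sub i1 i2, sub_eq_zero]
        exact neg_injective (hwk.symm.trans heq)
      · intro p hp
        rw [image_eq_zero_of_notMem_tsupport (fun h => hp (hs h)), zero_smul]
  -- The exceptional null set depends on the direction, so only the finitely many basis directions
  -- are used.
  have hall := ae_all_iff.2 fun i : Fin n => key (EuclideanSpace.basisFun (Fin n) ℝ i)
  rw [ae_restrict_iff' hU.measurableSet]
  filter_upwards [hall] with p hp hpU
  refine ContinuousLinearMap.coe_injective
    ((EuclideanSpace.basisFun (Fin n) ℝ).toBasis.ext fun i => ?_)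
  have := hp i hpU
  rw [sub_eq_zero] at this
  simpa using this

end ChainRule

/-! ### Weak derivatives in one variable -/

section OneDim

/-- Outside the transition interval the function sits at its global minimum 0 or maximum 1, so the
derivative vanishes there. -/
theorem deriv_smoothTransition_of_notMem {t : ℝ} (ht : t ∉ Ioc (0 : ℝ) 1) :
    deriv Real.smoothTransition t = 0 := by
  rcases le_or_gt t 0 with h | h
  · refine IsLocalMin.deriv_eq_zero (Eventually.of_forall fun s => ?_)
    rw [Real.smoothTransition.zero_of_nonpos h]
    exact Real.smoothTransition.nonneg s
  · have h1 : 1 < t := not_le.1 fun h1 => ht ⟨h, h1⟩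
    refine IsLocalMax.deriv_eq_zero (Eventually.of_forall fun s => ?_)
    rw [Real.smoothTransition.one_of_one_le h1.le]
    exact Real.smoothTransition.le_one s

theorem contDiff_smoothTransition : ContDiff ℝ ∞ Real.smoothTransition :=
  Real.smoothTransition.contDiff

theorem continuous_deriv_smoothTransition : Continuous (deriv Real.smoothTransition) :=
  contDiff_smoothTransition.continuous_deriv (by simp)

theorem integral_deriv_smoothTransition : ∫ s in (0 : ℝ)..1, deriv Real.smoothTransition s = 1 := by
  rw [intervalIntegral.integral_deriv_eq_sub
    (fun x _ => contDiff_smoothTransition.differentiable (by simp) x)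
    (continuous_deriv_smoothTransition.intervalIntegrable _ _)]
  simp

theorem hasDerivAt_smoothTransition_scaled (a ε t : ℝ) :
    HasDerivAt (fun t => Real.smoothTransition ((t - a) / ε))
      (deriv Real.smoothTransition ((t - a) / ε) * ε⁻¹) t := by
  have h1 : HasDerivAt (fun t : ℝ => (t - a) / ε) ε⁻¹ t := by
    simpa [div_eq_mul_inv] using ((hasDerivAt_id t).sub_const a).div_const ε
  exact ((contDiff_smoothTransition.differentiable (by simp) _).hasDerivAt).comp t h1

theorem deriv_smoothTransition_scaled_of_notMem {a ε t : ℝ} (hε : 0 < ε)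
    (ht : t ∉ Ioc a (a + ε)) : deriv Real.smoothTransition ((t - a) / ε) = 0 := by
  refine deriv_smoothTransition_of_notMem fun h => ht ⟨?_, ?_⟩
  · have := (div_pos_iff_of_pos_right hε).1 h.1
    linarith
  · have := (div_le_one hε).1 h.2
    linarith

/-- An approximate identity computing point values of a continuous function. -/
theorem integrableOn_and_setIntegral_deriv_smoothTransition {U : ℝ → ℝ} {S : Set ℝ} {a ε : ℝ}
    (hS : MeasurableSet S)
    (hε : 0 < ε) (hsub : Icc a (a + ε) ⊆ S) (hU : ContinuousOn U (Icc a (a + ε))) :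
    IntegrableOn (fun t => deriv Real.smoothTransition ((t - a) / ε) * ε⁻¹ * U t) S ∧
    ∫ t in S, deriv Real.smoothTransition ((t - a) / ε) * ε⁻¹ * U t =
      ∫ s in (0 : ℝ)..1, deriv Real.smoothTransition s * U (a + ε * s) := by
  set f : ℝ → ℝ := fun t => deriv Real.smoothTransition ((t - a) / ε) * ε⁻¹ * U t with hf
  have hz : ∀ t ∉ Ioc a (a + ε), f t = 0 := fun t ht => by
    simp [hf, deriv_smoothTransition_scaled_of_notMem hε ht]
  have hfc : ContinuousOn f (Icc a (a + ε)) :=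
    ((continuous_deriv_smoothTransition.comp (by fun_prop)).mul
      continuous_const).continuousOn.mul hU
  have hint : IntegrableOn f (Ioc a (a + ε)) :=
    (hfc.integrableOn_compact isCompact_Icc).mono_set Ioc_subset_Icc_self
  have hsub' : Ioc a (a + ε) ⊆ S := Ioc_subset_Icc_self.trans hsub
  constructor
  · refine Integrable.integrableOn ?_
    rw [← integrableOn_iff_integrable_of_support_subset (s := Ioc a (a + ε))]
    · exact hint
    · intro t ht
      by_contra h
      exact ht (hz t h)
  · rw [setIntegral_eq_of_subset_of_forall_sdiff_eq_zero hS hsub' (fun t ht => hz t ht.2),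
      ← intervalIntegral.integral_of_le (by linarith)]
    have h1 := intervalIntegral.integral_comp_mul_add (a := 0) (b := 1) f hε.ne' a
    simp only [mul_zero, zero_add, mul_one] at h1
    rw [add_comm ε a] at h1
    have h2 : ∫ t in a..(a + ε), f t = ε • ∫ s in (0 : ℝ)..1, f (ε * s + a) := by
      rw [h1, smul_smul, mul_inv_cancel₀ hε.ne', one_smul]
    rw [h2, smul_eq_mul, ← intervalIntegral.integral_const_mul]
    refine intervalIntegral.integral_congr fun s _ => ?_
    have h3 : (ε * s + a - a) / ε = s := by field_simp; ring
    simp only [hf, h3, add_comm a]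
    field_simp

/-- The kernel has mass 1 and samples U only to the right of a, so the averages tend to the value at
a by continuity from the right. -/
theorem tendsto_integral_deriv_smoothTransition {U : ℝ → ℝ} {a T : ℝ} (haT : a < T)
    (hU : ContinuousOn U (Ico a T)) :
    Tendsto (fun ε => ∫ s in (0 : ℝ)..1, deriv Real.smoothTransition s * U (a + ε * s))
      (𝓝[>] 0) (𝓝 (U a)) := by
  have h0 : U a = ∫ s in (0 : ℝ)..1, deriv Real.smoothTransition s * U a := by
    rw [intervalIntegral.integral_mul_const, integral_deriv_smoothTransition, one_mul]
  rw [h0]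
  obtain ⟨b, hab, hbT⟩ := exists_between haT
  have hUc : ContinuousOn U (Icc a b) := hU.mono fun t ht => ⟨ht.1, ht.2.trans_lt hbT⟩
  obtain ⟨M, hM⟩ := isCompact_Icc.exists_bound_of_continuousOn hUc
  have hε : ∀ᶠ ε in 𝓝[>] (0 : ℝ), 0 < ε ∧ ε ≤ b - a := by
    filter_upwards [Ioc_mem_nhdsGT (sub_pos.2 hab)] with ε hε using hε
  have hmem : ∀ {ε s : ℝ}, 0 < ε ∧ ε ≤ b - a → s ∈ Icc (0 : ℝ) 1 → a + ε * s ∈ Icc a b := by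
    intro ε s h1 h2
    constructor <;> nlinarith [h1.1, h1.2, h2.1, h2.2]
  refine intervalIntegral.tendsto_integral_filter_of_dominated_convergence
    (fun s => |deriv Real.smoothTransition s| * M) ?_ ?_ ?_ ?_
  · filter_upwards [hε] with ε h1
    refine ContinuousOn.aestronglyMeasurable ?_ measurableSet_uIoc
    refine continuous_deriv_smoothTransition.continuousOn.mul
      (hUc.comp (by fun_prop) fun s hs => hmem h1 ?_)
    rw [uIoc_of_le zero_le_one] at hs
    exact Ioc_subset_Icc_self hs
  · filter_upwards [hε] with ε h1
    refine Eventually.of_forall fun s hs => ?_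
    rw [uIoc_of_le zero_le_one] at hs
    rw [norm_mul, Real.norm_eq_abs]
    gcongr
    exact hM _ (hmem h1 (Ioc_subset_Icc_self hs))
  · exact (continuous_deriv_smoothTransition.abs.mul continuous_const).intervalIntegrable _ _
  · refine Eventually.of_forall fun s hs => ?_
    rw [uIoc_of_le zero_le_one] at hs
    refine Tendsto.const_mul _ ?_
    have h2 : Tendsto U (𝓝[Icc a b] a) (𝓝 (U a)) := hUc a ⟨le_rfl, hab.le⟩
    refine h2.comp (tendsto_nhdsWithin_iff.2 ⟨?_, ?_⟩)
    · have : Tendsto (fun ε : ℝ => a + ε * s) (𝓝 0) (𝓝 (a + 0 * s)) :=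
        (Continuous.tendsto (by fun_prop) 0)
      simpa using this.mono_left nhdsWithin_le_nhds
    · filter_upwards [hε] with ε h1 using hmem h1 (Ioc_subset_Icc_self hs)

/-- A continuous function with integrable weak derivative `-h` is a primitive of `-h`. -/
theorem sub_eq_intervalIntegral_of_weakDeriv {T : ℝ} {U h : ℝ → ℝ} (hU : ContinuousOn U (Ioo 0 T))
    (hh : IntegrableOn h (Ioo 0 T))
    (hweak : ∀ ζ : ℝ → ℝ, ContDiff ℝ ∞ ζ → HasCompactSupport ζ → tsupport ζ ⊆ Ioo 0 T →
      ∫ t in Ioo 0 T, deriv ζ t * U t = ∫ t in Ioo 0 T, ζ t * h t)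
    {a b : ℝ} (ha : 0 < a) (hab : a ≤ b) (hb : b < T) : U a - U b = ∫ t in a..b, h t := by
  have haT : a < T := hab.trans_lt hb
  have e1 := tendsto_integral_deriv_smoothTransition haT
    (hU.mono fun t ht => ⟨ha.trans_le ht.1, ht.2⟩)
  have e2 := tendsto_integral_deriv_smoothTransition hb
    (hU.mono fun t ht => ⟨(ha.trans_le hab).trans_le ht.1, ht.2⟩)
  -- A smooth approximation of the indicator of (a, b]. Its derivative is the difference of two
  -- approximate identities, at a and at b, so the weak equation turns into U a - U b as ε → 0.
  set ζ : ℝ → ℝ → ℝ := fun ε t =>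
    Real.smoothTransition ((t - a) / ε) - Real.smoothTransition ((t - b) / ε) with hζ
  have hsm : ∀ ε, ContDiff ℝ ∞ (ζ ε) := fun ε =>
    (contDiff_smoothTransition.comp (f := fun t : ℝ => (t - a) / ε) (by fun_prop)).sub
      (contDiff_smoothTransition.comp (f := fun t : ℝ => (t - b) / ε) (by fun_prop))
  have hev : ∀ᶠ ε in 𝓝[>] (0 : ℝ), 0 < ε ∧ b + ε < T := by
    filter_upwards [Ioo_mem_nhdsGT (sub_pos.2 hb)] with ε hε
    exact ⟨hε.1, by linarith [hε.2]⟩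
  have hsupp : ∀ {ε}, 0 < ε → Function.support (ζ ε) ⊆ Icc a (b + ε) := by
    intro ε hε t ht
    by_contra h
    refine ht ?_
    rw [mem_Icc, not_and_or, not_le, not_le] at h
    rcases h with h | h
    · have h1 : (t - a) / ε ≤ 0 := div_nonpos_of_nonpos_of_nonneg (by linarith) hε.le
      have h2 : (t - b) / ε ≤ 0 := div_nonpos_of_nonpos_of_nonneg (by linarith) hε.le
      simp [hζ, Real.smoothTransition.zero_of_nonpos h1, Real.smoothTransition.zero_of_nonpos h2]
    · have h1 : 1 ≤ (t - a) / ε := (one_le_div hε).2 (by linarith)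
      have h2 : 1 ≤ (t - b) / ε := (one_le_div hε).2 (by linarith)
      simp [hζ, Real.smoothTransition.one_of_one_le h1, Real.smoothTransition.one_of_one_le h2]
  have e3 : Tendsto (fun ε => ∫ t in Ioo 0 T, ζ ε t * h t) (𝓝[>] 0) (𝓝 (U a - U b)) := by
    refine (e1.sub e2).congr' ?_
    filter_upwards [hev] with ε hε
    have hc : tsupport (ζ ε) ⊆ Icc a (b + ε) := closure_minimal (hsupp hε.1) isClosed_Icc
    rw [← hweak (ζ ε) (hsm ε) (HasCompactSupport.of_support_subset_isCompact isCompact_Icc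
      (hsupp hε.1)) (hc.trans fun t ht => ⟨ha.trans_le ht.1, ht.2.trans_lt hε.2⟩)]
    have s1 : Icc a (a + ε) ⊆ Ioo 0 T := fun t ht =>
      ⟨ha.trans_le ht.1, by linarith [ht.2, hε.2]⟩
    have s2 : Icc b (b + ε) ⊆ Ioo 0 T := fun t ht =>
      ⟨(ha.trans_le hab).trans_le ht.1, by linarith [ht.2, hε.2]⟩
    obtain ⟨i1, j1⟩ := integrableOn_and_setIntegral_deriv_smoothTransition
      (measurableSet_Ioo (a := 0) (b := T)) hε.1 s1 (hU.mono s1)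
    obtain ⟨i2, j2⟩ := integrableOn_and_setIntegral_deriv_smoothTransition
      (measurableSet_Ioo (a := 0) (b := T)) hε.1 s2 (hU.mono s2)
    rw [← j1, ← j2, ← integral_sub i1 i2]
    refine integral_congr_ae (Eventually.of_forall fun t => ?_)
    have : deriv (ζ ε) t = deriv Real.smoothTransition ((t - a) / ε) * ε⁻¹ -
        deriv Real.smoothTransition ((t - b) / ε) * ε⁻¹ :=
      ((hasDerivAt_smoothTransition_scaled a ε t).sub
        (hasDerivAt_smoothTransition_scaled b ε t)).deriv
    simp only [this]
    ring
  have e4 : Tendsto (fun ε => ∫ t in Ioo 0 T, ζ ε t * h t) (𝓝[>] 0)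
      (𝓝 (∫ t in Ioo 0 T, (Ioc a b).indicator h t)) := by
    refine tendsto_integral_filter_of_dominated_convergence (fun t => ‖h t‖) ?_ ?_ hh.norm ?_
    · exact Eventually.of_forall fun ε =>
        (hsm ε).continuous.aestronglyMeasurable.mul hh.aestronglyMeasurable
    · refine Eventually.of_forall fun ε => Eventually.of_forall fun t => ?_
      rw [norm_mul]
      refine mul_le_of_le_one_left (norm_nonneg _) ?_
      rw [Real.norm_eq_abs, abs_le]
      have h1 := Real.smoothTransition.nonneg ((t - a) / ε)
      have h2 := Real.smoothTransition.le_one ((t - a) / ε)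
      have h3 := Real.smoothTransition.nonneg ((t - b) / ε)
      have h4 := Real.smoothTransition.le_one ((t - b) / ε)
      constructor <;> simp only [hζ] <;> linarith
    · have hS : ∀ c t : ℝ, ∀ᶠ ε in 𝓝[>] (0 : ℝ),
          Real.smoothTransition ((t - c) / ε) = if c < t then 1 else 0 := by
        intro c t
        split_ifs with hct
        · filter_upwards [Ioc_mem_nhdsGT (sub_pos.2 hct)] with ε hε
          exact Real.smoothTransition.one_of_one_le ((one_le_div hε.1).2 hε.2)
        · filter_upwards [self_mem_nhdsWithin] with ε hε
          exact Real.smoothTransition.zero_of_nonpos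
            (div_nonpos_of_nonpos_of_nonneg (by linarith) (le_of_lt hε))
      refine Eventually.of_forall fun t => tendsto_const_nhds.congr' ?_
      filter_upwards [hS a t, hS b t] with ε h1 h2
      simp only [hζ, h1, h2, indicator, mem_Ioc]
      by_cases h3 : a < t
      · by_cases h4 : b < t
        · simp [h3, h4]
        · simp [h3, h4, not_lt.1 h4]
      · have h4 : ¬ b < t := fun h => h3 (hab.trans_lt h)
        simp [h3, h4]
  have hsub : Ioc a b ⊆ Ioo 0 T := fun t ht => ⟨ha.trans ht.1, ht.2.trans_lt hb⟩
  rw [tendsto_nhds_unique e3 e4, integral_indicator measurableSet_Ioc,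
    Measure.restrict_restrict measurableSet_Ioc, intervalIntegral.integral_of_le hab,
    inter_eq_left.2 hsub]

end OneDim

/-! ### The weak equation, integrated in time -/

section WeakEquation

variable {n N : ℕ} {Ω : Set (EuclideanSpace ℝ (Fin n))} {T : ℝ}
  {u : ℝ → EuclideanSpace ℝ (Fin n) → EuclideanSpace ℝ (Fin N)}

/-- The pairing `∑ᵢ ⟨A bᵢ, B bᵢ⟩` of linear maps. -/
noncomputable def sumInner {E F ι : Type*} [NormedAddCommGroup E] [NormedSpace ℝ E]
    [NormedAddCommGroup F] [InnerProductSpace ℝ F] [Fintype ι] (b : ι → E) :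
    (E →L[ℝ] F) →L[ℝ] (E →L[ℝ] F) →L[ℝ] ℝ :=
  ∑ i, (innerBilin F).bilinearComp (ContinuousLinearMap.apply ℝ F (b i))
    (ContinuousLinearMap.apply ℝ F (b i))

theorem sumInner_apply {E F ι : Type*} [NormedAddCommGroup E] [NormedSpace ℝ E]
    [NormedAddCommGroup F] [InnerProductSpace ℝ F] [Fintype ι] (b : ι → E) (A B : E →L[ℝ] F) :
    sumInner b A B = ∑ i, inner ℝ (A (b i)) (B (b i)) := by
  simp [sumInner, innerBilin_apply]

/-- The pairing `A^i_α B^i_α` of gradients. -/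
noncomputable def gradPairing (n N : ℕ) :
    (EuclideanSpace ℝ (Fin n) →L[ℝ] EuclideanSpace ℝ (Fin N)) →L[ℝ]
      (EuclideanSpace ℝ (Fin n) →L[ℝ] EuclideanSpace ℝ (Fin N)) →L[ℝ] ℝ :=
  sumInner fun α : Fin n => EuclideanSpace.single α 1

theorem gradPairing_apply
    (A B : EuclideanSpace ℝ (Fin n) →L[ℝ] EuclideanSpace ℝ (Fin N)) :
    gradPairing n N A B = ∑ α : Fin n,
      inner ℝ (A (EuclideanSpace.single α 1)) (B (EuclideanSpace.single α 1)) :=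
  sumInner_apply _ _ _

theorem hasFDerivAt_smul_prod {E F : Type*} [NormedAddCommGroup E] [NormedSpace ℝ E]
    [NormedAddCommGroup F] [NormedSpace ℝ F] {ζ : ℝ → ℝ} {φ : E → F} (hζ : Differentiable ℝ ζ)
    (hφ : Differentiable ℝ φ) (p : E × ℝ) :
    HasFDerivAt (fun p : E × ℝ => ζ p.2 • φ p.1)
      (ζ p.2 • (fderiv ℝ φ p.1).comp (ContinuousLinearMap.fst ℝ E ℝ) +
        (deriv ζ p.2 • ContinuousLinearMap.snd ℝ E ℝ).smulRight (φ p.1)) p := by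
  have h1 : HasFDerivAt (fun p : E × ℝ => ζ p.2)
      (deriv ζ p.2 • ContinuousLinearMap.snd ℝ E ℝ) p :=
    ((hζ p.2).hasDerivAt).comp_hasFDerivAt p hasFDerivAt_snd
  exact h1.smul ((hφ p.1).hasFDerivAt.comp p hasFDerivAt_fst)

theorem memLp_fst {α β : Type*} [MeasurableSpace α] [MeasurableSpace β] {μ : Measure α}
    {ν : Measure β} [SFinite μ] [IsFiniteMeasure ν] {G : Type*} [NormedAddCommGroup G]
    {f : α → G} (hf : MemLp f 2 μ) : MemLp (fun p : α × β => f p.1) 2 (μ.prod ν) := by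
  refine ⟨hf.1.comp_fst, (eLpNorm_prod_le (C := eLpNorm f 2 μ) hf.1.comp_fst
    (Eventually.of_forall fun _ => le_rfl)).trans_lt ?_⟩
  have := hf.2.ne
  finiteness

theorem tendsto_eLpNorm_fst {α β : Type*} [MeasurableSpace α] [MeasurableSpace β] {μ : Measure α}
    {ν : Measure β} [SFinite μ] [IsFiniteMeasure ν] {G : Type*} [NormedAddCommGroup G]
    {f : ℕ → α → G} {g : α → G} (hf : ∀ k, AEStronglyMeasurable (f k) μ)
    (hg : AEStronglyMeasurable g μ)
    (h : Tendsto (fun k => eLpNorm (fun x => f k x - g x) 2 μ) atTop (𝓝 0)) :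
    Tendsto (fun k => eLpNorm (fun p : α × β => f k p.1 - g p.1) 2 (μ.prod ν))
      atTop (𝓝 0) := by
  refine tendsto_of_tendsto_of_tendsto_of_le_of_le tendsto_const_nhds
    (h := fun k => eLpNorm (fun x => f k x - g x) 2 μ * ν univ ^ (1 / (2 : ℝ)))
    ?_ (fun _ => zero_le) (fun k => ?_)
  · have hfin : ν univ ^ (1 / (2 : ℝ)) ≠ ⊤ := by finiteness
    simpa only [zero_mul] using ENNReal.Tendsto.mul_const h (Or.inr hfin)
  · have h1 : AEStronglyMeasurable (fun x => f k x - g x) μ := (hf k).sub hg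
    exact eLpNorm_prod_le (f := fun p : α × β => f k p.1 - g p.1) (h1.comp_fst (β := β))
      (Eventually.of_forall fun _ => le_rfl)

/-- The weak equation tested with products of a function of time and a function of space. -/
theorem weak_eq_time (hΩ : IsOpen Ω) (hu : MemV Ω T u)
    {H : EuclideanSpace ℝ (Fin n) × ℝ →
      EuclideanSpace ℝ (Fin n) →L[ℝ] EuclideanSpace ℝ (Fin N)}
    (hH : MemLp H 2 (volume.restrict (parabolicCylinder Ω T)))
    (hweak : ∀ (w : EuclideanSpace ℝ (Fin n) × ℝ → EuclideanSpace ℝ (Fin N))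
      (Dw : EuclideanSpace ℝ (Fin n) × ℝ →
        EuclideanSpace ℝ (Fin n) × ℝ →L[ℝ] EuclideanSpace ℝ (Fin N)),
      IsH10With (parabolicCylinder Ω T) w Dw →
      ∫ p in parabolicCylinder Ω T, (- inner ℝ (u p.2 p.1) (Dw p (0, 1)) +
          ∑ α : Fin n, inner ℝ (H p (EuclideanSpace.single α 1))
            (Dw p (EuclideanSpace.single α 1, 0))) = 0)
    {φ : EuclideanSpace ℝ (Fin n) → EuclideanSpace ℝ (Fin N)} (hφ : ContDiff ℝ ∞ φ)
    (hφc : HasCompactSupport φ) (hφs : tsupport φ ⊆ Ω) {ζ : ℝ → ℝ} (hζ : ContDiff ℝ ∞ ζ)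
    (hζc : HasCompactSupport ζ) (hζs : tsupport ζ ⊆ Ioo 0 T) :
    ∫ t in Ioo 0 T, deriv ζ t * ∫ x in Ω, inner ℝ (φ x) (u t x) =
      ∫ t in Ioo 0 T, ζ t * ∫ x in Ω, gradPairing n N (H (x, t)) (fderiv ℝ φ x) := by
  have : IsFiniteMeasureOnCompacts (volume : Measure (EuclideanSpace ℝ (Fin n) × ℝ)) :=
    inferInstanceAs (IsFiniteMeasureOnCompacts
      ((volume : Measure (EuclideanSpace ℝ (Fin n))).prod (volume : Measure ℝ)))
  have hφL : MemLp φ 2 (volume.restrict Ω) :=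
    (hφ.continuous.memLp_of_hasCompactSupport hφc).restrict Ω
  have hDφL : MemLp (fderiv ℝ φ) 2 (volume.restrict Ω) :=
    ((hφ.continuous_fderiv (by simp)).memLp_of_hasCompactSupport (hφc.fderiv ℝ)).restrict Ω
  have hζ' : Continuous (deriv ζ) := hζ.continuous_deriv (by simp)
  have hsub : Function.support (fun p : EuclideanSpace ℝ (Fin n) × ℝ => ζ p.2 • φ p.1) ⊆
      tsupport φ ×ˢ tsupport ζ := by
    intro p hp
    rw [Function.mem_support] at hp
    exact ⟨subset_tsupport _ (right_ne_zero_of_smul hp),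
      subset_tsupport _ (left_ne_zero_of_smul hp)⟩
  have hcl : IsClosed (tsupport φ ×ˢ tsupport ζ) :=
    (isClosed_tsupport φ).prod (isClosed_tsupport ζ)
  have hw := hweak _ _ (IsH10With.of_contDiff (U := parabolicCylinder Ω T)
    (φ := fun p : EuclideanSpace ℝ (Fin n) × ℝ => ζ p.2 • φ p.1)
    ((hζ.comp contDiff_snd).smul (hφ.comp contDiff_fst))
    (HasCompactSupport.of_support_subset_isCompact (hφc.isCompact.prod hζc.isCompact) hsub)
    ((closure_minimal hsub hcl).trans (prod_mono hφs hζs)))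
  have hpt : ∀ p : EuclideanSpace ℝ (Fin n) × ℝ,
      - inner ℝ (u p.2 p.1) (fderiv ℝ (fun p : EuclideanSpace ℝ (Fin n) × ℝ =>
          ζ p.2 • φ p.1) p (0, 1)) + ∑ α : Fin n, inner ℝ (H p (EuclideanSpace.single α 1))
        (fderiv ℝ (fun p : EuclideanSpace ℝ (Fin n) × ℝ => ζ p.2 • φ p.1) p
          (EuclideanSpace.single α 1, 0)) =
      ζ p.2 * gradPairing n N (H p) (fderiv ℝ φ p.1) -
        deriv ζ p.2 * inner ℝ (φ p.1) (u p.2 p.1) := by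
    intro p
    rw [(hasFDerivAt_smul_prod (hζ.differentiable (by simp)) (hφ.differentiable (by simp)) p).fderiv,
      gradPairing_apply, Finset.mul_sum]
    simp [real_inner_smul_right, real_inner_comm]
    ring
  simp only [hpt] at hw
  have huL := hu.memLp hΩ
  rw [restrict_parabolicCylinder] at hw huL hH
  obtain ⟨M, hM⟩ := hζc.exists_bound_of_continuous hζ.continuous
  obtain ⟨M', hM'⟩ := hζc.deriv.exists_bound_of_continuous hζ'
  have i1 : Integrable (fun p : EuclideanSpace ℝ (Fin n) × ℝ =>
      ζ p.2 * gradPairing n N (H p) (fderiv ℝ φ p.1))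
      ((volume.restrict Ω).prod (volume.restrict (Ioo 0 T))) :=
    (integrable_bilin (gradPairing n N) hH (memLp_fst hDφL)).bdd_mul
      (hζ.continuous.comp continuous_snd).aestronglyMeasurable
      (Eventually.of_forall fun p => hM p.2)
  have i2 : Integrable (fun p : EuclideanSpace ℝ (Fin n) × ℝ =>
      deriv ζ p.2 * inner ℝ (φ p.1) (u p.2 p.1))
      ((volume.restrict Ω).prod (volume.restrict (Ioo 0 T))) :=
    (integrable_bilin (innerBilin _) (memLp_fst hφL) huL).bdd_mul
      (hζ'.comp continuous_snd).aestronglyMeasurable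
      (Eventually.of_forall fun p => hM' p.2)
  rw [integral_sub i1 i2, integral_prod_symm _ i1, integral_prod_symm _ i2, sub_eq_zero] at hw
  simp only [integral_const_mul] at hw
  exact hw.symm

/-- The weak equation integrated in time, for spatial test functions in `H¹₀(Ω)`. -/
theorem weak_eq_integrated (hΩ : IsOpen Ω) (hT : 0 < T) (hu : MemV Ω T u)
    (hu_zero : TendstoWeakL2 Ω u (𝓝[>] 0) (u 0)) (hu_T : TendstoWeakL2 Ω u (𝓝[<] T) (u T))
    {H : EuclideanSpace ℝ (Fin n) × ℝ →
      EuclideanSpace ℝ (Fin n) →L[ℝ] EuclideanSpace ℝ (Fin N)}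
    (hH : MemLp H 2 (volume.restrict (parabolicCylinder Ω T)))
    (hweak : ∀ (w : EuclideanSpace ℝ (Fin n) × ℝ → EuclideanSpace ℝ (Fin N))
      (Dw : EuclideanSpace ℝ (Fin n) × ℝ →
        EuclideanSpace ℝ (Fin n) × ℝ →L[ℝ] EuclideanSpace ℝ (Fin N)),
      IsH10With (parabolicCylinder Ω T) w Dw →
      ∫ p in parabolicCylinder Ω T, (- inner ℝ (u p.2 p.1) (Dw p (0, 1)) +
          ∑ α : Fin n, inner ℝ (H p (EuclideanSpace.single α 1))
            (Dw p (EuclideanSpace.single α 1, 0))) = 0)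
    {φ : EuclideanSpace ℝ (Fin n) → EuclideanSpace ℝ (Fin N)}
    {Dφ : EuclideanSpace ℝ (Fin n) → EuclideanSpace ℝ (Fin n) →L[ℝ] EuclideanSpace ℝ (Fin N)}
    (hφ : IsH10With Ω φ Dφ) {t : ℝ} (ht : t ∈ Icc 0 T) :
    (∫ x in Ω, inner ℝ (φ x) (u t x)) - (∫ x in Ω, inner ℝ (φ x) (u 0 x)) =
      - ∫ s in (0 : ℝ)..t, ∫ x in Ω, gradPairing n N (H (x, s)) (Dφ x) := by
  have hutL : ∀ {t}, t ∈ Icc 0 T → MemLp (u t) 2 (volume.restrict Ω) := by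
    intro t ht
    rcases ht.1.eq_or_lt with h | h
    · rw [← h]; exact hu_zero.memLp
    rcases ht.2.eq_or_lt with h' | h'
    · rw [h']; exact hu_T.memLp
    · exact hu.memLp_slice t ⟨h, h'⟩
  have hHprod := hH
  rw [restrict_parabolicCylinder] at hHprod
  -- smooth compactly supported test functions
  have smooth : ∀ ψ : EuclideanSpace ℝ (Fin n) → EuclideanSpace ℝ (Fin N), ContDiff ℝ ∞ ψ →
      HasCompactSupport ψ → tsupport ψ ⊆ Ω → ∀ t ∈ Icc 0 T,
      (∫ x in Ω, inner ℝ (ψ x) (u t x)) - (∫ x in Ω, inner ℝ (ψ x) (u 0 x)) =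
      - ∫ s in (0 : ℝ)..t, ∫ x in Ω, gradPairing n N (H (x, s)) (fderiv ℝ ψ x) := by
    intro ψ hψ hc hs
    have hψL : MemLp ψ 2 (volume.restrict Ω) :=
      (hψ.continuous.memLp_of_hasCompactSupport hc).restrict Ω
    have hDψL : MemLp (fderiv ℝ ψ) 2 (volume.restrict Ω) :=
      ((hψ.continuous_fderiv (by simp)).memLp_of_hasCompactSupport (hc.fderiv ℝ)).restrict Ω
    set U : ℝ → ℝ := fun t => ∫ x in Ω, inner ℝ (ψ x) (u t x) with hUdef
    set h : ℝ → ℝ := fun s => ∫ x in Ω, gradPairing n N (H (x, s)) (fderiv ℝ ψ x) with hhdef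
    have hUc : ContinuousOn U (Ioo 0 T) := by
      refine (hu.continuousOn_setIntegral_inner hΩ hc.isCompact hs
        (g := ψ) (hψL.mono_measure (Measure.restrict_mono hs le_rfl))).congr fun t _ => ?_
      refine setIntegral_eq_of_subset_of_forall_sdiff_eq_zero hΩ.measurableSet hs fun x hx => ?_
      rw [image_eq_zero_of_notMem_tsupport hx.2, inner_zero_left]
    have hh : IntegrableOn h (Ioo 0 T) :=
      (integrable_bilin (gradPairing n N) hHprod (memLp_fst hDψL)).integral_prod_right
    have hmain : ∀ {a b : ℝ}, 0 < a → a ≤ b → b < T → U a - U b = ∫ t in a..b, h t :=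
      fun ha hab hb => sub_eq_intervalIntegral_of_weakDeriv hUc hh
        (fun ζ h1 h2 h3 => weak_eq_time hΩ hu hH hweak hψ hc hs h1 h2 h3) ha hab hb
    have hii : IntervalIntegrable h volume 0 T := by
      rw [intervalIntegrable_iff_integrableOn_Ioo_of_le hT.le]
      exact hh
    have hGc : ContinuousOn (fun t => ∫ s in (0 : ℝ)..t, h s) (Icc 0 T) := by
      have := intervalIntegral.continuousOn_primitive_interval' hii left_mem_uIcc
      rwa [uIcc_of_le hT.le] at this
    -- The integrated equation says that P is constant. This holds on (0, T) by the one-variable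
    -- lemma and extends to both endpoints through the weak limits defining u(0) and u(T).
    set P : ℝ → ℝ := fun t => U t + ∫ s in (0 : ℝ)..t, h s with hPdef
    have hsubint : ∀ {a b}, a ∈ Icc 0 T → b ∈ Icc 0 T → IntervalIntegrable h volume a b := by
      intro a b ha hb
      refine hii.mono_set ?_
      rw [uIcc_of_le hT.le]
      exact ordConnected_Icc.uIcc_subset ha hb
    have hP : ∀ {a b : ℝ}, 0 < a → a ≤ b → b < T → P a = P b := by
      intro a b ha hab hb
      have h1 := hmain ha hab hb
      have h2 := intervalIntegral.integral_add_adjacent_intervals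
        (hsubint ⟨le_rfl, hT.le⟩ ⟨ha.le, (hab.trans_lt hb).le⟩)
        (hsubint ⟨ha.le, (hab.trans_lt hb).le⟩ ⟨(ha.trans_le hab).le, hb.le⟩)
      simp only [hPdef]
      linarith
    have hPhalf : ∀ {a : ℝ}, a ∈ Ioo 0 T → P a = P (T / 2) := by
      intro a ha
      rcases le_total a (T / 2) with h1 | h1
      · exact hP ha.1 h1 (by linarith)
      · exact (hP (by linarith) h1 ha.2).symm
    have hP0 : P 0 = P (T / 2) := by
      have l1 : Tendsto P (𝓝[>] 0) (𝓝 (P 0)) := by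
        refine (hu_zero.tendsto ψ hψL).add ?_
        exact (hGc 0 ⟨le_rfl, hT.le⟩).mono_left
          (nhdsWithin_le_iff.2 (mem_of_superset (Ioo_mem_nhdsGT hT) Ioo_subset_Icc_self))
      refine tendsto_nhds_unique l1 (tendsto_const_nhds.congr' ?_)
      filter_upwards [Ioo_mem_nhdsGT hT] with t ht using (hPhalf ht).symm
    have hPT : P T = P (T / 2) := by
      have l1 : Tendsto P (𝓝[<] T) (𝓝 (P T)) := by
        refine (hu_T.tendsto ψ hψL).add ?_
        exact (hGc T ⟨hT.le, le_rfl⟩).mono_left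
          (nhdsWithin_le_iff.2 (mem_of_superset (Ioo_mem_nhdsLT hT) Ioo_subset_Icc_self))
      refine tendsto_nhds_unique l1 (tendsto_const_nhds.congr' ?_)
      filter_upwards [Ioo_mem_nhdsLT hT] with t ht using (hPhalf ht).symm
    intro t ht
    have hPt : P t = P 0 := by
      rcases ht.1.eq_or_lt with h1 | h1
      · rw [← h1]
      rcases ht.2.eq_or_lt with h2 | h2
      · rw [h2, hPT, hP0]
      · rw [hPhalf ⟨h1, h2⟩, hP0]
    simp only [hPdef, intervalIntegral.integral_same, add_zero] at hPt
    linarith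
  obtain ⟨ψ, hψ, hlim, hDlim⟩ := hφ.approx
  have hψL : ∀ k, MemLp (ψ k) 2 (volume.restrict Ω) := fun k =>
    ((hψ k).1.continuous.memLp_of_hasCompactSupport (hψ k).2.1).restrict Ω
  have hDψL : ∀ k, MemLp (fderiv ℝ (ψ k)) 2 (volume.restrict Ω) := fun k =>
    (((hψ k).1.continuous_fderiv (by simp)).memLp_of_hasCompactSupport
      ((hψ k).2.1.fderiv ℝ)).restrict Ω
  have l1 : ∀ {s}, s ∈ Icc 0 T → Tendsto (fun k => ∫ x in Ω, inner ℝ (ψ k x) (u s x)) atTop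
      (𝓝 (∫ x in Ω, inner ℝ (φ x) (u s x))) := by
    intro s hs
    have := tendsto_integral_bilin (innerBilin _) (hutL hs) hψL hφ.memLp hlim
    simpa only [innerBilin_apply, real_inner_comm] using this
  have hHt : MemLp H 2 ((volume.restrict Ω).prod (volume.restrict (Ioo 0 t))) := by
    refine hHprod.mono_measure ?_
    rw [Measure.prod_restrict, Measure.prod_restrict]
    exact Measure.restrict_mono (prod_mono le_rfl (Ioo_subset_Ioo_right ht.2)) le_rfl
  -- As a single integral over the product, the flux term is an L² pairing, so it is continuous in
  -- Dφ and the identity extends from test functions to H¹₀.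
  have hform : ∀ {B : EuclideanSpace ℝ (Fin n) →
      EuclideanSpace ℝ (Fin n) →L[ℝ] EuclideanSpace ℝ (Fin N)},
      MemLp B 2 (volume.restrict Ω) →
      ∫ s in (0 : ℝ)..t, ∫ x in Ω, gradPairing n N (H (x, s)) (B x) =
      ∫ p, gradPairing n N (H p) (B p.1)
        ∂((volume.restrict Ω).prod (volume.restrict (Ioo 0 t))) := by
    intro B hB
    rw [integral_prod_symm _ (integrable_bilin (gradPairing n N) hHt (memLp_fst hB)),
      intervalIntegral.integral_of_le ht.1, integral_Ioc_eq_integral_Ioo]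
  have l2 := tendsto_integral_bilin (gradPairing n N) hHt (fun k => memLp_fst (hDψL k))
    (memLp_fst hφ.memLp_deriv) (tendsto_eLpNorm_fst (fun k => (hDψL k).1) hφ.memLp_deriv.1 hDlim)
  rw [hform hφ.memLp_deriv]
  refine tendsto_nhds_unique ((l1 ht).sub (l1 ⟨le_rfl, hT.le⟩)) (l2.neg.congr fun k => ?_)
  rw [smooth (ψ k) (hψ k).1 (hψ k).2.1 (hψ k).2.2 t ht, hform (hDψL k)]

end WeakEquation

/-! ### Translations and Steklov averages -/

section Translation

variable {E G₁ G₂ : Type*} [NormedAddCommGroup G₁] [NormedSpace ℝ G₁] [NormedAddCommGroup G₂]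
  [NormedSpace ℝ G₂]

/-- Continuity of translation in L², read off from the continuous action of the translation group on
`Lp`. -/
theorem tendsto_eLpNorm_translate {X G : Type*} [NormedAddCommGroup X] [NormedSpace ℝ X]
    [FiniteDimensional ℝ X] [MeasurableSpace X] [BorelSpace X] {μ : Measure X} [μ.IsAddHaarMeasure]
    [NormedAddCommGroup G] {f : X → G} (hf : MemLp f 2 μ) :
    Tendsto (fun a : X => eLpNorm (fun p => f (a + p) - f p) 2 μ) (𝓝 0) (𝓝 0) := by
  have : Fact ((1 : ℝ≥0∞) ≤ 2) := ⟨one_le_two⟩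
  have : Fact ((2 : ℝ≥0∞) ≠ ⊤) := ⟨by norm_num⟩
  have h1 : Continuous fun a : X => (DomAddAct.mk a) +ᵥ hf.toLp f :=
    Continuous.vadd DomAddAct.continuous_mk continuous_const
  have h2 := (h1.tendsto 0).edist (tendsto_const_nhds (x := hf.toLp f))
  have h3 : DomAddAct.mk (0 : X) +ᵥ hf.toLp f = hf.toLp f := by
    rw [DomAddAct.mk_vadd_toLp]
    simp
  simp only [h3, edist_self] at h2
  refine h2.congr fun a => ?_
  rw [DomAddAct.mk_vadd_toLp, Lp.edist_toLp_toLp]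
  rfl

variable [MeasurableSpace E] {μ : Measure E} [SFinite μ]

theorem measurePreserving_sub_snd (r : ℝ) :
    MeasurePreserving (fun p : E × ℝ => (p.1, p.2 - r)) (μ.prod volume) (μ.prod volume) :=
  (MeasurePreserving.id μ).prod (measurePreserving_sub_right volume r)

theorem lintegral_enorm_bilin_le {α G₃ : Type*} [MeasurableSpace α] {μ : Measure α}
    [NormedAddCommGroup G₃] [NormedSpace ℝ G₃] (L : G₁ →L[ℝ] G₂ →L[ℝ] G₃) {f : α → G₁}
    {g : α → G₂} (hf : AEStronglyMeasurable f μ) (hg : AEStronglyMeasurable g μ) :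
    ∫⁻ x, ‖L (f x) (g x)‖ₑ ∂μ ≤ ‖L‖ₑ * eLpNorm f 2 μ * eLpNorm g 2 μ := by
  rw [← eLpNorm_one_eq_lintegral_enorm]
  refine eLpNorm_le_eLpNorm_mul_eLpNorm_of_nnnorm (p := 2) (q := 2) hf hg (fun a b => L a b)
    ‖L‖₊ (Eventually.of_forall fun x => ?_)
  exact L.le_opNorm₂ _ _

theorem memLp_sub_snd {G : Type*} [NormedAddCommGroup G] {f : E × ℝ → G} (hf : MemLp f 2 (μ.prod volume)) (r : ℝ) :
    MemLp (fun p : E × ℝ => f (p.1, p.2 - r)) 2 (μ.prod volume) :=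
  hf.comp_measurePreserving (measurePreserving_sub_snd r)

/-- For each shift r, Cauchy–Schwarz and translation invariance bound the integral over (x, t)
independently of r, and r ranges over a bounded interval. Strong measurability of f and g themselves
lets them be composed with (t, r, x) ↦ (x, t - r) without tracking null sets. -/
theorem integrable_translate_bilin (L : G₁ →L[ℝ] G₂ →L[ℝ] ℝ) {f : E × ℝ → G₁} {g : E × ℝ → G₂}
    (hfm : StronglyMeasurable f) (hgm : StronglyMeasurable g) (hf : MemLp f 2 (μ.prod volume))
    (hg : MemLp g 2 (μ.prod volume)) (h : ℝ) :
    Integrable (fun q : (ℝ × ℝ) × E => L (f (q.2, q.1.1 - q.1.2)) (g (q.2, q.1.1)))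
      (((volume : Measure ℝ).prod (volume.restrict (Ioc 0 h))).prod μ) := by
  have m1 : StronglyMeasurable (fun q : (ℝ × ℝ) × E => f (q.2, q.1.1 - q.1.2)) :=
    hfm.comp_measurable (by fun_prop)
  have m2 : StronglyMeasurable (fun q : (ℝ × ℝ) × E => g (q.2, q.1.1)) :=
    hgm.comp_measurable (by fun_prop)
  have m3 : StronglyMeasurable
      (fun q : (ℝ × ℝ) × E => L (f (q.2, q.1.1 - q.1.2)) (g (q.2, q.1.1))) :=
    (L.continuous₂.comp_stronglyMeasurable (m1.prodMk m2))
  refine ⟨m3.aestronglyMeasurable, ?_⟩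
  have m4 := m3.enorm
  rw [HasFiniteIntegral, lintegral_prod _ m4.aemeasurable,
    lintegral_prod_symm _ m4.lintegral_prod_right'.aemeasurable]
  have hle : ∀ r : ℝ, ∫⁻ t, ∫⁻ x, ‖L (f (x, t - r)) (g (x, t))‖ₑ ∂μ ≤
      ‖L‖ₑ * eLpNorm f 2 (μ.prod volume) * eLpNorm g 2 (μ.prod volume) := by
    intro r
    have m5 : StronglyMeasurable (fun p : E × ℝ => f (p.1, p.2 - r)) :=
      hfm.comp_measurable (by fun_prop)
    have m6 : StronglyMeasurable (fun p : E × ℝ => L (f (p.1, p.2 - r)) (g p)) :=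
      L.continuous₂.comp_stronglyMeasurable (m5.prodMk hgm)
    have h1 := lintegral_prod_symm (μ := μ) (ν := (volume : Measure ℝ))
      (fun p : E × ℝ => ‖L (f (p.1, p.2 - r)) (g p)‖ₑ) m6.enorm.aemeasurable
    rw [← h1]
    refine (lintegral_enorm_bilin_le L m5.aestronglyMeasurable hg.1).trans (le_of_eq ?_)
    rw [← eLpNorm_comp_measurePreserving hf.1 (measurePreserving_sub_snd r)]
    rfl
  refine (lintegral_mono hle).trans_lt ?_
  rw [lintegral_const, Measure.restrict_apply_univ, Real.volume_Ioc]
  have := hf.2.ne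
  have := hg.2.ne
  finiteness

theorem integrableOn_integral_translate_bilin (L : G₁ →L[ℝ] G₂ →L[ℝ] ℝ) {f : E × ℝ → G₁}
    {g : E × ℝ → G₂}
    (hfm : StronglyMeasurable f) (hgm : StronglyMeasurable g) (hf : MemLp f 2 (μ.prod volume))
    (hg : MemLp g 2 (μ.prod volume)) (h : ℝ) :
    IntegrableOn (fun r => ∫ p, L (f (p.1, p.2 - r)) (g p) ∂(μ.prod volume)) (Ioc 0 h) := by
  have h1 := (integrable_translate_bilin L hfm hgm hf hg h).integral_prod_left.integral_prod_right
  refine h1.congr (Eventually.of_forall fun r => ?_)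
  exact (integral_prod_symm _ (integrable_bilin L (memLp_sub_snd hf r) hg)).symm

theorem integral_integral_translate_bilin (L : G₁ →L[ℝ] G₂ →L[ℝ] ℝ) {f : E × ℝ → G₁}
    {g : E × ℝ → G₂}
    (hfm : StronglyMeasurable f) (hgm : StronglyMeasurable g) (hf : MemLp f 2 (μ.prod volume))
    (hg : MemLp g 2 (μ.prod volume)) (h : ℝ) :
    ∫ t, ∫ r in Ioc 0 h, ∫ x, L (f (x, t - r)) (g (x, t)) ∂μ =
      ∫ r in Ioc 0 h, ∫ p, L (f (p.1, p.2 - r)) (g p) ∂(μ.prod volume) := by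
  have h1 := (integrable_translate_bilin L hfm hgm hf hg h).integral_prod_left
  rw [integral_integral_swap (f := fun t r => ∫ x, L (f (x, t - r)) (g (x, t)) ∂μ) h1]
  refine integral_congr_ae (Eventually.of_forall fun r => ?_)
  exact (integral_prod_symm _ (integrable_bilin L (memLp_sub_snd hf r) hg)).symm

end Translation

/-! ### The energy inequality -/

section Energy

theorem IsH10With.congr_deriv {E F : Type*} [NormedAddCommGroup E] [NormedSpace ℝ E]
    [MeasureSpace E] [NormedAddCommGroup F] [NormedSpace ℝ F] {U : Set E} {w : E → F}
    {Dw Dw' : E → E →L[ℝ] F} (h : IsH10With U w Dw) (hD : Dw =ᵐ[volume.restrict U] Dw') :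
    IsH10With U w Dw' := by
  obtain ⟨φ, h1, h2, h3⟩ := h.approx
  refine ⟨h.memLp, h.memLp_deriv.ae_eq hD, φ, h1, h2, h3.congr fun k => eLpNorm_congr_ae ?_⟩
  filter_upwards [hD] with x hx
  rw [hx]

variable {n N : ℕ} {Ω : Set (EuclideanSpace ℝ (Fin n))} {T : ℝ}
  {u : ℝ → EuclideanSpace ℝ (Fin n) → EuclideanSpace ℝ (Fin N)}

/-- The energy `∫_Ω Ψ(u(t))` of the part of `u` above the level `k`. -/
noncomputable def truncEnergy (Ω : Set (EuclideanSpace ℝ (Fin n))) (k : ℝ)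
    (f : EuclideanSpace ℝ (Fin n) → EuclideanSpace ℝ (Fin N)) : ℝ :=
  ∫ x in Ω, truncPotential k (f x)

theorem integrable_truncPotential {α : Type*} [MeasurableSpace α] {μ : Measure α} (k : ℝ)
    {f : α → EuclideanSpace ℝ (Fin N)} (hf : MemLp f 2 μ) :
    Integrable (fun x => truncPotential k (f x)) μ := by
  refine (hf.integrable_norm_pow two_ne_zero).mono'
    ((continuous_truncPotential k).comp_aestronglyMeasurable hf.1)
    (Eventually.of_forall fun x => ?_)
  rw [Real.norm_of_nonneg (truncPotential_nonneg _ _)]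
  exact truncPotential_le k (f x)

theorem memLp_truncField {α : Type*} [MeasurableSpace α] {μ : Measure α} (k : ℝ)
    {f : α → EuclideanSpace ℝ (Fin N)} (hf : MemLp f 2 μ) :
    MemLp (fun x => truncField k (f x)) 2 μ :=
  (lipschitzWith_truncField k).comp_memLp (by simp [truncField]) hf

/-- The integrated subgradient inequality at f. With f = u(t) and g an earlier state it replaces the
chain rule for d/dt ∫ Ψ(u), which is unavailable because u_t is not a function. -/
theorem truncEnergy_sub_le (k : ℝ)
    {f g : EuclideanSpace ℝ (Fin n) → EuclideanSpace ℝ (Fin N)}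
    (hf : MemLp f 2 (volume.restrict Ω)) (hg : MemLp g 2 (volume.restrict Ω)) :
    truncEnergy Ω k f - truncEnergy Ω k g ≤
      (∫ x in Ω, inner ℝ (truncField k (f x)) (f x)) -
        ∫ x in Ω, inner ℝ (truncField k (f x)) (g x) := by
  have hw := memLp_truncField k hf
  have i1 : Integrable (fun x => inner ℝ (truncField k (f x)) (f x)) (volume.restrict Ω) :=
    integrable_bilin (innerBilin _) hw hf
  have i2 : Integrable (fun x => inner ℝ (truncField k (f x)) (g x)) (volume.restrict Ω) :=
    integrable_bilin (innerBilin _) hw hg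
  rw [truncEnergy, truncEnergy, ← integral_sub (integrable_truncPotential k hf)
    (integrable_truncPotential k hg), ← integral_sub i1 i2]
  refine integral_mono ((integrable_truncPotential k hf).sub (integrable_truncPotential k hg))
    (i1.sub i2) fun x => ?_
  have := inner_truncField_le k (g x) (f x)
  rw [inner_sub_right] at this
  simp only
  linarith

/-- The energy on a compact set is lower semicontinuous from the left. -/
theorem eventually_truncEnergy_ge (hΩ : IsOpen Ω) (hT : 0 < T) (hu : MemV Ω T u)
    (hu_T : TendstoWeakL2 Ω u (𝓝[<] T) (u T)) (k : ℝ) {b : ℝ} (hb : b ∈ Ioc 0 T)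
    (hub : MemLp (u b) 2 (volume.restrict Ω))
    {K : Set (EuclideanSpace ℝ (Fin n))} (hK : IsCompact K) (hKΩ : K ⊆ Ω) {ε : ℝ} (hε : 0 < ε) :
    ∀ᶠ t in 𝓝[<] b, truncEnergy K k (u b) - ε ≤ truncEnergy Ω k (u t) := by
  have hle : (volume : Measure (EuclideanSpace ℝ (Fin n))).restrict K ≤ volume.restrict Ω :=
    Measure.restrict_mono hKΩ le_rfl
  have hw := memLp_truncField k hub
  have hlim : Tendsto (fun t => ∫ x in K, inner ℝ (truncField k (u b x)) (u t x)) (𝓝[<] b)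
      (𝓝 (∫ x in K, inner ℝ (truncField k (u b x)) (u b x))) := by
    -- At b = T only the weak L² limit is available; at interior times weak continuity on K serves.
    rcases hb.2.eq_or_lt with h | h
    · subst h
      have h1 := hu_T.tendsto _ (hw.indicator hK.measurableSet)
      have h2 : ∀ t, ∫ x in Ω, inner ℝ (K.indicator (fun x => truncField k (u b x)) x) (u t x) =
          ∫ x in K, inner ℝ (truncField k (u b x)) (u t x) := by
        intro t
        have h3 : (fun x => inner ℝ (K.indicator (fun x => truncField k (u b x)) x) (u t x)) =
            K.indicator fun x => (inner ℝ (truncField k (u b x)) (u t x) : ℝ) := by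
          ext x
          by_cases hx : x ∈ K <;> simp [hx]
        rw [h3, integral_indicator hK.measurableSet, Measure.restrict_restrict hK.measurableSet,
          inter_eq_left.2 hKΩ]
      simpa only [h2] using h1
    · exact ((hu.continuousOn_setIntegral_inner hΩ hK hKΩ (hw.mono_measure hle)).continuousAt
        (Ioo_mem_nhds hb.1 h)).tendsto.mono_left nhdsWithin_le_nhds
  filter_upwards [hlim.eventually_const_lt (sub_lt_self _ hε), Ioo_mem_nhdsLT hb.1] with t ht ht'
  have hut : MemLp (u t) 2 (volume.restrict Ω) := hu.memLp_slice t ⟨ht'.1, ht'.2.trans_le hb.2⟩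
  -- Convexity at u(b) with the fixed field `truncField k (u b)`: the energy drop on K is at most a
  -- pairing of this field with u(b) - u(t), which weak convergence makes small.
  have h1 := truncEnergy_sub_le (Ω := K) k (hub.mono_measure hle) (hut.mono_measure hle)
  have h2 : truncEnergy K k (u t) ≤ truncEnergy Ω k (u t) :=
    setIntegral_mono_set (integrable_truncPotential k hut)
      (Eventually.of_forall fun x => truncPotential_nonneg _ _) hKΩ.eventuallyLE
  linarith

/-- One backward time step of the energy. -/
theorem truncEnergy_step (hT : 0 < T)
    (hutL : ∀ t ∈ Icc 0 T, MemLp (u t) 2 (volume.restrict Ω)) (k : ℝ)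
    {H : EuclideanSpace ℝ (Fin n) × ℝ →
      EuclideanSpace ℝ (Fin n) →L[ℝ] EuclideanSpace ℝ (Fin N)}
    (hH : MemLp H 2 volume) (hH0 : ∀ p ∉ parabolicCylinder Ω T, H p = 0)
    {t : ℝ} (ht : t ∈ Icc 0 T)
    {Dw : EuclideanSpace ℝ (Fin n) → EuclideanSpace ℝ (Fin n) →L[ℝ] EuclideanSpace ℝ (Fin N)}
    (hw : IsH10With Ω (fun x => truncField k (u t x)) Dw)
    (heq : ∀ s ∈ Icc 0 T, (∫ x in Ω, inner ℝ (truncField k (u t x)) (u s x)) -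
      (∫ x in Ω, inner ℝ (truncField k (u t x)) (u 0 x)) =
      - ∫ r in (0 : ℝ)..s, ∫ x in Ω, gradPairing n N (H (x, r)) (Dw x))
    {h : ℝ} (hh : 0 ≤ h) :
    truncEnergy Ω k (u t) - truncEnergy Ω k (u (max (t - h) 0)) ≤
      - ∫ r in Ioc 0 h, ∫ x in Ω, gradPairing n N (H (x, t - r)) (Dw x) := by
  -- Before time 0 the solution is frozen at u(0). The flux H vanishes there, so the window (t - h,
  -- t) can be kept in full on the right-hand side.
  set a := max (t - h) 0 with ha
  have haT : a ∈ Icc 0 T := ⟨le_max_right _ _, max_le (by linarith [ht.2]) hT.le⟩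
  refine (truncEnergy_sub_le k (hutL t ht) (hutL a haT)).trans (le_of_eq ?_)
  set g : ℝ → ℝ := fun s => ∫ x in Ω, gradPairing n N (H (x, s)) (Dw x) with hg
  have hint : ∀ c d, IntervalIntegrable g volume c d := by
    intro c d
    rw [intervalIntegrable_iff]
    have : IsFiniteMeasure ((volume : Measure ℝ).restrict (uIoc c d)) :=
      ⟨by rw [Measure.restrict_apply_univ]; simp [uIoc]⟩
    have hH' : MemLp H 2 ((volume.restrict Ω).prod (volume.restrict (uIoc c d))) := by
      refine hH.mono_measure ?_
      rw [Measure.prod_restrict]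
      exact Measure.restrict_le_self
    exact (integrable_bilin (gradPairing n N) hH' (memLp_fst hw.memLp_deriv)).integral_prod_right
  have e1 := heq t ht
  have e2 := heq a haT
  have e3 := intervalIntegral.integral_add_adjacent_intervals (hint 0 a) (hint a t)
  have e4 := intervalIntegral.integral_add_adjacent_intervals (hint (t - h) a) (hint a t)
  have e5 : ∫ s in (t - h)..a, g s = 0 := by
    rcases le_total (t - h) 0 with h1 | h1
    · rw [ha, max_eq_right h1]
      refine (intervalIntegral.integral_congr_ae (g := fun _ => 0) ?_).trans (by simp)
      refine Eventually.of_forall fun s hs => ?_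
      rw [uIoc_of_le h1] at hs
      have h2 : ∀ x, H (x, s) = 0 := fun x => hH0 _ fun hx => by
        have := hx.2.1
        exact absurd hs.2 (not_le.2 this)
      simp [hg, h2]
    · rw [ha, max_eq_left h1, intervalIntegral.integral_same]
  have e6 : ∫ r in Ioc 0 h, ∫ x in Ω, gradPairing n N (H (x, t - r)) (Dw x) =
      ∫ s in (t - h)..t, g s := by
    rw [← intervalIntegral.integral_of_le hh]
    have := intervalIntegral.integral_comp_sub_left (a := 0) (b := h) g t
    rw [sub_zero] at this
    exact this
  rw [e6, ← e4, e5]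
  linarith

end Energy

/-! ### The maximum principle -/

section Boundedness

theorem ae_ae_of_ae_prod_symm {α β : Type*} [MeasurableSpace α] [MeasurableSpace β]
    {μ : Measure α} {ν : Measure β} [SFinite μ] [SFinite ν] {p : α × β → Prop}
    (h : ∀ᵐ z ∂μ.prod ν, p z) : ∀ᵐ y ∂ν, ∀ᵐ x ∂μ, p (x, y) :=
  Measure.ae_ae_of_ae_prod (p := fun z => p z.swap)
    (Measure.measurePreserving_swap.quasiMeasurePreserving.ae h)

theorem ae_memLp_slice {α β G : Type*} [MeasurableSpace α] [MeasurableSpace β]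
    {μ : Measure α} {ν : Measure β} [SFinite μ] [SFinite ν] [NormedAddCommGroup G]
    {f : α × β → G} (hf : MemLp f 2 (μ.prod ν)) :
    ∀ᵐ y ∂ν, MemLp (fun x => f (x, y)) 2 μ := by
  filter_upwards [hf.1.prodMk_right, (hf.integrable_norm_pow two_ne_zero).prod_left_ae]
    with y h1 h2
  exact (memLp_two_iff_integrable_sq_norm h1).2 h2

variable {n N : ℕ} {Ω : Set (EuclideanSpace ℝ (Fin n))} {T : ℝ}
  {u : ℝ → EuclideanSpace ℝ (Fin n) → EuclideanSpace ℝ (Fin N)}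

/-- The truncations of `u` above its boundary level lie in `H¹₀(Ω)` at almost every time. -/
theorem ae_isH10With_truncField (hΩ : IsOpen Ω) (hu : MemV Ω T u)
    {v : ℕ → EuclideanSpace ℝ (Fin n) × ℝ → EuclideanSpace ℝ (Fin N)}
    {Du : EuclideanSpace ℝ (Fin n) × ℝ →
      EuclideanSpace ℝ (Fin n) →L[ℝ] EuclideanSpace ℝ (Fin N)}
    (hv : ∀ k, ContDiffOn ℝ 1 (v k) (parabolicCylinder Ω T))
    (hDv : ∀ k, MemLp (spatialDeriv (v k)) 2 (volume.restrict (parabolicCylinder Ω T)))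
    (hDu : MemLp Du 2 (volume.restrict (parabolicCylinder Ω T)))
    (h1 : Tendsto (fun k => ⨆ t ∈ Ioo 0 T,
      eLpNorm (fun x => v k (x, t) - u t x) 2 (volume.restrict Ω)) atTop (𝓝 0))
    (h2 : Tendsto (fun k => eLpNorm (fun p => spatialDeriv (v k) p - Du p) 2
      (volume.restrict (parabolicCylinder Ω T))) atTop (𝓝 0)) (k : ℝ) :
    ∀ᵐ t ∂volume.restrict (Ioo 0 T),
      (∃ k' < k, MemH10 Ω (fun x => max (‖u t x‖ - k') 0)) →
      IsH10With Ω (fun x => truncField k (u t x))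
        (fun x => (fderiv ℝ (truncField k) (u t x)).comp (Du (x, t))) := by
  rw [restrict_parabolicCylinder] at hDu h2
  simp only [restrict_parabolicCylinder] at hDv
  -- Gradients converge in L² of the cylinder, hence on almost every time slice along a subsequence;
  -- the functions themselves converge on every slice by the supremum in the V norm.
  obtain ⟨ns, hns, hlim⟩ := exists_subseq_slice_tendsto (fun j => (hDv j).1) hDu.1 h2
  filter_upwards [hlim, ae_memLp_slice hDu, ae_restrict_mem measurableSet_Ioo] with t h3 h4 ht
  rintro ⟨k', hk', hmem⟩
  refine isH10With_truncField (v := fun j x => v (ns j) (x, t)) hΩ (hu.memLp_slice t ht) h4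
    (fun j => contDiffOn_slice (hv (ns j)) ht) ?_ h3 hk' hmem
  exact tendsto_of_tendsto_of_tendsto_of_le_of_le tendsto_const_nhds
    (h1.comp hns.tendsto_atTop) (fun _ => zero_le) (fun j => le_iSup_slice
      (f := fun t => eLpNorm (fun x => v (ns j) (x, t) - u t x) 2 (volume.restrict Ω)) ht)

/-- Provides zero extensions of the flux and of the test gradient to all times, in strongly
measurable form, so that they may be shifted in time. -/
theorem exists_stronglyMeasurable_indicator {α G : Type*} [MeasurableSpace α] {μ : Measure α}
    [NormedAddCommGroup G] {U : Set α} (hU : MeasurableSet U) {f : α → G}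
    (hf : MemLp f 2 (μ.restrict U)) :
    ∃ g : α → G, StronglyMeasurable g ∧ MemLp g 2 μ ∧ (∀ p ∉ U, g p = 0) ∧
      ∀ᵐ p ∂μ.restrict U, g p = f p := by
  refine ⟨U.indicator (hf.1.mk f), hf.1.stronglyMeasurable_mk.indicator hU,
    (memLp_indicator_iff_restrict hU).2 (hf.ae_eq hf.1.ae_eq_mk),
    fun p hp => indicator_of_notMem hp _, ?_⟩
  filter_upwards [hf.1.ae_eq_mk, ae_restrict_mem hU] with p h1 h2
  rw [indicator_of_mem h2, h1]

theorem truncEnergy_of_ae_le {k : ℝ} {f : EuclideanSpace ℝ (Fin n) → EuclideanSpace ℝ (Fin N)}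
    (h : ∀ᵐ x ∂volume.restrict Ω, ‖f x‖ ≤ k) : truncEnergy Ω k f = 0 := by
  rw [truncEnergy]
  refine integral_eq_zero_of_ae ?_
  filter_upwards [h] with x hx using truncPotential_of_le hx

/-- A time average of the energy is bounded by a time average of the dissipation. -/
theorem integral_energy_le {E J : ℝ → ℝ} {M : ℝ → ℝ} {b h : ℝ} (hh : 0 < h) (hhb : h < b)
    (hE : IntervalIntegrable E volume 0 b) (hE0 : E 0 = 0)
    (hM : Integrable M) (hM0 : ∀ t ∉ Ioo 0 b, M t = 0)
    (hMJ : ∫ t, M t = ∫ r in Ioc 0 h, J r)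
    (hstep : ∀ᵐ t ∂volume.restrict (Ioo 0 b), E t - E (max (t - h) 0) ≤ -M t) :
    ∫ t in (b - h)..b, E t ≤ -∫ r in Ioc 0 h, J r := by
  have hb : 0 < b := hh.trans hhb
  have hsub : ∀ {c d}, c ∈ Icc 0 b → d ∈ Icc 0 b → IntervalIntegrable E volume c d := by
    intro c d hc hd
    refine hE.mono_set ?_
    rw [uIcc_of_le hb.le]
    exact ordConnected_Icc.uIcc_subset hc hd
  have m0 : (0 : ℝ) ∈ Icc 0 b := ⟨le_rfl, hb.le⟩
  have mb : b ∈ Icc 0 b := ⟨hb.le, le_rfl⟩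
  have mbh : b - h ∈ Icc 0 b := ⟨by linarith, by linarith⟩
  -- The shifted energy vanishes on (0, h] since E 0 = 0, and on (h, b] it is a translate of E.
  -- Subtracting the two integrals leaves exactly the last window (b - h, b).
  have p1 : EqOn (fun t => E (max (t - h) 0)) (fun _ => 0) (uIoc 0 h) := by
    intro t ht
    rw [uIoc_of_le hh.le] at ht
    simp only
    rw [max_eq_right (by linarith [ht.2]), hE0]
  have p2 : EqOn (fun t => E (max (t - h) 0)) (fun t => E (t - h)) (uIoc h b) := by
    intro t ht
    rw [uIoc_of_le hhb.le] at ht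
    simp only
    rw [max_eq_left (by linarith [ht.1])]
  have i1 : IntervalIntegrable (fun t => E (max (t - h) 0)) volume 0 h :=
    (intervalIntegrable_const (c := (0 : ℝ))).congr p1.symm
  have i2' : IntervalIntegrable (fun t => E (t - h)) volume h b := by
    simpa using (hsub m0 mbh).comp_sub_right h
  have i2 : IntervalIntegrable (fun t => E (max (t - h) 0)) volume h b := i2'.congr p2.symm
  have v1 : ∫ t in (0 : ℝ)..h, E (max (t - h) 0) = 0 := by
    rw [intervalIntegral.integral_congr_ae (g := fun _ => (0 : ℝ))
      (Eventually.of_forall fun t ht => p1 ht)]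
    simp
  have v2 : ∫ t in h..b, E (max (t - h) 0) = ∫ t in (0 : ℝ)..(b - h), E t := by
    rw [intervalIntegral.integral_congr_ae (g := fun t => E (t - h))
      (Eventually.of_forall fun t ht => p2 ht), intervalIntegral.integral_comp_sub_right, sub_self]
  have v3 := intervalIntegral.integral_add_adjacent_intervals i1 i2
  have v4 := intervalIntegral.integral_add_adjacent_intervals (hsub m0 mbh) (hsub mbh mb)
  have i3 := i1.trans i2
  have hmono : ∫ t in Ioo 0 b, (E t - E (max (t - h) 0)) ≤ ∫ t in Ioo 0 b, -M t := by
    refine integral_mono_ae ?_ hM.neg.integrableOn hstep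
    rw [← IntegrableOn, ← intervalIntegrable_iff_integrableOn_Ioo_of_le hb.le]
    exact hE.sub i3
  rw [← integral_Ioc_eq_integral_Ioo, ← intervalIntegral.integral_of_le hb.le,
    intervalIntegral.integral_sub hE i3, integral_neg,
    setIntegral_eq_integral_of_forall_compl_eq_zero hM0, hMJ] at hmono
  linarith

/-- If `|u| ≤ k` initially and on the lateral boundary up to the time `b`, then `|u(b)| ≤ k`. -/
theorem IsWeakSolution.ae_norm_le (hΩ : IsOpen Ω) (hT : 0 < T)
    {Φ : EuclideanSpace ℝ (Fin N) → ℝ} {lam Lam : ℝ} (hΦ : IsDiffusionPotential Φ lam Lam)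
    {φ : ℝ → ℝ} (hφ : ∀ z, Φ z = φ ‖z‖) (hu : IsWeakSolution Ω T Φ u)
    (hu_zero : TendstoWeakL2 Ω u (𝓝[>] 0) (u 0)) (hu_T : TendstoWeakL2 Ω u (𝓝[<] T) (u T))
    {k : ℝ} (hk : 0 ≤ k) {b : ℝ} (hb : b ∈ Ioc 0 T)
    (h0 : ∀ᵐ x ∂volume.restrict Ω, ‖u 0 x‖ ≤ k)
    (hbd : ∀ᵐ s ∂volume.restrict (Ioo 0 b),
      ∃ k' < k, MemH10 Ω (fun x => max (‖u s x‖ - k') 0)) :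
    ∀ᵐ x ∂volume.restrict Ω, ‖u b x‖ ≤ k := by
  have hV := hu.memV
  obtain ⟨H₀, hwd, hH₀, hweak₀⟩ := hu.weak_eq
  obtain ⟨v, Du, hv, hvb, hDv, hDu, h1, h2⟩ := hV.approx
  have hutL : ∀ t ∈ Icc 0 T, MemLp (u t) 2 (volume.restrict Ω) := by
    intro t ht
    rcases ht.1.eq_or_lt with h | h
    · rw [← h]; exact hu_zero.memLp
    rcases ht.2.eq_or_lt with h' | h'
    · rw [h']; exact hu_T.memLp
    · exact hV.memLp_slice t ⟨h, h'⟩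
  have hUm : MeasurableSet (parabolicCylinder Ω T) := (isOpen_parabolicCylinder hΩ T).measurableSet
  have hUbm : MeasurableSet (parabolicCylinder Ω b) :=
    (isOpen_parabolicCylinder hΩ b).measurableSet
  have hUb : parabolicCylinder Ω b ⊆ parabolicCylinder Ω T :=
    prod_mono le_rfl (Ioo_subset_Ioo_right hb.2)
  obtain ⟨H, hHm, hH, hHz, hHeq⟩ := exists_stronglyMeasurable_indicator hUm hH₀
  have hweak : ∀ (w : EuclideanSpace ℝ (Fin n) × ℝ → EuclideanSpace ℝ (Fin N))
      (Dw : EuclideanSpace ℝ (Fin n) × ℝ →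
        EuclideanSpace ℝ (Fin n) × ℝ →L[ℝ] EuclideanSpace ℝ (Fin N)),
      IsH10With (parabolicCylinder Ω T) w Dw →
      ∫ p in parabolicCylinder Ω T, (- inner ℝ (u p.2 p.1) (Dw p (0, 1)) +
          ∑ α : Fin n, inner ℝ (H p (EuclideanSpace.single α 1))
            (Dw p (EuclideanSpace.single α 1, 0))) = 0 := by
    intro w Dw hw
    refine Eq.trans (integral_congr_ae ?_) (hweak₀ w Dw hw)
    filter_upwards [hHeq] with p hp
    rw [hp]
  have hgrad0 : gradient Φ 0 = 0 := by
    have : fderiv ℝ Φ 0 = 0 := by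
      ext η
      exact fderiv_radial_apply_eq_zero (hΦ.contDiff.differentiable two_ne_zero) hφ (by simp)
    simp [gradient, this]
  have huL := hV.memLp hΩ
  have hchain : ∀ᵐ p ∂volume.restrict (parabolicCylinder Ω T),
      H₀ p = (fderiv ℝ (gradient Φ) (u p.2 p.1)).comp (Du p) :=
    IsWeakSpatialDeriv.ae_eq_of_tendsto hΩ hΦ.contDiff_gradient hgrad0 (C := ‖Lam‖₊)
      hΦ.norm_fderiv_gradient_le hv (fun j => memLp_parabolicCylinder hΩ (hv j) (hvb j)) hDv huL hDu
      (tendsto_eLpNorm_parabolicCylinder hΩ hV hv h1) h2 hwd hH₀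
  have hW₀ : MemLp (fun p => (fderiv ℝ (truncField k) (u p.2 p.1)).comp (Du p)) 2
      (volume.restrict (parabolicCylinder Ω b)) :=
    (memLp_bilin_of_bound (ContinuousLinearMap.compL ℝ (EuclideanSpace ℝ (Fin n)) _ _)
      ((continuous_fderiv_truncField k).comp_aestronglyMeasurable huL.1)
      (Eventually.of_forall fun _ => norm_fderiv_truncField_le k _) hDu).mono_measure
        (Measure.restrict_mono hUb le_rfl)
  -- The test gradient is cut off at time b, so the boundary condition enters only for times before
  -- b.
  obtain ⟨W, hWm, hW, hWz, hWeq⟩ := exists_stronglyMeasurable_indicator hUbm hW₀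
  have hm : (volume.restrict Ω).prod (volume : Measure ℝ) ≤
      (volume : Measure (EuclideanSpace ℝ (Fin n) × ℝ)) := by
    have : (volume.restrict Ω).prod (volume : Measure ℝ) =
        (volume : Measure (EuclideanSpace ℝ (Fin n) × ℝ)).restrict (Ω ×ˢ univ) := by
      rw [Measure.volume_eq_prod, ← Measure.prod_restrict, Measure.restrict_univ]
    rw [this]
    exact Measure.restrict_le_self
  have hHL := hH.mono_measure hm
  have hWL := hW.mono_measure hm
  -- The dissipation with the flux delayed by r. At r = 0 it is the true dissipation up to time b.
  set J : ℝ → ℝ := fun r => ∫ p, gradPairing n N (H (p.1, p.2 - r)) (W p)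
    ∂((volume.restrict Ω).prod volume) with hJ
  have hJlim : Tendsto J (𝓝 0) (𝓝 (J 0)) := by
    have : (volume : Measure (EuclideanSpace ℝ (Fin n) × ℝ)).IsAddHaarMeasure :=
      inferInstanceAs ((volume : Measure (EuclideanSpace ℝ (Fin n))).prod
        (volume : Measure ℝ)).IsAddHaarMeasure
    have t1 : Tendsto (fun r : ℝ => ((0, -r) : EuclideanSpace ℝ (Fin n) × ℝ)) (𝓝 0) (𝓝 0) := by
      have : Continuous fun r : ℝ => ((0, -r) : EuclideanSpace ℝ (Fin n) × ℝ) := by fun_prop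
      have h := this.tendsto 0
      rw [neg_zero] at h
      exact h
    have t2 := (tendsto_eLpNorm_translate hH).comp t1
    refine tendsto_integral_bilin (gradPairing n N).flip hWL (memLp_sub_snd hHL)
      (memLp_sub_snd hHL 0) (tendsto_of_tendsto_of_tendsto_of_le_of_le tendsto_const_nhds t2
        (fun _ => zero_le) (fun r => ?_))
    refine (eLpNorm_mono_measure _ hm).trans (le_of_eq ?_)
    simp only [Function.comp_def, sub_zero]
    congr 1
    ext1 p
    congr 2
    ext1 <;> simp [sub_eq_neg_add]
  -- The chain rule identifies both factors as Hessians of radial potentials applied to the same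
  -- `Du`, so the pointwise inequality applies in each coordinate direction.
  have hJ0 : 0 ≤ J 0 := by
    refine integral_nonneg_of_ae (hm.absolutelyContinuous.ae_le ?_)
    rw [ae_restrict_iff' hUm] at hHeq hchain
    rw [ae_restrict_iff' hUbm] at hWeq
    filter_upwards [hHeq, hchain, hWeq] with p a1 a2 a3
    simp only [sub_zero, Prod.mk.eta, Pi.zero_apply]
    by_cases hp : p ∈ parabolicCylinder Ω b
    · rw [a1 (hUb hp), a2 (hUb hp), a3 hp, gradPairing_apply]
      exact Finset.sum_nonneg fun α _ => hΦ.inner_fderiv_truncField_nonneg hφ k _ _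
    · rw [hWz p hp, map_zero]
  set E : ℝ → ℝ := fun t => truncEnergy Ω k (u t) with hE
  have hE0 : E 0 = 0 := truncEnergy_of_ae_le h0
  have hEint : IntervalIntegrable E volume 0 b := by
    rw [intervalIntegrable_iff_integrableOn_Ioo_of_le hb.1.le]
    have := huL.mono_measure (Measure.restrict_mono hUb le_rfl)
    rw [restrict_parabolicCylinder] at this
    exact (integrable_truncPotential k this).integral_prod_right
  have hrestr : volume.restrict (Ioo 0 b) ≤ volume.restrict (Ioo 0 T) :=
    Measure.restrict_mono (Ioo_subset_Ioo_right hb.2) le_rfl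
  have hslice : ∀ᵐ t ∂volume.restrict (Ioo 0 b),
      IsH10With Ω (fun x => truncField k (u t x)) (fun x => W (x, t)) := by
    rw [restrict_parabolicCylinder] at hWeq
    filter_upwards [hrestr.absolutelyContinuous.ae_le
      (ae_isH10With_truncField hΩ hV hv hDv hDu h1 h2 k), hbd,
      ae_ae_of_ae_prod_symm hWeq] with t a1 a2 a3
    refine (a1 a2).congr_deriv ?_
    filter_upwards [a3] with x hx using hx.symm
  have havg : ∀ h, 0 < h → h < b → ∫ t in (b - h)..b, E t ≤ -∫ r in Ioc 0 h, J r := by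
    intro h hh hhb
    refine integral_energy_le hh hhb hEint hE0 (M := fun t => ∫ r in Ioc 0 h, ∫ x in Ω,
      gradPairing n N (H (x, t - r)) (W (x, t))) ?_ ?_ ?_ ?_
    · exact (integrable_translate_bilin (gradPairing n N) hHm hWm hHL
        hWL h).integral_prod_left.integral_prod_left
    · intro t ht
      have : ∀ x, W (x, t) = 0 := fun x => hWz _ fun hx => ht hx.2
      simp [this]
    · exact integral_integral_translate_bilin (gradPairing n N) hHm hWm hHL hWL h
    · filter_upwards [hslice, ae_restrict_mem measurableSet_Ioo] with t ht htb
      have htT : t ∈ Icc 0 T := ⟨htb.1.le, htb.2.le.trans hb.2⟩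
      exact truncEnergy_step hT hutL k hH hHz htT ht
        (fun s hs => weak_eq_integrated hΩ hT hV hu_zero hu_T (hH.restrict _) hweak ht hs) hh.le
  have hK : ∀ K : Set (EuclideanSpace ℝ (Fin n)), IsCompact K → K ⊆ Ω →
      truncEnergy K k (u b) ≤ 0 := by
    intro K hK hKΩ
    refine le_of_forall_pos_le_add fun ε hε => ?_
    have e1 := eventually_truncEnergy_ge hΩ hT hV hu_T k hb (hutL b ⟨hb.1.le, hb.2⟩) hK hKΩ
      (half_pos hε)
    obtain ⟨c, hcb, hc⟩ := mem_nhdsLT_iff_exists_Ioo_subset.1 e1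
    obtain ⟨δ, hδ, hδJ⟩ := Metric.eventually_nhds_iff.1
      (hJlim.eventually_const_lt (sub_lt_self (J 0) (half_pos hε)))
    -- One h small enough for three purposes: the window stays in (0, b), the energy there exceeds
    -- its value at b on K minus ε/2, and J > J 0 - ε/2 ≥ -ε/2 for shifts up to h.
    obtain ⟨h, hh, hh'⟩ := exists_between
      (lt_min (lt_min hb.1 (sub_pos.2 (mem_Iio.1 hcb))) hδ)
    have hhb : h < b := hh'.trans_le ((min_le_left _ _).trans (min_le_left _ _))
    have hhc : h < b - c := hh'.trans_le ((min_le_left _ _).trans (min_le_right _ _))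
    have hhδ : h < δ := hh'.trans_le (min_le_right _ _)
    have l1 : h * (truncEnergy K k (u b) - ε / 2) ≤ ∫ t in (b - h)..b, E t := by
      have := intervalIntegral.integral_mono_on_of_le_Ioo (a := b - h) (b := b)
        (f := fun _ => truncEnergy K k (u b) - ε / 2) (g := E) (by linarith)
        intervalIntegrable_const (hEint.mono_set (by
          rw [uIcc_of_le hb.1.le, uIcc_of_le (by linarith)]
          exact Icc_subset_Icc_left (by linarith)))
        (fun t ht => hc ⟨by linarith [ht.1], ht.2⟩)
      rw [intervalIntegral.integral_const, smul_eq_mul, sub_sub_cancel] at this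
      exact this
    have l2 : h * (-(ε / 2)) ≤ ∫ r in Ioc 0 h, J r := by
      have := setIntegral_mono_on (μ := volume) (s := Ioc 0 h) (f := fun _ => -(ε / 2)) (g := J)
        (integrableOn_const (by simp))
        (integrableOn_integral_translate_bilin (gradPairing n N) hHm hWm hHL hWL h)
        measurableSet_Ioc (fun r hr => ?_)
      · simpa [hh.le] using this
      · have := hδJ (y := r) (by
          rw [Real.dist_0_eq_abs, abs_of_pos hr.1]
          exact hr.2.trans_lt hhδ)
        linarith
    have l3 := havg h hh hhb
    have l4 : h * (truncEnergy K k (u b) - ε) ≤ 0 := by nlinarith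
    have l5 : truncEnergy K k (u b) - ε ≤ 0 := nonpos_of_mul_nonpos_right l4 hh
    linarith
  have hubL := hutL b ⟨hb.1.le, hb.2⟩
  have hae : ∀ K : Set (EuclideanSpace ℝ (Fin n)), IsCompact K → K ⊆ Ω →
      ∀ᵐ x ∂volume.restrict K, ‖u b x‖ ≤ k := by
    intro K hKc hKΩ
    have hint := integrable_truncPotential k
      (hubL.mono_measure (Measure.restrict_mono hKΩ le_rfl))
    have hz : truncEnergy K k (u b) = 0 := le_antisymm (hK K hKc hKΩ)
      (integral_nonneg fun x => truncPotential_nonneg _ _)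
    rw [truncEnergy, integral_eq_zero_iff_of_nonneg (fun x => truncPotential_nonneg _ _) hint] at hz
    filter_upwards [hz] with x hx
    by_contra h
    exact (truncPotential_pos hk (not_le.1 h)).ne' hx
  -- The exceptional set is null near each point of Ω, hence null, because compact neighbourhoods
  -- inside Ω exist.
  rw [ae_restrict_iff' hΩ.measurableSet, ae_iff]
  refine measure_null_of_locally_null _ fun x hx => ?_
  simp only [mem_ofPred_eq, Classical.not_imp] at hx
  obtain ⟨K, hKn, hKΩ, hKc⟩ := local_compact_nhds (hΩ.mem_nhds hx.1)
  refine ⟨_, inter_mem_nhdsWithin _ hKn, ?_⟩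
  have := hae K hKc hKΩ
  rw [ae_restrict_iff' hKc.measurableSet, ae_iff] at this
  refine measure_mono_null (fun y hy => ?_) this
  simp only [mem_inter_iff, mem_ofPred_eq, Classical.not_imp] at hy ⊢
  exact ⟨hy.2, hy.1.2⟩

/-- Passing to a measurable representative makes the exceptional set measurable, so its measure is
computed slice by slice. -/
theorem eLpNorm_top_prod_le {α β G : Type*} [MeasurableSpace α] [MeasurableSpace β]
    {μ : Measure α} {ν : Measure β} [SFinite μ] [SFinite ν] [NormedAddCommGroup G]
    {f : α × β → G} (hf : AEStronglyMeasurable f (μ.prod ν)) {C : ℝ≥0∞}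
    (h : ∀ᵐ t ∂ν, eLpNorm (fun x => f (x, t)) ⊤ μ ≤ C) : eLpNorm f ⊤ (μ.prod ν) ≤ C := by
  rw [eLpNorm_congr_ae hf.ae_eq_mk, eLpNorm_exponent_top]
  refine essSup_le_of_ae_le C ?_
  have hs : MeasurableSet {p | ¬ ‖hf.mk f p‖ₑ ≤ C} :=
    (measurableSet_le hf.stronglyMeasurable_mk.enorm measurable_const).compl
  change (μ.prod ν) {p | ¬ ‖hf.mk f p‖ₑ ≤ C} = 0
  rw [Measure.prod_apply_symm hs, lintegral_eq_zero_iff (measurable_measure_prodMk_right hs)]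
  filter_upwards [h, ae_ae_of_ae_prod_symm hf.ae_eq_mk] with t h1 h2
  rw [eLpNorm_exponent_top] at h1
  change ∀ᵐ x ∂μ, ‖hf.mk f (x, t)‖ₑ ≤ C
  filter_upwards [h2, ae_le_eLpNormEssSup (f := fun x => f (x, t)) (μ := μ)] with x h3 h4
  rw [← h3]
  exact h4.trans h1

end Boundedness

theorem mainTheorem5 {n N : ℕ} (Ω : Set (EuclideanSpace ℝ (Fin n))) (hΩ : IsOpen Ω)
    (T : ℝ) (hT : 0 < T)
    (Φ : EuclideanSpace ℝ (Fin N) → ℝ) (lam Lam : ℝ) (hΦ : IsDiffusionPotential Φ lam Lam)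
    (hrad : ∃ φ : ℝ → ℝ, ∀ z, Φ z = φ ‖z‖)
    (u : ℝ → EuclideanSpace ℝ (Fin n) → EuclideanSpace ℝ (Fin N))
    (hu : IsWeakSolution Ω T Φ u)
    (hu_zero : TendstoWeakL2 Ω u (𝓝[>] 0) (u 0))
    (hu_T : TendstoWeakL2 Ω u (𝓝[<] T) (u T)) :
    (∀ t ∈ Icc 0 T,
      eLpNorm (u t) ⊤ (volume.restrict Ω) ≤
        max (eLpNorm (u 0) ⊤ (volume.restrict Ω))
          (essSup (fun s => boundaryNorm Ω (u s)) (volume.restrict (Ioo 0 t)))) ∧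
    (eLpNorm (u 0) ⊤ (volume.restrict Ω) < ⊤ →
      essSup (fun s => boundaryNorm Ω (u s)) (volume.restrict (Ioo 0 T)) < ⊤ →
      eLpNorm (fun p : EuclideanSpace ℝ (Fin n) × ℝ => u p.2 p.1) ⊤
        (volume.restrict (parabolicCylinder Ω T)) < ⊤) := by
  obtain ⟨φ, hφ⟩ := hrad
  have main : ∀ t ∈ Icc 0 T, eLpNorm (u t) ⊤ (volume.restrict Ω) ≤
      max (eLpNorm (u 0) ⊤ (volume.restrict Ω))
        (essSup (fun s => boundaryNorm Ω (u s)) (volume.restrict (Ioo 0 t))) := by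
    intro t ht
    rcases ht.1.eq_or_lt with h0 | h0
    · rw [← h0]
      exact le_max_left _ _
    -- Work with a level c strictly above the maximum. At almost every time s the infimum defining
    -- the boundary norm is then below c, which yields an admissible k' < c, possibly depending on
    -- s; this is the gap needed for the truncation to be in H¹₀.
    refine le_of_forall_gt_imp_ge_of_dense fun c hc => ?_
    rcases eq_or_ne c ⊤ with rfl | hctop
    · exact le_top
    obtain ⟨hc1, hc2⟩ := max_lt_iff.1 hc
    lift c to ℝ≥0 using hctop
    have hae : ∀ᵐ x ∂volume.restrict Ω, ‖u t x‖ ≤ c := by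
      refine hu.ae_norm_le hΩ hT hΦ hφ hu_zero hu_T c.2 ⟨h0, ht.2⟩ ?_ ?_
      · rw [eLpNorm_exponent_top] at hc1
        filter_upwards [ae_le_eLpNormEssSup (f := u 0) (μ := volume.restrict Ω)] with x hx
        exact_mod_cast hx.trans hc1.le
      · filter_upwards [ENNReal.ae_le_essSup (μ := volume.restrict (Ioo 0 t))
          fun s => boundaryNorm Ω (u s)] with s hs
        obtain ⟨k', hk'⟩ := iInf_lt_iff.1 (hs.trans_lt hc2)
        obtain ⟨hmem, hlt⟩ := iInf_lt_iff.1 hk'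
        exact ⟨k', by exact_mod_cast hlt, hmem⟩
    rw [eLpNorm_exponent_top]
    exact (eLpNormEssSup_le_of_ae_bound hae).trans (by simp)
  refine ⟨main, fun h1 h2 => ?_⟩
  refine lt_of_le_of_lt ?_ (max_lt h1 h2)
  have hm := hu.memV.aestronglyMeasurable
  rw [restrict_parabolicCylinder] at hm ⊢
  refine eLpNorm_top_prod_le hm ?_
  filter_upwards [ae_restrict_mem measurableSet_Ioo] with t ht
  refine (main t ⟨ht.1.le, ht.2.le⟩).trans (max_le_max le_rfl ?_)
  exact essSup_mono_measure
    (Measure.restrict_mono (Ioo_subset_Ioo_right ht.2.le) le_rfl).absolutelyContinuous
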